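/- Let $\alpha>\tfrac12$, $\alpha\notin\mathbb{N}$, $\nu=\alpha-\tfrac12$, $\kappa,\sigma>0$, $m\in\mathbb{N}_0$, and let $\{\alpha\}=\alpha-\lfloor\alpha\rfloor$. Let $\big(\sum_{i=0}^m a_ix^i\big)/\big(\sum_{i=0}^m b_ix^i\big)$ be the best approximation of $x^{\{\alpha\}}$ in the supremum norm on $[0,1]$ among quotients of polynomials of degree at most $m$ whose denominator has no zero on $[0,1]$; put $P_m(x)=\sum_{i=0}^m a_ix^{m-i}$, $Q_m(x)=\sum_{i=0}^m b_ix^{m-i}$, and let $P_m(x)/Q_m(x)=k+\sum_{i=1}^m c_i/(x-p_i)$ be the (real) partial fraction decomposition. With $A=\sqrt2\,\kappa^{2\nu}\Gamma(\nu+\tfrac12)/\Gamma(\nu)$ define the spectral densities $$f_0(w)=\frac{A\sigma^2\kappa^{-2\alpha}\,k}{(1+\kappa^{-2}w^2)^{\lfloor\alpha\rfloor}},\qquad f_i(w)=\frac{A\sigma^2\kappa^{-2\alpha}\,c_i}{(1+\kappa^{-2}w^2)^{\lfloor\alpha\rfloor}(1+\kappa^{-2}w^2-p_i)}\quad(1\le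 i\le m),$$ and the covariance functions $\varrho_i(h)=(2\pi)^{-1/2}\int_{\mathbb{R}}e^{\mathrm{i}wh}f_i(w)\,dw$; except that, if $\alpha<1$, $\varrho_0(h)=k\sigma^2\frac{\Gamma(\alpha)}{\Gamma(\alpha-1/2)}\frac{\sqrt{4\pi}}{\kappa}\,1_{[h=0]}$. Let $N_0=\max(\lfloor\alpha\rfloor-1,0)$, $N_i=\lfloor\alpha\rfloor$ for $i\ge1$, and $\mathbf r_i(s,t)=\big[\partial_s^{k'}\partial_t^{\ell'}\varrho_i(s-t)\big]_{0\le k',\ell'\le N_i}$. Let $I\subset\mathbb{R}$ be an interval with more than one point, let $i\in\{0,\dots,m\}$, and let $u_i$ be a centered Gaussian process on $I$ with $\operatorname{Cov}(u_i(s),u_i(t))=\varrho_i(s-t)$. Then $u_i$ has mean-square derivatives on $I$ up to order $N_i$. Let $t_1<t_2<\dots<t_n$ be locations in $I$, let $\mathbf u_{i,j}=[u_i(t_j),u_i'(t_j),\dots,u_i^{(N_i)}(t_j)]$, and $\mathbf u_i=[\mathbf u_{i,1},\dots,\mathbf u_{i,n}]$. Then $\mathbf u_i$ is a centered Gaussian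 vector whose covariance matrix is the block matrix $[\mathbf r_i(t_j,t_l)]_{j,l=1}^n$; this matrix is positive definite, and the precision matrix $\mathbf Q=[\mathbf r_i(t_j,t_l)]_{j,l}^{-1}$ of $\mathbf u_i$, with blocks $\mathbf Q_{j,l}$ of size $(N_i+1)\times(N_i+1)$, is block tridiagonal: $\mathbf Q_{j,l}=\mathbf 0$ for $|j-l|>1$. Moreover, the matrices that are inverted below are invertible, and: 1. If $n\ge2$, then $$\begin{bmatrix}\mathbf Q_{1,1}&\mathbf Q_{1,2}\\ \mathbf Q_{2,1}&\mathbf M\end{bmatrix}=\begin{bmatrix}\mathbf r_i(t_1,t_1)&\mathbf r_i(t_1,t_2)\\ \mathbf r_i(t_2,t_1)&\mathbf r_i(t_2,t_2)\end{bmatrix}^{-1}$$ for some block $\mathbf M$, with $\mathbf M=\mathbf Q_{2,2}$ if $n=2$. 2. For $j\in\{2,\dots,n-1\}$, $$\begin{bmatrix}\mathbf M_1&\mathbf M_2&\mathbf 0\\ \mathbf M_3&\mathbf Q_{j,j}&\mathbf Q_{j,j+1}\\ \mathbf 0&\mathbf Q_{j+1,j}&\mathbf M_4\end{bmatrix}=\Big[\mathbf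 r_i(t_a,t_b)\Big]_{a,b\in\{j-1,j,j+1\}}^{-1}$$ for some blocks $\mathbf M_1,\mathbf M_2,\mathbf M_3,\mathbf M_4$, with $\mathbf M_4=\mathbf Q_{n,n}$ if $j=n-1$. -/

import Mathlib

open MeasureTheory ProbabilityTheory Filter Topology

namespace RationalMatern

/-! ### The best rational approximation of `x ^ θ` on `[0, 1]` -/

/-- The ascending polynomial `∑ i, a i * x ^ i`. -/
noncomputable def ascPoly {m : ℕ} (a : Fin (m + 1) → ℝ) (x : ℝ) : ℝ :=
  ∑ i : Fin (m + 1), a i * x ^ (i : ℕ)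

/-- The polynomial with reversed coefficients, `∑ i, a i * x ^ (m - i)`. -/
noncomputable def revPoly {m : ℕ} (a : Fin (m + 1) → ℝ) (x : ℝ) : ℝ :=
  ∑ i : Fin (m + 1), a i * x ^ (m - (i : ℕ))

/-- `(∑ a i x ^ i) / (∑ b i x ^ i)` is a best approximation of `x ^ θ` in the supremum norm on
`[0, 1]`, among all quotients of polynomials of degree at most `m` whose denominator has no zero
on `[0, 1]`. -/
structure IsBestRationalApprox {m : ℕ} (θ : ℝ) (a b : Fin (m + 1) → ℝ) : Prop where
  denom_ne_zero : ∀ x ∈ Set.Icc (0 : ℝ) 1, ascPoly b x ≠ 0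
  best : ∀ a' b' : Fin (m + 1) → ℝ, (∀ x ∈ Set.Icc (0 : ℝ) 1, ascPoly b' x ≠ 0) →
    ∀ E : ℝ, (∀ x ∈ Set.Icc (0 : ℝ) 1, |x ^ θ - ascPoly a' x / ascPoly b' x| ≤ E) →
      ∀ x ∈ Set.Icc (0 : ℝ) 1, |x ^ θ - ascPoly a x / ascPoly b x| ≤ E

/-- `k + ∑ i, c i / (x - p i)` is the partial fraction decomposition of `P_m / Q_m`, where
`P_m` and `Q_m` have the reversed coefficients. -/
def IsPartialFraction {m : ℕ} (a b : Fin (m + 1) → ℝ) (k : ℝ) (c p : Fin m → ℝ) : Prop :=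
  ∀ x : ℝ, revPoly b x ≠ 0 → revPoly a x / revPoly b x = k + ∑ i : Fin m, c i / (x - p i)

/-! ### Spectral densities and covariance functions of the components -/

/-- `A = √2 κ^(2ν) Γ(ν + 1/2) / Γ(ν)` with `ν = α - 1/2`. -/
noncomputable def specConst (α κ : ℝ) : ℝ :=
  Real.sqrt 2 * κ ^ (2 * (α - 1 / 2)) * Real.Gamma (α - 1 / 2 + 1 / 2) / Real.Gamma (α - 1 / 2)

/-- The spectral density of the component `i`: the index `0` is the one with the constant `k`,
and the index `i.succ` is the one with the pole `p i`. -/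
noncomputable def specDensity {m : ℕ} (α κ σ k : ℝ) (c p : Fin m → ℝ) (i : Fin (m + 1)) (w : ℝ) :
    ℝ :=
  specConst α κ * σ ^ 2 * κ ^ (-2 * α) *
    Fin.cases (k / (1 + w ^ 2 / κ ^ 2) ^ ⌊α⌋₊)
      (fun j : Fin m => c j / ((1 + w ^ 2 / κ ^ 2) ^ ⌊α⌋₊ * (1 + w ^ 2 / κ ^ 2 - p j))) i

/-- The covariance function with the (even, integrable) spectral density `f`, in the symmetric
normalisation `(2π)^(-1/2) ∫ exp(iwh) f(w) dw` of the Fourier transform. -/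
noncomputable def spectralCov (f : ℝ → ℝ) (h : ℝ) : ℝ :=
  ((1 / Real.sqrt (2 * Real.pi) : ℝ) *
    ∫ w : ℝ, Complex.exp (Complex.I * w * h) * (f w : ℂ) : ℂ).re

/-- The covariance function of the component `i`. When `α < 1` the component `0` has a constant
spectral density, and it is the process of uncorrelated variables with the variance
`k σ² c_α √(4π) / κ`, `c_α = Γ(α) / Γ(α - 1/2)`. -/
noncomputable def componentCov {m : ℕ} (α κ σ k : ℝ) (c p : Fin m → ℝ) (i : Fin (m + 1)) (h : ℝ) :
    ℝ :=
  open Classical in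
  if i = 0 ∧ α < 1 then
    if h = 0 then
      k * σ ^ 2 * (Real.Gamma α / Real.Gamma (α - 1 / 2) * Real.sqrt (4 * Real.pi) / κ)
    else 0
  else spectralCov (specDensity α κ σ k c p i) h

/-- The number of derivatives of the component `i` that are used: `max (⌊α⌋ - 1) 0` for `i = 0`
(natural number subtraction), and `⌊α⌋` for `i > 0`. -/
noncomputable def maxOrder {m : ℕ} (α : ℝ) (i : Fin (m + 1)) : ℕ :=
  Fin.cases (⌊α⌋₊ - 1) (fun _ : Fin m => ⌊α⌋₊) i

/-- The multivariate covariance function of a stationary process with covariance function `ρ`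
and its first `N` derivatives: the entry `(k, l)` is `∂ₛᵏ ∂ₜˡ ρ(s - t)`. -/
noncomputable def multiCov (N : ℕ) (ρ : ℝ → ℝ) (s t : ℝ) :
    Matrix (Fin (N + 1)) (Fin (N + 1)) ℝ :=
  Matrix.of fun k l =>
    iteratedDeriv (k : ℕ) (fun x => iteratedDeriv (l : ℕ) (fun y => ρ (x - y)) t) s

/-! ### Block matrices -/

/-- The block matrix with the blocks `r (s j) (s l)`. -/
def blockCov {d q : ℕ} (r : ℝ → ℝ → Matrix (Fin q) (Fin q) ℝ) (s : Fin d → ℝ) :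
    Matrix (Fin d × Fin q) (Fin d × Fin q) ℝ :=
  Matrix.of fun x y => r (s x.1) (s y.1) x.2 y.2

/-- The block `(j, l)` of a block matrix. -/
def blk {d q : ℕ} (M : Matrix (Fin d × Fin q) (Fin d × Fin q) ℝ) (j l : Fin d) :
    Matrix (Fin q) (Fin q) ℝ :=
  Matrix.of fun x y => M (j, x) (l, y)

/-- All the blocks off the three central block diagonals vanish. -/
def IsBlockTridiagonal {d q : ℕ} (M : Matrix (Fin d × Fin q) (Fin d × Fin q) ℝ) : Prop :=
  ∀ j l : Fin d, ((j : ℕ) + 1 < l ∨ (l : ℕ) + 1 < j) → blk M j l = 0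

/-! ### Processes -/

variable {Ω : Type*} [MeasurableSpace Ω]

/-- On `I`, the process `u` is a centered Gaussian process with stationary covariance `ρ`. -/
structure IsCenteredGaussianProcessOn (P : Measure Ω) (I : Set ℝ) (u : ℝ → Ω → ℝ) (ρ : ℝ → ℝ) :
    Prop where
  gaussian : IsGaussianProcess (fun (t : I) ω => u t ω) P
  mean_zero : ∀ t ∈ I, ∫ ω, u t ω ∂P = 0
  cov_eq : ∀ s ∈ I, ∀ t ∈ I, cov[u s, u t; P] = ρ (s - t)

/-- On `I`, the process `v` is the derivative of the process `u` in the mean-square sense. -/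
def IsMeanSquareDerivOn (P : Measure Ω) (I : Set ℝ) (u v : ℝ → Ω → ℝ) : Prop :=
  ∀ t ∈ I, MemLp (v t) 2 P ∧
    Tendsto (fun s => eLpNorm (fun ω => (u s ω - u t ω) / (s - t) - v t ω) 2 P)
      (𝓝[I \ {t}] t) (𝓝 0)

/-- On `I`, `D 0, …, D N` are the process `u` and its mean-square derivatives up to order `N`. -/
structure IsMeanSquareDerivSeqOn (P : Measure Ω) (I : Set ℝ) (u : ℝ → Ω → ℝ) (N : ℕ)
    (D : ℕ → ℝ → Ω → ℝ) : Prop where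
  zero : ∀ t ∈ I, D 0 t = u t
  succ : ∀ k < N, IsMeanSquareDerivOn P I (D k) (D (k + 1))

/-- The covariance matrix of a finite family of random variables. -/
noncomputable def covarianceMatrix {ι : Type*} (P : Measure Ω) (X : ι → Ω → ℝ) : Matrix ι ι ℝ :=
  Matrix.of fun x y => cov[X x, X y; P]

/-- The random vector `X` is centered Gaussian with the precision matrix `Q`: its covariance
matrix is positive definite and has the inverse `Q`. -/
structure IsCenteredGaussianWithPrecision {ι : Type*} [Fintype ι] [DecidableEq ι]
    (P : Measure Ω) (X : ι → Ω → ℝ) (Q : Matrix ι ι ℝ) : Prop where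
  gaussian : HasGaussianLaw (fun ω x => X x ω) P
  mean_zero : ∀ x, ∫ ω, X x ω ∂P = 0
  posDef : (covarianceMatrix P X).PosDef
  inv_eq : (covarianceMatrix P X)⁻¹ = Q

/-- The concatenated vector of the values of `D 0, …, D N` at the locations `t 0, t 1, …`. -/
def stackedVector {n : ℕ} (N : ℕ) (D : ℕ → ℝ → Ω → ℝ) (t : Fin n → ℝ) :
    Fin n × Fin (N + 1) → Ω → ℝ :=
  fun x => D (x.2 : ℕ) (t x.1)

end RationalMatern

namespace RationalMatern

/-! ### Zeros of generalized polynomials -/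

/-! The argument has three layers: nondegeneracy of the rational approximation, the Markov property
of a rational spectral density, and linear algebra for Markov covariances.

Approximation. Since `0 < Int.fract α < 1`, the function `x ^ θ * q - p` is a generalized
polynomial, and Rolle's theorem bounds its positive zeros (`card_zeros_lt`). If the reduced form `p
/ q` of a best approximation were degenerate, the error would have so few zeros that a tangent
direction of the family of quotients could follow its sign and decrease its norm
(`not_best_of_few_zeros`). So the reduced form has full degree and a numerator that does not vanish
at the origin (`IsBestRationalApprox.exists_coprime`). For the partial fractions this means `k ≠ 0`,
`c i ≠ 0` and distinct poles; the poles are below `1` because the denominator has no zero on `[0,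
1]`.

Markov property. Outside the white noise case the spectral density is therefore a nonzero constant
times the inverse of a product of `N + 1` factors `w² + lam l²`, with `N` the number of derivatives.
The constant is positive because a process with this covariance is given, and variances are
nonnegative. For `h > 0` the covariance function satisfies a linear differential equation of order
`N + 1` (`hasDerivAt_spectralOp_charPoly`), so the vector of the process and its `N` derivatives has
a covariance that factors through any intermediate time (`derivCov_markov`). Positive definiteness
holds because the quadratic form is the integral of the squared modulus of an exponential polynomial
against a positive density, and exponential polynomials with distinct frequencies are linearly
independent.

Linear algebra and probability. By the factorization, a row of the inverse covariance of a small
window of locations, padded with zeros, is a row of the full precision matrix (`blk_inv_of_window`);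
this gives both the band structure and the block formulas. The mean-square derivatives exist because
difference quotients are Cauchy in `L²`, and they are jointly Gaussian because they stay in the
closed linear span of the process. -/

theorem rolle_finset (F F' : ℝ → ℝ) (hF : ∀ x, 0 < x → HasDerivAt F (F' x) x) (N : ℕ)
    (S : Finset ℝ) (hS : ∀ x ∈ S, 0 < x ∧ F x = 0) (hcard : S.card = N + 1) :
    ∃ T : Finset ℝ, T.card = N ∧ ∀ x ∈ T, 0 < x ∧ F' x = 0 := by
  set z := S.orderEmbOfFin hcard
  have hz : ∀ i, 0 < z i ∧ F (z i) = 0 := fun i => hS _ (S.orderEmbOfFin_mem hcard i)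
  have key : ∀ i : Fin N, ∃ w, z i.castSucc < w ∧ w < z i.succ ∧ F' w = 0 := by
    intro i
    have hlt : z i.castSucc < z i.succ := z.strictMono (Fin.castSucc_lt_succ)
    obtain ⟨w, hw, hw'⟩ := exists_hasDerivAt_eq_zero (f := F) (f' := F') hlt
      (fun x hx => (hF x ((hz _).1.trans_le hx.1)).continuousAt.continuousWithinAt)
      (by rw [(hz _).2, (hz _).2]) (fun x hx => hF x ((hz _).1.trans hx.1))
    exact ⟨w, hw.1, hw.2, hw'⟩
  choose w hw1 hw2 hw3 using key
  have hmono : StrictMono w := by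
    intro i j hij
    refine (hw2 i).trans_le (le_trans (z.monotone ?_) (hw1 j).le)
    exact Fin.succ_le_castSucc_iff.2 hij
  refine ⟨Finset.univ.map ⟨w, hmono.injective⟩, by simp, ?_⟩
  intro x hx
  obtain ⟨i, -, rfl⟩ := Finset.mem_map.1 hx
  exact ⟨(hz _).1.trans (hw1 i), hw3 i⟩

/-- Induction by Rolle. Division by `x ^ e l` makes the term `l` constant, and differentiation then
removes it at the cost of at most one zero. The remaining exponents stay distinct, and a second
nonzero coefficient survives since its exponent differs from `e l`. A single monomial has no
positive zero. -/
theorem card_zeros_lt {ι : Type*} (n : ℕ) : ∀ (s : Finset ι) (e a : ι → ℝ), s.card = n →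
    Set.InjOn e s → (∃ l ∈ s, a l ≠ 0) → ∀ S : Finset ℝ,
    (∀ x ∈ S, 0 < x ∧ ∑ l ∈ s, a l * x ^ e l = 0) → S.card < n := by
  classical
  induction n with
  | zero =>
    intro s e a hs _ ⟨l, hl, _⟩
    simp [Finset.card_eq_zero.1 hs] at hl
  | succ n ih =>
    intro s e a hs he ⟨l, hl, hal⟩ S hS
    by_cases h1 : ∃ l1 ∈ s, l1 ≠ l ∧ a l1 ≠ 0
    · obtain ⟨l1, hl1, hne, hal1⟩ := h1
      by_contra! hcon
      obtain ⟨S', hS', hS'c⟩ := Finset.exists_subset_card_eq hcon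
      obtain ⟨T, hT, hTz⟩ := rolle_finset (fun x => ∑ j ∈ s, a j * x ^ (e j - e l))
        (fun x => ∑ j ∈ s, a j * ((e j - e l) * x ^ (e j - e l - 1)))
        (fun x hx => by
          refine HasDerivAt.fun_sum fun j _ => ?_
          exact (Real.hasDerivAt_rpow_const (Or.inl hx.ne')).const_mul _) n S'
        (fun x hx => by
          obtain ⟨hx0, hx1⟩ := hS x (hS' hx)
          refine ⟨hx0, ?_⟩
          have : ∑ j ∈ s, a j * x ^ (e j - e l) = (∑ j ∈ s, a j * x ^ e j) / x ^ e l := by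
            rw [Finset.sum_div]
            exact Finset.sum_congr rfl fun j _ => by rw [Real.rpow_sub hx0, mul_div_assoc]
          rw [this, hx1, zero_div]) hS'c
      have := ih (s.erase l) (fun j => e j - e l - 1) (fun j => a j * (e j - e l))
        (by rw [Finset.card_erase_of_mem hl, hs]; rfl)
        (fun i hi j hj hij => he (Finset.mem_of_mem_erase hi) (Finset.mem_of_mem_erase hj)
          (by simpa using hij))
        ⟨l1, Finset.mem_erase.2 ⟨hne, hl1⟩, mul_ne_zero hal1
          (sub_ne_zero.2 fun h => hne (he hl1 hl h))⟩ T
        (fun x hx => by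
          refine ⟨(hTz x hx).1, ?_⟩
          have h2 := (hTz x hx).2
          rw [← Finset.add_sum_erase s _ hl] at h2
          simp only [sub_self, zero_mul, mul_zero, zero_add] at h2
          rw [← h2]
          exact Finset.sum_congr rfl fun j _ => by ring)
      omega
    · push Not at h1
      suffices S = ∅ by simp [this]
      refine Finset.eq_empty_of_forall_notMem fun x hx => ?_
      obtain ⟨hx0, hx1⟩ := hS x hx
      rw [Finset.sum_eq_single_of_mem l hl (fun j hj hjl => by rw [h1 j hj hjl, zero_mul])] at hx1
      exact (mul_ne_zero hal (Real.rpow_pos_of_pos hx0 _).ne') hx1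

/-- The number of zeros of `x ^ θ * q x - p x` on the positive half-axis. -/
theorem card_zeros_rpow_mul_sub (θ : ℝ) (hθ : 0 < θ) (hθ1 : θ < 1) (p q : Polynomial ℝ)
    (hq : q ≠ 0) (S : Finset ℝ) (hS : ∀ x ∈ S, 0 < x ∧ x ^ θ * q.eval x - p.eval x = 0) :
    S.card < q.support.card + p.support.card := by
  have key := card_zeros_lt (ι := ℕ ⊕ ℕ) (q.support.card + p.support.card)
    (q.support.disjSum p.support) (Sum.elim (fun j => θ + j) (fun j => (j : ℝ)))
    (Sum.elim (fun j => q.coeff j) (fun j => - p.coeff j)) (by simp) ?_ ?_ S ?_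
  · exact key
  · have aux : ∀ i j : ℕ, θ + i ≠ j := by
      intro i j h
      have h1 : (i : ℝ) < j := by linarith
      have h2 : (j : ℝ) < i + 1 := by linarith
      have h1' : i < j := by exact_mod_cast h1
      have h2' : j < i + 1 := by exact_mod_cast h2
      omega
    rintro (i | i) _ (j | j) _ hij
    · simpa using hij
    · exact absurd hij (aux i j)
    · exact absurd hij.symm (aux j i)
    · simpa using hij
  · refine ⟨Sum.inl q.natDegree, by simpa using hq, by simpa using hq⟩
  · intro x hx
    obtain ⟨h0, h1⟩ := hS x hx
    refine ⟨h0, ?_⟩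
    rw [Finset.sum_disjSum, ← h1, Polynomial.eval_eq_sum, Polynomial.eval_eq_sum,
      Polynomial.sum, Polynomial.sum, Finset.mul_sum, sub_eq_add_neg, ← Finset.sum_neg_distrib]
    congr 1
    · refine Finset.sum_congr rfl fun j _ => ?_
      simp only [Sum.elim_inl]
      rw [Real.rpow_add h0, Real.rpow_natCast]; ring
    · refine Finset.sum_congr rfl fun j _ => ?_
      simp only [Sum.elim_inr]
      rw [Real.rpow_natCast]; ring

/-! ### A polynomial with prescribed sign changes -/

theorem same_sign_of_no_zero (e : ℝ → ℝ) (a b : ℝ) (hab : a < b)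
    (he : ContinuousOn e (Set.Icc a b)) (hz : ∀ x ∈ Set.Ioo a b, e x ≠ 0) :
    (∀ x ∈ Set.Icc a b, 0 ≤ e x) ∨ (∀ x ∈ Set.Icc a b, e x ≤ 0) := by
  have hcl : Set.Icc a b ⊆ closure (Set.Ioo a b) := by rw [closure_Ioo hab.ne]
  have main : (∀ x ∈ Set.Ioo a b, 0 ≤ e x) ∨ (∀ x ∈ Set.Ioo a b, e x ≤ 0) := by
    by_contra! h
    obtain ⟨⟨x, hx, hx0⟩, ⟨y, hy, hy0⟩⟩ := h
    have hpre : IsPreconnected (Set.Ioo a b) := isPreconnected_Ioo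
    obtain ⟨z, hz1, hz2⟩ := hpre.intermediate_value hx hy (he.mono Set.Ioo_subset_Icc_self)
      (show (0 : ℝ) ∈ Set.Icc (e x) (e y) from ⟨hx0.le, hy0.le⟩)
    exact hz z hz1 hz2
  have ext : ∀ s : Set ℝ, IsClosed s → (∀ x ∈ Set.Ioo a b, e x ∈ s) →
      ∀ x ∈ Set.Icc a b, e x ∈ s := by
    intro s hs h x hx
    have h1 : ContinuousWithinAt e (Set.Ioo a b) x := (he x hx).mono Set.Ioo_subset_Icc_self
    have := h1.mem_closure_image (hcl hx)
    exact (closure_minimal (by rintro _ ⟨y, hy, rfl⟩; exact h y hy) hs) this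
  rcases main with h | h
  · left; exact ext (Set.Ici 0) isClosed_Ici h
  · right; exact ext (Set.Iic 0) isClosed_Iic h

/-- The zeros are handled from the right. To the left of the largest zero `z` the inductive
polynomial already has the right sign; to the right of `z` the product with `e` has one sign, and a
factor `z - x` is inserted only if that sign is wrong. Zeros without a sign change thus cost no
degree. -/
theorem exists_polynomial_sign (e : ℝ → ℝ) (n : ℕ) : ∀ (c : ℝ), 0 < c →
    ContinuousOn e (Set.Icc 0 c) → ∀ (Z : Finset ℝ), Z.card = n →
    (∀ x ∈ Set.Ioo 0 c, e x = 0 → x ∈ Z) → (∀ x ∈ Z, x ∈ Set.Ioo 0 c ∧ e x = 0) →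
    ∃ g : Polynomial ℝ, g.natDegree ≤ n ∧ (∀ x ∈ Set.Icc 0 c, 0 ≤ e x * g.eval x) ∧
      ∀ x, g.eval x = 0 → x ∈ Z := by
  classical
  induction n with
  | zero =>
    intro c hc he Z hZ h1 _
    have hZ' : Z = ∅ := Finset.card_eq_zero.1 hZ
    subst hZ'
    rcases same_sign_of_no_zero e 0 c hc he (fun x hx h => by simpa using h1 x hx h) with h | h
    · exact ⟨1, by simp, by simpa using h, by simp⟩
    · exact ⟨-1, by simp, by simpa using h, by simp⟩
  | succ n ih =>
    intro c hc he Z hZ h1 h2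
    have hne : Z.Nonempty := Finset.card_pos.1 (by omega)
    set z := Z.max' hne
    have hzZ : z ∈ Z := Z.max'_mem hne
    have hz := h2 z hzZ
    have hmax : ∀ x ∈ Z, x ≤ z := fun x hx => Z.le_max' x hx
    obtain ⟨g, hg1, hg2, hg3⟩ := ih z hz.1.1
      (he.mono (Set.Icc_subset_Icc_right hz.1.2.le)) (Z.erase z)
      (by rw [Finset.card_erase_of_mem hzZ, hZ]; rfl)
      (fun x hx hx0 => Finset.mem_erase.2
        ⟨hx.2.ne, h1 x ⟨hx.1, hx.2.trans hz.1.2⟩ hx0⟩)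
      (fun x hx => by
        obtain ⟨hxz, hxZ⟩ := Finset.mem_erase.1 hx
        exact ⟨⟨(h2 x hxZ).1.1, lt_of_le_of_ne (hmax x hxZ) hxz⟩, (h2 x hxZ).2⟩)
    have hcont : ContinuousOn (fun x => e x * g.eval x) (Set.Icc z c) :=
      (he.mono (Set.Icc_subset_Icc_left hz.1.1.le)).mul g.continuous.continuousOn
    rcases same_sign_of_no_zero (fun x => e x * g.eval x) z c hz.1.2 hcont
      (fun x hx h => by
        rcases mul_eq_zero.1 h with h | h
        · exact absurd (hmax x (h1 x ⟨hz.1.1.trans hx.1, hx.2⟩ h)) (not_le.2 hx.1)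
        · exact absurd (hmax x (Finset.mem_of_mem_erase (hg3 x h))) (not_le.2 hx.1)) with h | h
    · refine ⟨g, by omega, fun x hx => ?_, fun x hx => Finset.mem_of_mem_erase (hg3 x hx)⟩
      rcases le_total x z with hxz | hxz
      · exact hg2 x ⟨hx.1, hxz⟩
      · exact h x ⟨hxz, hx.2⟩
    · refine ⟨g * (Polynomial.C z - Polynomial.X), ?_, fun x hx => ?_, fun x hx => ?_⟩
      · refine Polynomial.natDegree_mul_le.trans (add_le_add hg1 ?_)
        refine (Polynomial.natDegree_sub_le _ _).trans (by simp)
      · simp only [Polynomial.eval_mul, Polynomial.eval_sub, Polynomial.eval_C,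
          Polynomial.eval_X, ← mul_assoc]
        rcases le_total x z with hxz | hxz
        · exact mul_nonneg (hg2 x ⟨hx.1, hxz⟩) (by linarith)
        · exact mul_nonneg_of_nonpos_of_nonpos (h x ⟨hxz, hx.2⟩) (by linarith)
      · simp only [Polynomial.eval_mul, Polynomial.eval_sub, Polynomial.eval_C,
          Polynomial.eval_X, mul_eq_zero] at hx
        rcases hx with hx | hx
        · exact Finset.mem_of_mem_erase (hg3 x hx)
        · rw [show x = z by linarith]; exact hzZ

/-! ### Tangent directions of rational functions -/

/-- A Bézout identity times `g` is normalized by taking `q1` modulo `q`. The degree of `p1` is then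
read off from `p1 * q = g + q1 * p`. -/
theorem exists_bezout_degree_le_aux (p q g : Polynomial ℝ) (hpq : IsCoprime p q) (hq : q ≠ 0) (m : ℕ)
    (hdeg : p.natDegree ≤ q.natDegree) (hm : q.natDegree ≤ m)
    (hg : g.natDegree ≤ m + q.natDegree) :
    ∃ p1 q1 : Polynomial ℝ, p1.natDegree ≤ m ∧ q1.natDegree ≤ m ∧ p1 * q - q1 * p = g := by
  obtain ⟨u, v, huv⟩ := hpq
  set A := (-(g * u)) / q
  set q1 := (-(g * u)) % q
  have hdiv : q * A + q1 = -(g * u) := EuclideanDomain.div_add_mod _ _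
  have hq1 : q1.natDegree ≤ q.natDegree :=
    Polynomial.natDegree_le_natDegree (EuclideanDomain.mod_lt _ hq).le
  have hid : (g * v - A * p) * q - q1 * p = g := by
    have : q1 = -(g * u) - q * A := by rw [← hdiv]; ring
    rw [this]
    linear_combination g * huv
  refine ⟨g * v - A * p, q1, ?_, hq1.trans hm, hid⟩
  by_cases h0 : g * v - A * p = 0
  · simp [h0]
  have h1 : ((g * v - A * p) * q).natDegree ≤ m + q.natDegree := by
    rw [show (g * v - A * p) * q = g + q1 * p by linear_combination hid]
    refine (Polynomial.natDegree_add_le _ _).trans (max_le hg ?_)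
    exact Polynomial.natDegree_mul_le.trans (by omega)
  rw [Polynomial.natDegree_mul h0 hq] at h1
  omega

/-- The derivative of `(p + ε p1) / (q + ε q1)` at `ε = 0` is `(p1 * q - q1 * p) / q²`, so every `g`
within the degree bound is the numerator of a tangent direction. The polynomial of larger degree
serves as the modulus; exchanging the two only changes a sign. -/
theorem exists_bezout_degree_le (p q g : Polynomial ℝ) (hpq : IsCoprime p q) (hq : q ≠ 0) (m : ℕ)
    (hp : p.natDegree ≤ m) (hm : q.natDegree ≤ m)
    (hg : g.natDegree ≤ m + max p.natDegree q.natDegree) :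
    ∃ p1 q1 : Polynomial ℝ, p1.natDegree ≤ m ∧ q1.natDegree ≤ m ∧ p1 * q - q1 * p = g := by
  rcases le_or_gt p.natDegree q.natDegree with h | h
  · exact exists_bezout_degree_le_aux p q g hpq hq m h hm (by rwa [max_eq_right h] at hg)
  · have hp0 : p ≠ 0 := by rintro rfl; simp at h
    obtain ⟨p1, q1, h1, h2, h3⟩ := exists_bezout_degree_le_aux q p (-g) hpq.symm hp0 m h.le hp
      (by rw [Polynomial.natDegree_neg]; rwa [max_eq_left h.le] at hg)
    exact ⟨q1, p1, h2, h1, by rw [← neg_neg g, ← h3]; ring⟩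

/-! ### Improving a rational approximation -/

/-- A direction whose sign agrees with the error improves a rational approximation. -/
theorem exists_better_rational (f : ℝ → ℝ) (hf : ContinuousOn f (Set.Icc 0 1))
    (p q p1 q1 : Polynomial ℝ) (hq : ∀ x ∈ Set.Icc (0 : ℝ) 1, q.eval x ≠ 0)
    (hsign : ∀ x ∈ Set.Icc (0 : ℝ) 1,
      0 ≤ (f x - p.eval x / q.eval x) * (p1 * q - q1 * p).eval x)
    (hne : ∀ x ∈ Set.Icc (0 : ℝ) 1, f x - p.eval x / q.eval x ≠ 0 →
      (p1 * q - q1 * p).eval x ≠ 0)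
    (E : ℝ) (hE : 0 < E) (hfE : ∀ x ∈ Set.Icc (0 : ℝ) 1, |f x - p.eval x / q.eval x| ≤ E) :
    ∃ ε : ℝ, (∀ x ∈ Set.Icc (0 : ℝ) 1, (q + Polynomial.C ε * q1).eval x ≠ 0) ∧ ∃ E' < E,
      ∀ x ∈ Set.Icc (0 : ℝ) 1,
        |f x - (p + Polynomial.C ε * p1).eval x / (q + Polynomial.C ε * q1).eval x| ≤ E' := by
  set e : ℝ → ℝ := fun x => f x - p.eval x / q.eval x with he
  set g := p1 * q - q1 * p with hg
  have hcomp : IsCompact (Set.Icc (0 : ℝ) 1) := isCompact_Icc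
  have hec : ContinuousOn e (Set.Icc 0 1) :=
    hf.sub (p.continuous.continuousOn.div q.continuous.continuousOn hq)
  -- the function `q ^ 2` is bounded below, the others are bounded
  obtain ⟨x0, hx0, hx0'⟩ := hcomp.exists_isMinOn ⟨0, by simp⟩
    ((q.continuous.pow 2).continuousOn (s := Set.Icc (0 : ℝ) 1))
  set δ := (q.eval x0) ^ 2
  have hδ : 0 < δ := by have := hq x0 hx0; positivity
  have hδ' : ∀ x ∈ Set.Icc (0 : ℝ) 1, δ ≤ (q.eval x) ^ 2 := fun x hx => hx0' hx
  obtain ⟨B1, hB1⟩ := hcomp.exists_bound_of_continuousOn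
    ((q.continuous.mul q1.continuous).continuousOn (s := Set.Icc (0 : ℝ) 1))
  obtain ⟨B2, hB2⟩ := hcomp.exists_bound_of_continuousOn
    (g.continuous.continuousOn (s := Set.Icc (0 : ℝ) 1))
  obtain ⟨B3, hB3⟩ := hcomp.exists_bound_of_continuousOn
    ((q.continuous.pow 2).continuousOn (s := Set.Icc (0 : ℝ) 1))
  simp only [Real.norm_eq_abs] at hB1 hB2 hB3
  have h01 : (0 : ℝ) ∈ Set.Icc (0 : ℝ) 1 := by simp
  have hB1p : 0 ≤ B1 := (abs_nonneg _).trans (hB1 0 h01)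
  have hB2p : 0 ≤ B2 := (abs_nonneg _).trans (hB2 0 h01)
  have hB3p : 0 < B3 := by
    refine lt_of_lt_of_le hδ ((hδ' 0 h01).trans ((le_abs_self _).trans (hB3 0 h01)))
  -- the part where the error is large
  have hK : IsCompact (Set.Icc (0 : ℝ) 1 ∩ (fun x => |e x|) ⁻¹' (Set.Ici (E / 2))) :=
    hcomp.of_isClosed_subset (hec.abs.preimage_isClosed_of_isClosed isClosed_Icc isClosed_Ici)
      Set.inter_subset_left
  obtain ⟨γ, hγ, hγ'⟩ : ∃ γ > 0, ∀ x ∈ Set.Icc (0 : ℝ) 1, E / 2 ≤ |e x| → γ ≤ |g.eval x| := by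
    rcases (Set.Icc (0 : ℝ) 1 ∩ (fun x => |e x|) ⁻¹' (Set.Ici (E / 2))).eq_empty_or_nonempty
      with h | h
    · refine ⟨1, one_pos, fun x hx hxe => ?_⟩
      have : x ∈ (∅ : Set ℝ) := h ▸ ⟨hx, hxe⟩
      exact this.elim
    · obtain ⟨y, hy, hy'⟩ := hK.exists_isMinOn h (g.continuous.abs.continuousOn)
      refine ⟨|g.eval y|, abs_pos.2 (hne y hy.1 ?_), fun x hx hxe => hy' ⟨hx, hxe⟩⟩
      have : E / 2 ≤ |e y| := hy.2
      exact abs_pos.1 (by linarith)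
  -- The first bound keeps `q * (q + ε q1)` between `δ / 2` and `B3 + δ`; the second makes the
  -- change of the quotient at most `E / 4`.
  obtain ⟨ε, hε, hε1, hε2⟩ : ∃ ε > 0, ε * B1 ≤ δ / 2 ∧ ε * B2 ≤ E / 4 * (δ / 2) := by
    refine ⟨min (δ / 2 / (B1 + 1)) (E / 4 * (δ / 2) / (B2 + 1)), by positivity, ?_, ?_⟩
    · calc _ ≤ (δ / 2 / (B1 + 1)) * (B1 + 1) :=
            mul_le_mul (min_le_left _ _) (by linarith) hB1p (by positivity)
        _ = _ := by field_simp
    · calc _ ≤ (E / 4 * (δ / 2) / (B2 + 1)) * (B2 + 1) :=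
            mul_le_mul (min_le_right _ _) (by linarith) hB2p (by positivity)
        _ = _ := by field_simp
  set W : ℝ → ℝ := fun x => q.eval x * (q + Polynomial.C ε * q1).eval x with hW
  have hWeq : ∀ x, W x = q.eval x ^ 2 + ε * (q.eval x * q1.eval x) := by
    intro x; simp [hW]; ring
  have hWb : ∀ x ∈ Set.Icc (0 : ℝ) 1, δ / 2 ≤ W x ∧ W x ≤ B3 + δ := by
    intro x hx
    have h1 : |ε * (q.eval x * q1.eval x)| ≤ δ / 2 := by
      rw [abs_mul, abs_of_pos hε]
      exact (mul_le_mul_of_nonneg_left (hB1 x hx) hε.le).trans hε1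
    have h2 := abs_le.1 h1
    have h3 := hδ' x hx
    have h4 : q.eval x ^ 2 ≤ B3 := (le_abs_self _).trans (hB3 x hx)
    rw [hWeq]; constructor <;> linarith
  have hden : ∀ x ∈ Set.Icc (0 : ℝ) 1, (q + Polynomial.C ε * q1).eval x ≠ 0 := by
    intro x hx h
    have := (hWb x hx).1
    simp only [hW, h, mul_zero] at this
    linarith
  refine ⟨ε, hden, max (E - ε * γ / (B3 + δ)) (3 / 4 * E), ?_, ?_⟩
  · refine max_lt ?_ (by linarith)
    have : 0 < ε * γ / (B3 + δ) := by positivity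
    linarith
  · intro x hx
    have hWp : 0 < W x := lt_of_lt_of_le (by positivity) (hWb x hx).1
    have hrw : f x - (p + Polynomial.C ε * p1).eval x / (q + Polynomial.C ε * q1).eval x
        = e x - ε * (g.eval x / W x) := by
      have h1 := hq x hx
      have h2 := hden x hx
      simp only [he, hg, hW]
      simp only [Polynomial.eval_add, Polynomial.eval_mul, Polynomial.eval_C,
        Polynomial.eval_sub] at h2 ⊢
      field_simp
      ring
    rw [hrw]
    have hφ : ε * |g.eval x / W x| ≤ E / 4 := by
      rw [abs_div, abs_of_pos hWp, ← mul_div_assoc, div_le_iff₀ hWp]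
      calc ε * |g.eval x| ≤ ε * B2 := mul_le_mul_of_nonneg_left (hB2 x hx) hε.le
        _ ≤ E / 4 * (δ / 2) := hε2
        _ ≤ E / 4 * W x := mul_le_mul_of_nonneg_left (hWb x hx).1 (by positivity)
    have hφabs : |ε * (g.eval x / W x)| = ε * |g.eval x / W x| := by
      rw [abs_mul, abs_of_pos hε]
    -- Where the error is at least `E / 2`, the correction has its sign and is too small to
    -- overshoot, so the error drops by at least `ε * γ / (B3 + δ)`. Elsewhere `E / 2 + E / 4` is an
    -- adequate bound.
    rcases le_or_gt (E / 2) |e x| with hbig | hsmall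
    · refine le_max_of_le_left ?_
      have hlow : ε * γ / (B3 + δ) ≤ ε * |g.eval x / W x| := by
        rw [abs_div, abs_of_pos hWp, mul_div_assoc]
        refine mul_le_mul_of_nonneg_left ?_ hε.le
        exact div_le_div₀ (abs_nonneg _) (hγ' x hx hbig) hWp (hWb x hx).2
      have hs : 0 ≤ e x * (ε * (g.eval x / W x)) := by
        have : e x * (ε * (g.eval x / W x)) = e x * g.eval x * (ε / W x) := by ring
        rw [this]
        exact mul_nonneg (hsign x hx) (by positivity)
      have h5 := hfE x hx
      change |e x| ≤ E at h5
      rw [← hφabs] at hφ hlow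
      rcases le_or_gt 0 (e x) with h0 | h0
      · have h6 : 0 ≤ ε * (g.eval x / W x) := by
          rcases h0.eq_or_lt with h0 | h0
          · rw [← h0, abs_zero] at hbig; linarith
          · exact nonneg_of_mul_nonneg_right hs h0
        rw [abs_of_nonneg h6] at hφ hlow
        rw [abs_of_nonneg h0] at hbig h5
        rw [abs_of_nonneg (by linarith)]
        linarith
      · have h6 : ε * (g.eval x / W x) ≤ 0 := by
          by_contra! h
          have := mul_neg_of_neg_of_pos h0 h
          linarith
        rw [abs_of_nonpos h6] at hφ hlow
        rw [abs_of_neg h0] at hbig h5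
        rw [abs_of_nonpos (by linarith)]
        linarith
    · refine le_max_of_le_right ?_
      refine (abs_sub _ _).trans ?_
      rw [hφabs]; linarith

/-! ### Nondegeneracy of the best approximation -/

theorem ascPoly_coeff (m : ℕ) (p : Polynomial ℝ) (hp : p.natDegree ≤ m) (x : ℝ) :
    ascPoly (fun i : Fin (m + 1) => p.coeff i) x = p.eval x := by
  rw [Polynomial.eval_eq_sum_range' (Nat.lt_succ_of_le hp), ascPoly,
    Fin.sum_univ_eq_sum_range (fun i => p.coeff i * x ^ i)]

/-- The polynomial with the given coefficients. -/
noncomputable def toPoly {m : ℕ} (a : Fin (m + 1) → ℝ) : Polynomial ℝ :=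
  ∑ i : Fin (m + 1), Polynomial.C (a i) * Polynomial.X ^ (i : ℕ)

theorem eval_toPoly {m : ℕ} (a : Fin (m + 1) → ℝ) (x : ℝ) : (toPoly a).eval x = ascPoly a x := by
  simp [toPoly, ascPoly, Polynomial.eval_finsetSum]

theorem natDegree_toPoly_le {m : ℕ} (a : Fin (m + 1) → ℝ) : (toPoly a).natDegree ≤ m := by
  refine Polynomial.natDegree_sum_le_of_forall_le _ _ fun i _ => ?_
  exact (Polynomial.natDegree_C_mul_X_pow_le _ _).trans (Nat.lt_succ_iff.1 i.2)

/-- The error of a best approximation has more zeros than a tangent polynomial can have. -/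
theorem not_best_of_few_zeros {m : ℕ} (θ : ℝ) (hθ : 0 < θ) (hθ1 : θ < 1)
    (a b : Fin (m + 1) → ℝ) (hab : IsBestRationalApprox θ a b) (p q : Polynomial ℝ)
    (hpq : IsCoprime p q) (hp : p.natDegree ≤ m) (hqm : q.natDegree ≤ m)
    (hq : ∀ x ∈ Set.Icc (0 : ℝ) 1, q.eval x ≠ 0)
    (hR : ∀ x ∈ Set.Icc (0 : ℝ) 1, ascPoly a x / ascPoly b x = p.eval x / q.eval x) :
    m + max p.natDegree q.natDegree + 1 < q.support.card + p.support.card := by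
  by_contra! hcon
  have hq0 : q ≠ 0 := by rintro rfl; exact hq 0 (by simp) (by simp)
  set f : ℝ → ℝ := fun x => x ^ θ with hfdef
  have hf : ContinuousOn f (Set.Icc 0 1) :=
    (Real.continuous_rpow_const hθ.le).continuousOn
  set e : ℝ → ℝ := fun x => f x - p.eval x / q.eval x with he
  have hec : ContinuousOn e (Set.Icc 0 1) :=
    hf.sub (p.continuous.continuousOn.div q.continuous.continuousOn hq)
  have hzero : ∀ S : Finset ℝ, (∀ x ∈ S, x ∈ Set.Ioo (0 : ℝ) 1 ∧ e x = 0) →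
      S.card < q.support.card + p.support.card := by
    intro S hS
    refine card_zeros_rpow_mul_sub θ hθ hθ1 p q hq0 S fun x hx => ⟨(hS x hx).1.1, ?_⟩
    have h1 := (hS x hx).2
    have h2 := hq x (Set.Ioo_subset_Icc_self (hS x hx).1)
    simp only [he, hfdef] at h1
    field_simp at h1
    linarith
  have hfin : {x | x ∈ Set.Ioo (0 : ℝ) 1 ∧ e x = 0}.Finite := by
    by_contra hinf
    obtain ⟨S, hS, hcard⟩ := Set.Infinite.exists_subset_card_eq hinf
      (q.support.card + p.support.card)
    exact absurd (hzero S fun x hx => hS hx) (by omega)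
  obtain ⟨g, hg1, hg2, hg3⟩ := exists_polynomial_sign e hfin.toFinset.card 1 one_pos hec
    hfin.toFinset rfl (fun x hx hx0 => by simpa using ⟨hx, hx0⟩) (fun x hx => by simpa using hx)
  -- The degree of `g` is at most the number of interior zeros of the error, and the assumption
  -- `hcon` brings this count into the range of the Bézout lemma.
  have hgd : g.natDegree ≤ m + max p.natDegree q.natDegree := by
    have := hzero hfin.toFinset (fun x hx => by simpa using hx)
    omega
  obtain ⟨p1, q1, hp1, hq1, hpq1⟩ := exists_bezout_degree_le p q g hpq hq0 m hp hqm hgd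
  obtain ⟨y, hy, hy'⟩ := isCompact_Icc.exists_isMaxOn (⟨0, by simp⟩ : (Set.Icc (0 : ℝ) 1).Nonempty)
    hec.abs
  have hEpos : 0 < |e y| := by
    by_contra! h
    have hall : Set.Ioo (0 : ℝ) 1 ⊆ {x | x ∈ Set.Ioo (0 : ℝ) 1 ∧ e x = 0} := fun x hx =>
      ⟨hx, abs_nonpos_iff.1 ((hy' (Set.Ioo_subset_Icc_self hx)).trans h)⟩
    exact (Set.Ioo_infinite one_pos) (hfin.subset hall)
  obtain ⟨ε, hε1, E', hE', hε2⟩ := exists_better_rational f hf p q p1 q1 hq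
    (by rw [hpq1]; exact hg2)
    (by
      rw [hpq1]
      intro x hx hex h
      have := hg3 x h
      simp only [Set.Finite.mem_toFinset, Set.mem_ofPred_eq] at this
      exact hex this.2) |e y| hEpos (fun x hx => hy' hx)
  have hdeg : ∀ (r r1 : Polynomial ℝ), r.natDegree ≤ m → r1.natDegree ≤ m →
      (r + Polynomial.C ε * r1).natDegree ≤ m := fun r r1 h h1 =>
    (Polynomial.natDegree_add_le _ _).trans
      (max_le h ((Polynomial.natDegree_C_mul_le _ _).trans h1))
  have := hab.best (fun i => (p + Polynomial.C ε * p1).coeff i)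
    (fun i => (q + Polynomial.C ε * q1).coeff i)
    (fun x hx => by rw [ascPoly_coeff _ _ (hdeg q q1 hqm hq1)]; exact hε1 x hx) E'
    (fun x hx => by
      rw [ascPoly_coeff _ _ (hdeg q q1 hqm hq1), ascPoly_coeff _ _ (hdeg p p1 hp hp1)]
      exact hε2 x hx) y hy
  rw [hR y hy] at this
  exact absurd (this.trans_lt hE') (lt_irrefl _)

/-- The reduced form of a best approximation has the full degree, and no zero at the origin. -/
theorem IsBestRationalApprox.exists_coprime {m : ℕ} {θ : ℝ} (hθ : 0 < θ) (hθ1 : θ < 1)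
    {a b : Fin (m + 1) → ℝ} (hab : IsBestRationalApprox θ a b) :
    ∃ p q : Polynomial ℝ, IsCoprime p q ∧ p * toPoly b = q * toPoly a ∧
      max p.natDegree q.natDegree = m ∧ p.eval 0 ≠ 0 := by
  have hb0 : toPoly b ≠ 0 := by
    intro h
    have := hab.denom_ne_zero 0 (by simp)
    rw [← eval_toPoly, h] at this
    simp at this
  set d := EuclideanDomain.gcd (toPoly a) (toPoly b)
  have hd0 : d ≠ 0 := fun h => hb0 (EuclideanDomain.gcd_eq_zero_iff.1 h).2
  obtain ⟨p, hp⟩ := EuclideanDomain.gcd_dvd_left (toPoly a) (toPoly b)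
  obtain ⟨q, hq⟩ := EuclideanDomain.gcd_dvd_right (toPoly a) (toPoly b)
  change toPoly a = d * p at hp
  change toPoly b = d * q at hq
  have hpq : IsCoprime p q := by
    have h := EuclideanDomain.gcd_eq_gcd_ab (toPoly a) (toPoly b)
    refine ⟨EuclideanDomain.gcdA (toPoly a) (toPoly b), EuclideanDomain.gcdB (toPoly a) (toPoly b), ?_⟩
    refine mul_left_cancel₀ hd0 ?_
    change d = _ at h
    linear_combination (-EuclideanDomain.gcdA (toPoly a) (toPoly b)) * hp
      - EuclideanDomain.gcdB (toPoly a) (toPoly b) * hq - h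
  have hq0 : q ≠ 0 := by rintro rfl; exact hb0 (by rw [hq, mul_zero])
  have hqm : q.natDegree ≤ m := by
    have := natDegree_toPoly_le b
    rw [hq, Polynomial.natDegree_mul hd0 hq0] at this; omega
  have hpm : p.natDegree ≤ m := by
    by_cases hp0 : p = 0
    · simp [hp0]
    have := natDegree_toPoly_le a
    rw [hp, Polynomial.natDegree_mul hd0 hp0] at this; omega
  have hbe : ∀ x ∈ Set.Icc (0 : ℝ) 1, d.eval x * q.eval x ≠ 0 := by
    intro x hx
    rw [← Polynomial.eval_mul, ← hq, eval_toPoly]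
    exact hab.denom_ne_zero x hx
  have key := not_best_of_few_zeros θ hθ hθ1 a b hab p q hpq hpm hqm
    (fun x hx => right_ne_zero_of_mul (hbe x hx))
    (fun x hx => by
      rw [← eval_toPoly, ← eval_toPoly, hp, hq, Polynomial.eval_mul, Polynomial.eval_mul,
        mul_div_mul_left _ _ (left_ne_zero_of_mul (hbe x hx))])
  have hcq : q.support.card ≤ q.natDegree + 1 := Polynomial.card_supp_le_succ_natDegree q
  have hcp : p.support.card ≤ p.natDegree + 1 := Polynomial.card_supp_le_succ_natDegree p
  have hmax := le_max_left p.natDegree q.natDegree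
  have hmax' := le_max_right p.natDegree q.natDegree
  -- A support has at most degree plus one elements, so `key` forces both degrees to be at least
  -- `m`. If `p` vanished at `0`, its support would lose one element and `key` would fail.
  refine ⟨p, q, hpq, by rw [hp, hq]; ring, ?_, ?_⟩
  · have : max p.natDegree q.natDegree ≤ m := max_le hpm hqm
    omega
  · intro h0
    have : p.support.card ≤ p.natDegree := by
      have hsub : p.support ⊆ (Finset.range (p.natDegree + 1)).erase 0 := by
        intro i hi
        refine Finset.mem_erase.2 ⟨?_, Finset.mem_range.2
          (Nat.lt_succ_of_le (Polynomial.le_natDegree_of_mem_supp i hi))⟩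
        rintro rfl
        rw [Polynomial.mem_support_iff, Polynomial.coeff_zero_eq_eval_zero] at hi
        exact hi h0
      refine (Finset.card_le_card hsub).trans ?_
      rw [Finset.card_erase_of_mem (by simp)]; simp
    omega

/-! ### The partial fraction decomposition -/

theorem revPoly_eq {m : ℕ} (a : Fin (m + 1) → ℝ) (x : ℝ) (hx : x ≠ 0) :
    revPoly a x = x ^ m * ascPoly a x⁻¹ := by
  rw [revPoly, ascPoly, Finset.mul_sum]
  refine Finset.sum_congr rfl fun i _ => ?_
  rw [inv_pow, pow_sub₀ x hx (Nat.lt_succ_iff.1 i.2)]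
  ring

theorem eval_reflect_eq (N : ℕ) (f : Polynomial ℝ) (hf : f.natDegree ≤ N) (y : ℝ) (hy : y ≠ 0) :
    (f.reflect N).eval y = y ^ N * f.eval y⁻¹ := by
  let _ : Invertible y⁻¹ := invertibleOfNonzero (inv_ne_zero hy)
  have h := Polynomial.eval₂_reflect_mul_pow (RingHom.id ℝ) y⁻¹ N f hf
  simp only [invOf_eq_inv, inv_inv] at h
  change (f.reflect N).eval y * _ = f.eval _ at h
  rw [← h, inv_pow]
  field_simp

/-- Intended for a partial fraction sum with one pole dropped: the quotient then has degree below
`m`, which `not_lower_degree` excludes. -/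
theorem exists_polynomial_quotient {ι : Type*} (k : ℝ) (c p : ι → ℝ) (s : Finset ι) :
    ∃ A B : Polynomial ℝ, A.natDegree ≤ s.card ∧ B.natDegree ≤ s.card ∧ B ≠ 0 ∧
      ∀ x, B.eval x ≠ 0 → k + ∑ i ∈ s, c i / (x - p i) = A.eval x / B.eval x := by
  classical
  induction s using Finset.induction_on with
  | empty => exact ⟨Polynomial.C k, 1, by simp, by simp, one_ne_zero, by simp⟩
  | insert j s hj ih =>
    obtain ⟨A, B, hA, hB, hB0, h⟩ := ih
    have hd : ∀ A : Polynomial ℝ, A.natDegree ≤ s.card →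
        (A * (Polynomial.X - Polynomial.C (p j))).natDegree ≤ s.card + 1 := fun A hA =>
      Polynomial.natDegree_mul_le.trans
        (add_le_add hA (Polynomial.natDegree_X_sub_C_le _))
    rw [Finset.card_insert_of_notMem hj]
    refine ⟨A * (Polynomial.X - Polynomial.C (p j)) + Polynomial.C (c j) * B,
      B * (Polynomial.X - Polynomial.C (p j)), ?_, hd B hB,
      mul_ne_zero hB0 (Polynomial.X_sub_C_ne_zero _), fun x hx => ?_⟩
    · refine (Polynomial.natDegree_add_le _ _).trans (max_le (hd A hA) ?_)
      exact (Polynomial.natDegree_C_mul_le _ _).trans (by omega)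
    · simp only [Polynomial.eval_mul, Polynomial.eval_sub, Polynomial.eval_X,
        Polynomial.eval_C, ne_eq, mul_eq_zero, not_or, Polynomial.eval_add] at hx ⊢
      rw [Finset.sum_insert hj, add_left_comm, h x hx.1]
      have h1 := hx.1
      have h2 := hx.2
      field_simp
      ring

/-- Reversing coefficients turns the identity in `x⁻¹` into `p * B' = q * A'` with `A'`, `B'` of
degree at most `N`. By coprimality `q` divides `B'` and `p` divides `A'`, against the full degree of
the reduced form. -/
theorem not_lower_degree {m : ℕ} {θ : ℝ} (hθ : 0 < θ) (hθ1 : θ < 1)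
    {a b : Fin (m + 1) → ℝ} (hab : IsBestRationalApprox θ a b) (N : ℕ) (hN : N < m)
    (A B : Polynomial ℝ) (hA : A.natDegree ≤ N) (hB : B.natDegree ≤ N) (hB0 : B ≠ 0)
    (h : ∀ x, 1 ≤ x → B.eval x ≠ 0 → ascPoly a x⁻¹ / ascPoly b x⁻¹ = A.eval x / B.eval x) :
    False := by
  obtain ⟨p, q, hpq, hmul, hmax, -⟩ := hab.exists_coprime hθ hθ1
  set A' := A.reflect N with hA'
  set B' := B.reflect N with hB'
  have hB'0 : B' ≠ 0 := by rwa [hB', Ne, Polynomial.reflect_eq_zero_iff]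
  have hA'd : A'.natDegree ≤ N := Polynomial.natDegree_reflect_le.trans (max_le le_rfl hA)
  have hB'd : B'.natDegree ≤ N := Polynomial.natDegree_reflect_le.trans (max_le le_rfl hB)
  -- The additional factor `B'` covers the points where `B` vanishes and the hypothesis says
  -- nothing.
  have hid : (toPoly a * B' - toPoly b * A') * B' = 0 := by
    refine Polynomial.eq_zero_of_infinite_isRoot _ ((Set.Ioo_infinite (one_pos (α := ℝ))).mono ?_)
    intro y hy
    have hy0 : y ≠ 0 := hy.1.ne'
    simp only [Set.mem_ofPred_eq, Polynomial.IsRoot, Polynomial.eval_mul, Polynomial.eval_sub]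
    by_cases hBy : B.eval y⁻¹ = 0
    · rw [hB', eval_reflect_eq N B hB y hy0, hBy]; ring
    · have h1 := h y⁻¹ (one_le_inv₀ hy.1 |>.2 hy.2.le) hBy
      rw [inv_inv, ← eval_toPoly, ← eval_toPoly] at h1
      have h2 : (toPoly b).eval y ≠ 0 := by
        rw [eval_toPoly]; exact hab.denom_ne_zero y ⟨hy.1.le, hy.2.le⟩
      rw [div_eq_div_iff h2 hBy] at h1
      rw [hB', hA', eval_reflect_eq N B hB y hy0, eval_reflect_eq N A hA y hy0]
      linear_combination (y ^ N * (y ^ N * B.eval y⁻¹)) * h1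
  have hid2 : toPoly a * B' = toPoly b * A' := by
    rcases mul_eq_zero.1 hid with h | h
    · exact sub_eq_zero.1 h
    · exact absurd h hB'0
  have hb0 : toPoly b ≠ 0 := by
    intro h
    have := hab.denom_ne_zero 0 (by simp)
    rw [← eval_toPoly, h] at this
    simp at this
  have hid3 : p * B' = q * A' := by
    refine mul_left_cancel₀ hb0 ?_
    linear_combination B' * hmul + q * hid2
  have hq : q.natDegree ≤ N := by
    have : q ∣ B' := hpq.symm.dvd_of_dvd_mul_left ⟨A', hid3⟩
    exact (Polynomial.natDegree_le_of_dvd this hB'0).trans hB'd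
  have hp : p.natDegree ≤ N := by
    by_cases hA0 : A' = 0
    · rw [hA0, mul_zero] at hid3
      rcases mul_eq_zero.1 hid3 with h | h
      · simp [h]
      · exact absurd h hB'0
    · have : p ∣ A' := hpq.dvd_of_dvd_mul_left ⟨B', hid3.symm⟩
      exact (Polynomial.natDegree_le_of_dvd this hA0).trans hA'd
  have := max_le hp hq
  omega

theorem continuous_ascPoly {m : ℕ} (a : Fin (m + 1) → ℝ) : Continuous (ascPoly a) := by
  have : ascPoly a = fun x => (toPoly a).eval x := funext fun x => (eval_toPoly a x).symm
  rw [this]; exact (toPoly a).continuous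

section PartialFraction

variable {m : ℕ} {θ : ℝ} {a b : Fin (m + 1) → ℝ} {k : ℝ} {c p : Fin m → ℝ}

theorem IsPartialFraction.eq_of_one_le (hab : IsBestRationalApprox θ a b)
    (h : IsPartialFraction a b k c p) (x : ℝ) (hx : 1 ≤ x) :
    ascPoly a x⁻¹ / ascPoly b x⁻¹ = k + ∑ i, c i / (x - p i) := by
  have hx0 : 0 < x := by linarith
  have hb := hab.denom_ne_zero x⁻¹ ⟨by positivity, inv_le_one_of_one_le₀ hx⟩
  rw [← h x (by rw [revPoly_eq b x hx0.ne']; positivity), revPoly_eq a x hx0.ne',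
    revPoly_eq b x hx0.ne', mul_div_mul_left _ _ (by positivity)]

/-- The constant is the value at infinity, that is, the value of the approximation at the origin,
where the reduced numerator does not vanish. -/
theorem IsPartialFraction.const_ne_zero (hθ : 0 < θ) (hθ1 : θ < 1)
    (hab : IsBestRationalApprox θ a b) (h : IsPartialFraction a b k c p) : k ≠ 0 := by
  obtain ⟨P, Q, hPQ, hmul, hmax, hP0⟩ := hab.exists_coprime hθ hθ1
  have hb0 := hab.denom_ne_zero 0 (by simp)
  have h1 : Tendsto (fun x : ℝ => ascPoly a x⁻¹ / ascPoly b x⁻¹) atTop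
      (𝓝 (ascPoly a 0 / ascPoly b 0)) :=
    (((continuous_ascPoly a).tendsto 0).comp tendsto_inv_atTop_zero).div
      (((continuous_ascPoly b).tendsto 0).comp tendsto_inv_atTop_zero) hb0
  have h2 : Tendsto (fun x : ℝ => k + ∑ i, c i / (x - p i)) atTop (𝓝 (k + ∑ i : Fin m, 0)) := by
    refine tendsto_const_nhds.add (tendsto_finsetSum _ fun i _ => ?_)
    exact tendsto_const_nhds.div_atTop (tendsto_atTop_add_const_right _ _ tendsto_id)
  have h3 : ascPoly a 0 / ascPoly b 0 = k + ∑ i : Fin m, 0 := by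
    refine tendsto_nhds_unique h1 (h2.congr' ?_)
    filter_upwards [eventually_ge_atTop 1] with x hx
    exact (h.eq_of_one_le hab x hx).symm
  rw [Finset.sum_const_zero, add_zero] at h3
  rintro rfl
  have h4 : ascPoly a 0 = 0 := by
    rcases div_eq_zero_iff.1 h3 with h | h
    · exact h
    · exact absurd h hb0
  have h5 := congrArg (Polynomial.eval 0) hmul
  rw [Polynomial.eval_mul, Polynomial.eval_mul, eval_toPoly, eval_toPoly, h4, mul_zero] at h5
  exact (mul_ne_zero hP0 hb0) h5

theorem IsPartialFraction.residue_ne_zero (hθ : 0 < θ) (hθ1 : θ < 1)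
    (hab : IsBestRationalApprox θ a b) (h : IsPartialFraction a b k c p) (i : Fin m) :
    c i ≠ 0 := by
  classical
  intro hc
  have hm : 0 < m := i.pos
  obtain ⟨A, B, hA, hB, hB0, hAB⟩ := exists_polynomial_quotient k c p (Finset.univ.erase i)
  rw [Finset.card_erase_of_mem (Finset.mem_univ i), Finset.card_univ, Fintype.card_fin] at hA hB
  refine not_lower_degree hθ hθ1 hab (m - 1) (by omega) A B hA hB hB0 fun x hx hBx => ?_
  rw [h.eq_of_one_le hab x hx, ← hAB x hBx, ← Finset.add_sum_erase _ _ (Finset.mem_univ i), hc]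
  simp

/-- Two equal poles could be merged by adding their residues, leaving a quotient of degree at most
`m - 1`. -/
theorem IsPartialFraction.pole_injective (hθ : 0 < θ) (hθ1 : θ < 1)
    (hab : IsBestRationalApprox θ a b) (h : IsPartialFraction a b k c p) :
    Function.Injective p := by
  classical
  intro i j hij
  by_contra hne
  have hm : 0 < m := i.pos
  obtain ⟨A, B, hA, hB, hB0, hAB⟩ := exists_polynomial_quotient k
    (Function.update c j (c j + c i)) p (Finset.univ.erase i)
  rw [Finset.card_erase_of_mem (Finset.mem_univ i), Finset.card_univ, Fintype.card_fin] at hA hB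
  refine not_lower_degree hθ hθ1 hab (m - 1) (by omega) A B hA hB hB0 fun x hx hBx => ?_
  have hj : j ∈ Finset.univ.erase i := Finset.mem_erase.2 ⟨Ne.symm hne, Finset.mem_univ j⟩
  rw [h.eq_of_one_le hab x hx, ← hAB x hBx, ← Finset.add_sum_erase _ _ (Finset.mem_univ i),
    ← Finset.add_sum_erase _ _ hj, ← Finset.add_sum_erase _ _ hj, Function.update_self, hij,
    ← add_assoc (c i / _), ← add_div, add_comm (c i)]
  congr 2
  refine Finset.sum_congr rfl fun l hl => ?_
  rw [Function.update_of_ne (Finset.mem_erase.1 hl).1]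

/-- For `p i ≥ 1` multiply by `x - p i` and let `x` decrease to `p i`. The approximation stays
finite at `(p i)⁻¹` in `[0, 1]`, so one side tends to `0`; the other tends to `c i ≠ 0`, the
remaining terms being bounded because the poles are distinct. -/
theorem IsPartialFraction.pole_lt_one (hθ : 0 < θ) (hθ1 : θ < 1)
    (hab : IsBestRationalApprox θ a b) (h : IsPartialFraction a b k c p) (i : Fin m) :
    p i < 1 := by
  classical
  by_contra! hp
  have hinj := h.pole_injective hθ hθ1 hab
  have hp0 : p i ≠ 0 := by linarith
  have hb0 := hab.denom_ne_zero (p i)⁻¹ ⟨by positivity, inv_le_one_of_one_le₀ hp⟩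
  have hle : 𝓝[>] (p i) ≤ 𝓝 (p i) := nhdsWithin_le_nhds
  have hinv : Tendsto (fun x : ℝ => x⁻¹) (𝓝[>] (p i)) (𝓝 (p i)⁻¹) :=
    (tendsto_inv₀ hp0).mono_left hle
  have hsub : Tendsto (fun x : ℝ => x - p i) (𝓝[>] (p i)) (𝓝 0) := by
    have : Tendsto (fun x : ℝ => x - p i) (𝓝 (p i)) (𝓝 (p i - p i)) :=
      tendsto_id.sub tendsto_const_nhds
    rw [sub_self] at this
    exact this.mono_left hle
  have h1 : Tendsto (fun x : ℝ => (x - p i) * (ascPoly a x⁻¹ / ascPoly b x⁻¹)) (𝓝[>] (p i))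
      (𝓝 (0 * (ascPoly a (p i)⁻¹ / ascPoly b (p i)⁻¹))) :=
    hsub.mul ((((continuous_ascPoly a).tendsto _).comp hinv).div
      (((continuous_ascPoly b).tendsto _).comp hinv) hb0)
  have h2 : Tendsto (fun x : ℝ => c i + (x - p i) *
      (k + ∑ j ∈ Finset.univ.erase i, c j / (x - p j))) (𝓝[>] (p i))
      (𝓝 (c i + 0 * (k + ∑ j ∈ Finset.univ.erase i, c j / (p i - p j)))) := by
    refine tendsto_const_nhds.add (hsub.mul (tendsto_const_nhds.add
      (tendsto_finsetSum _ fun j hj => ?_)))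
    refine tendsto_const_nhds.div ?_ (sub_ne_zero.2 fun h =>
      (Finset.mem_erase.1 hj).1 (hinj h.symm))
    exact (tendsto_id.sub tendsto_const_nhds).mono_left hle
  have h3 := tendsto_nhds_unique h1 (h2.congr' ?_)
  · rw [zero_mul, zero_mul, add_zero] at h3
    exact h.residue_ne_zero hθ hθ1 hab i h3.symm
  · filter_upwards [self_mem_nhdsWithin] with x hx
    have hx' : p i < x := hx
    rw [h.eq_of_one_le hab x (hp.trans hx'.le), ← Finset.add_sum_erase _ _ (Finset.mem_univ i)]
    have : x - p i ≠ 0 := by linarith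
    field_simp
    ring

end PartialFraction

/-! ### Rational spectral densities -/

/-- The rational spectral density `∏ l ≤ M, (w² + lam l²)⁻¹`. -/
noncomputable def ratDensity (lam : ℕ → ℝ) (M : ℕ) (w : ℝ) : ℝ :=
  (∏ l ∈ Finset.range (M + 1), (w ^ 2 + lam l ^ 2))⁻¹

/-- The integrand `p(iw) exp(iwh) f(w)`. -/
noncomputable def spectralIntegrand (lam : ℕ → ℝ) (M : ℕ) (p : Polynomial ℝ) (h w : ℝ) : ℂ :=
  Polynomial.aeval (Complex.I * w) p * Complex.exp (Complex.I * w * h) * (ratDensity lam M w : ℂ)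

/-- The real part of `∫ p(iw) exp(iwh) f(w) dw`, that is, the differential operator `p(d/dh)`
applied to the covariance function with the spectral density `f`. -/
noncomputable def spectralOp (lam : ℕ → ℝ) (M : ℕ) (p : Polynomial ℝ) (h : ℝ) : ℝ :=
  (∫ w : ℝ, spectralIntegrand lam M p h w).re

section

variable {lam : ℕ → ℝ} (hlam : ∀ l, 0 < lam l)
include hlam

theorem ratDensity_pos (M : ℕ) (w : ℝ) : 0 < ratDensity lam M w :=
  inv_pos.2 (Finset.prod_pos fun l _ => by have := hlam l; positivity)

theorem continuous_ratDensity (M : ℕ) : Continuous (ratDensity lam M) := by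
  refine Continuous.inv₀ (by fun_prop) fun w => ?_
  exact (Finset.prod_pos fun l _ => by have := hlam l; positivity).ne'

theorem ratDensity_le (M : ℕ) : ∃ C, ∀ w, ratDensity lam M w ≤ C * ((1 + w ^ 2) ^ (M + 1))⁻¹ := by
  refine ⟨(∏ l ∈ Finset.range (M + 1), min 1 (lam l ^ 2))⁻¹, fun w => ?_⟩
  have h0 : ∀ l, 0 < min 1 (lam l ^ 2) := fun l => by have := hlam l; positivity
  rw [ratDensity, ← mul_inv]
  refine inv_anti₀ (mul_pos (Finset.prod_pos fun l _ => h0 l) (by positivity)) ?_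
  have : (1 + w ^ 2) ^ (M + 1) = ∏ l ∈ Finset.range (M + 1), (1 + w ^ 2) := by simp
  rw [this, ← Finset.prod_mul_distrib]
  refine Finset.prod_le_prod (fun l _ => (mul_pos (h0 l) (by positivity)).le) fun l _ => ?_
  have h1 : min 1 (lam l ^ 2) ≤ 1 := min_le_left _ _
  have h2 : min 1 (lam l ^ 2) ≤ lam l ^ 2 := min_le_right _ _
  nlinarith [sq_nonneg w]

omit hlam in
theorem pow_le_one_add_sq_pow (w : ℝ) (j M : ℕ) (hj : j ≤ 2 * M) : |w| ^ j ≤ (1 + w ^ 2) ^ M := by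
  rcases le_total |w| 1 with h | h
  · exact (pow_le_one₀ (abs_nonneg w) h).trans (one_le_pow₀ (by nlinarith [sq_nonneg w]))
  · calc |w| ^ j ≤ |w| ^ (2 * M) := pow_le_pow_right₀ h hj
      _ = (w ^ 2) ^ M := by rw [pow_mul, sq_abs]
      _ ≤ _ := pow_le_pow_left₀ (sq_nonneg w) (by linarith) M

omit hlam in
theorem norm_aeval_le (p : Polynomial ℝ) (M : ℕ) (hp : p.natDegree ≤ 2 * M) :
    ∃ C, 0 ≤ C ∧ ∀ w : ℝ, ‖Polynomial.aeval (Complex.I * w) p‖ ≤ C * (1 + w ^ 2) ^ M := by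
  refine ⟨∑ j ∈ Finset.range (p.natDegree + 1), |p.coeff j|,
    Finset.sum_nonneg fun _ _ => abs_nonneg _, fun w => ?_⟩
  rw [Polynomial.aeval_eq_sum_range, Finset.sum_mul]
  refine (norm_sum_le _ _).trans (Finset.sum_le_sum fun j hj => ?_)
  rw [norm_smul, norm_pow, norm_mul, Complex.norm_I, one_mul, Complex.norm_real,
    Real.norm_eq_abs, Real.norm_eq_abs]
  refine mul_le_mul_of_nonneg_left (pow_le_one_add_sq_pow w j M ?_) (abs_nonneg _)
  have := Finset.mem_range.1 hj
  omega

omit hlam in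
theorem norm_exp_I_mul (w h : ℝ) : ‖Complex.exp (Complex.I * w * h)‖ = 1 := by
  rw [show Complex.I * w * h = ((w * h : ℝ) : ℂ) * Complex.I by push_cast; ring]
  exact Complex.norm_exp_ofReal_mul_I _

/-- With `M + 1` quadratic factors in the denominator, a polynomial of degree at most `2 * M` leaves
the integrable majorant `(1 + w²)⁻¹`. This is why the covariance function has `2 * M` continuous
derivatives on the whole line. -/
theorem norm_spectralIntegrand_le (M : ℕ) (p : Polynomial ℝ) (hp : p.natDegree ≤ 2 * M) :
    ∃ C, ∀ h w, ‖spectralIntegrand lam M p h w‖ ≤ C * (1 + w ^ 2)⁻¹ := by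
  obtain ⟨C1, hC1, h1⟩ := norm_aeval_le p M hp
  obtain ⟨C2, h2⟩ := ratDensity_le hlam M
  refine ⟨C1 * C2, fun h w => ?_⟩
  rw [spectralIntegrand, norm_mul, norm_mul, norm_exp_I_mul, mul_one, Complex.norm_real,
    Real.norm_eq_abs, abs_of_pos (ratDensity_pos hlam M w)]
  calc _ ≤ (C1 * (1 + w ^ 2) ^ M) * (C2 * ((1 + w ^ 2) ^ (M + 1))⁻¹) :=
        mul_le_mul (h1 w) (h2 w) (ratDensity_pos hlam M w).le (by positivity)
    _ = _ := by
        have : (1 + w ^ 2) ≠ 0 := by positivity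
        field_simp
        ring

omit hlam in
theorem continuous_aeval_I (p : Polynomial ℝ) :
    Continuous fun w : ℝ => Polynomial.aeval (Complex.I * w) p := by
  have : ∀ w : ℝ, Polynomial.aeval (Complex.I * w) p
      = ∑ j ∈ Finset.range (p.natDegree + 1), p.coeff j • (Complex.I * w) ^ j :=
    fun w => Polynomial.aeval_eq_sum_range _
  simp_rw [this]
  fun_prop

theorem continuous_spectralIntegrand (M : ℕ) (p : Polynomial ℝ) (h : ℝ) :
    Continuous (spectralIntegrand lam M p h) := by
  refine ((continuous_aeval_I p).mul (by fun_prop)).mul ?_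
  exact Complex.continuous_ofReal.comp (continuous_ratDensity hlam M)

theorem integrable_spectralIntegrand (M : ℕ) (p : Polynomial ℝ) (hp : p.natDegree ≤ 2 * M) (h : ℝ) :
    Integrable (spectralIntegrand lam M p h) := by
  obtain ⟨C, hC⟩ := norm_spectralIntegrand_le hlam M p hp
  exact (integrable_inv_one_add_sq.const_mul C).mono'
    (continuous_spectralIntegrand hlam M p h).aestronglyMeasurable (ae_of_all _ fun w => hC h w)

theorem spectralOp_add (M : ℕ) (p q : Polynomial ℝ) (hp : p.natDegree ≤ 2 * M)
    (hq : q.natDegree ≤ 2 * M) (h : ℝ) :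
    spectralOp lam M (p + q) h = spectralOp lam M p h + spectralOp lam M q h := by
  rw [spectralOp, spectralOp, spectralOp, ← Complex.add_re,
    ← integral_add (integrable_spectralIntegrand hlam M p hp h)
      (integrable_spectralIntegrand hlam M q hq h)]
  congr 2
  ext w
  simp only [spectralIntegrand, map_add]
  ring

omit hlam in
theorem spectralOp_C_mul (M : ℕ) (c : ℝ) (p : Polynomial ℝ) (h : ℝ) :
    spectralOp lam M (Polynomial.C c * p) h = c * spectralOp lam M p h := by
  rw [spectralOp, spectralOp, ← Complex.re_ofReal_mul, ← integral_const_mul]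
  congr 2
  ext w
  simp only [spectralIntegrand, map_mul, Polynomial.aeval_C, Complex.coe_algebraMap]
  ring

theorem spectralOp_sum (M : ℕ) {ι : Type*} (s : Finset ι) (p : ι → Polynomial ℝ)
    (hp : ∀ i ∈ s, (p i).natDegree ≤ 2 * M) (h : ℝ) :
    spectralOp lam M (∑ i ∈ s, p i) h = ∑ i ∈ s, spectralOp lam M (p i) h := by
  classical
  induction s using Finset.induction_on with
  | empty => simp [spectralOp, spectralIntegrand]
  | insert j s hj ih =>
    have hs : ∀ i ∈ s, (p i).natDegree ≤ 2 * M := fun i hi => hp i (Finset.mem_insert_of_mem hi)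
    rw [Finset.sum_insert hj, Finset.sum_insert hj, spectralOp_add hlam M _ _
      (hp j (Finset.mem_insert_self _ _)) (Polynomial.natDegree_sum_le_of_forall_le _ _ hs), ih hs]

theorem exists_spectralOp_bound (M : ℕ) (p : Polynomial ℝ) (hp : p.natDegree ≤ 2 * M) :
    ∃ C, ∀ h, |spectralOp lam M p h| ≤ C := by
  obtain ⟨C, hC⟩ := norm_spectralIntegrand_le hlam M p hp
  refine ⟨∫ w : ℝ, C * (1 + w ^ 2)⁻¹, fun h => ?_⟩
  exact (Complex.abs_re_le_norm _).trans
    (norm_integral_le_of_norm_le (integrable_inv_one_add_sq.const_mul C) (ae_of_all _ fun w => hC h w))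

theorem continuous_spectralOp (M : ℕ) (p : Polynomial ℝ) (hp : p.natDegree ≤ 2 * M) :
    Continuous (spectralOp lam M p) := by
  obtain ⟨C, hC⟩ := norm_spectralIntegrand_le hlam M p hp
  refine Complex.continuous_re.comp (continuous_of_dominated
    (fun h => (continuous_spectralIntegrand hlam M p h).aestronglyMeasurable)
    (fun h => ae_of_all _ fun w => hC h w) (integrable_inv_one_add_sq.const_mul C)
    (ae_of_all _ fun w => ?_))
  unfold spectralIntegrand
  fun_prop

/-- Differentiation under the integral: `d/dh` brings down the factor `iw`, which is `X` evaluated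
at `iw`. -/
theorem hasDerivAt_spectralOp (M : ℕ) (p : Polynomial ℝ) (hp : p.natDegree + 1 ≤ 2 * M) (h : ℝ) :
    HasDerivAt (spectralOp lam M p) (spectralOp lam M (Polynomial.X * p) h) h := by
  have hXp : (Polynomial.X * p).natDegree ≤ 2 * M :=
    Polynomial.natDegree_mul_le.trans (by rw [Polynomial.natDegree_X]; omega)
  obtain ⟨C, hC⟩ := norm_spectralIntegrand_le hlam M _ hXp
  have key := (hasDerivAt_integral_of_dominated_loc_of_deriv_le (μ := volume)
    (F := fun h w => spectralIntegrand lam M p h w)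
    (F' := fun h w => spectralIntegrand lam M (Polynomial.X * p) h w) (x₀ := h) (s := Set.univ)
    (bound := fun w => C * (1 + w ^ 2)⁻¹) univ_mem
    (Eventually.of_forall fun h => (continuous_spectralIntegrand hlam M p h).aestronglyMeasurable)
    (integrable_spectralIntegrand hlam M p (by omega) h)
    (continuous_spectralIntegrand hlam M _ h).aestronglyMeasurable
    (ae_of_all _ fun w h _ => hC h w) (integrable_inv_one_add_sq.const_mul C)
    (ae_of_all _ fun w x _ => by
      have h1 : HasDerivAt (fun y : ℝ => Complex.exp (Complex.I * w * y))
          (Complex.exp (Complex.I * w * x) * (Complex.I * w)) x := by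
        have := ((hasDerivAt_id (x : ℂ)).const_mul (Complex.I * w)).cexp.comp_ofReal
        simpa using this
      have h2 := (h1.const_mul (Polynomial.aeval (Complex.I * w) p)).mul_const
        (ratDensity lam M w : ℂ)
      refine h2.congr_deriv ?_
      simp only [spectralIntegrand, map_mul, Polynomial.aeval_X]
      ring)).2
  exact (Complex.reCLM.hasFDerivAt.comp_hasDerivAt h key)

/-- At `iw` the polynomial `lam² - X²` equals `lam² + w²` and cancels the last factor of the
density. This drives the induction on the order of the density. -/
theorem spectralOp_mul_sq_sub (M : ℕ) (p : Polynomial ℝ) (h : ℝ) :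
    spectralOp lam (M + 1) (p * (Polynomial.C (lam (M + 1)) ^ 2 - Polynomial.X ^ 2)) h
      = spectralOp lam M p h := by
  rw [spectralOp, spectralOp]
  congr 2
  ext w
  have h0 : ((w : ℂ) ^ 2 + (lam (M + 1) : ℂ) ^ 2) ≠ 0 := by
    have : (0 : ℝ) < w ^ 2 + lam (M + 1) ^ 2 := by have := hlam (M + 1); positivity
    exact_mod_cast this.ne'
  simp only [spectralIntegrand, map_mul, map_sub, map_pow, Polynomial.aeval_X, Polynomial.aeval_C,
    Complex.coe_algebraMap, ratDensity]
  rw [Finset.prod_range_succ _ (M + 1)]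
  push_cast
  rw [mul_inv, mul_pow, Complex.I_sq]
  field_simp
  ring

/-- The covariance function of the Ornstein–Uhlenbeck process. -/
theorem spectralOp_zero_one (h : ℝ) :
    spectralOp lam 0 1 h = Real.pi / lam 0 * Real.exp (-lam 0 * |h|) := by
  set c := lam 0
  have hc : 0 < c := hlam 0
  set g : ℝ → ℂ := fun x => Complex.exp (-c * |x|) with hg
  have hgc : Continuous g := by fun_prop
  -- integrability and Fourier transform, on the two half-lines
  have hcplx : ∀ z : ℂ, (-(c : ℂ) + z).re < 0 → (0 < ((c : ℂ) + z).re) →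
      Integrable (fun x : ℝ => Complex.exp (z * x) * g x) ∧
      ∫ x : ℝ, Complex.exp (z * x) * g x = 1 / (c + z) + 1 / (c - z) := by
    intro z hz1 hz2
    have e1 : Set.EqOn (fun x : ℝ => Complex.exp (z * x) * g x)
        (fun x : ℝ => Complex.exp ((-(c : ℂ) + z) * x)) (Set.Ioi 0) := by
      intro x hx
      simp only [hg]
      rw [abs_of_pos hx, ← Complex.exp_add]; congr 1; ring
    have e2 : Set.EqOn (fun x : ℝ => Complex.exp (z * x) * g x)
        (fun x : ℝ => Complex.exp (((c : ℂ) + z) * x)) (Set.Iic 0) := by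
      intro x hx
      simp only [hg]
      rw [abs_of_nonpos hx, ← Complex.exp_add]; congr 1; push_cast; ring
    have i1 : IntegrableOn (fun x : ℝ => Complex.exp (z * x) * g x) (Set.Ioi 0) :=
      (integrableOn_exp_mul_complex_Ioi hz1 0).congr_fun e1.symm measurableSet_Ioi
    have i2 : IntegrableOn (fun x : ℝ => Complex.exp (z * x) * g x) (Set.Iic 0) :=
      (integrableOn_exp_mul_complex_Iic hz2 0).congr_fun e2.symm measurableSet_Iic
    refine ⟨?_, ?_⟩
    · rw [← integrableOn_univ, ← Set.Iic_union_Ioi (a := (0 : ℝ))]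
      exact i2.union i1
    · rw [← intervalIntegral.integral_Iic_add_Ioi i2 i1, setIntegral_congr_fun measurableSet_Ioi e1,
        setIntegral_congr_fun measurableSet_Iic e2, integral_exp_mul_complex_Ioi hz1,
        integral_exp_mul_complex_Iic hz2]
      simp only [Complex.ofReal_zero, mul_zero, Complex.exp_zero]
      rw [show -(c : ℂ) + z = -(c - z) by ring, neg_div_neg_eq]
  have hFT : ∀ ξ : ℝ, FourierTransform.fourier g ξ
      = ((2 * c / (c ^ 2 + (2 * Real.pi * ξ) ^ 2) : ℝ) : ℂ) := by
    intro ξ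
    have hre : (-(2 * Real.pi * ξ : ℝ) * Complex.I : ℂ).re = 0 := by simp
    obtain ⟨-, h2⟩ := hcplx (-(2 * Real.pi * ξ : ℝ) * Complex.I)
      (by rw [Complex.add_re, hre]; simpa using hc) (by rw [Complex.add_re, hre]; simpa using hc)
    rw [Real.fourier_eq']
    have : ∀ v : ℝ, Complex.exp (((-2 * Real.pi * inner ℝ v ξ : ℝ) : ℂ) * Complex.I) • g v
        = Complex.exp (-(2 * Real.pi * ξ : ℝ) * Complex.I * v) * g v := by
      intro v
      rw [smul_eq_mul]
      congr 2
      simp only [RCLike.inner_apply, conj_trivial]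
      push_cast; ring
    simp_rw [this, h2]
    have hsq : (c : ℂ) ^ 2 + (2 * Real.pi * ξ) ^ 2 ≠ 0 := by
      have : (0 : ℝ) < c ^ 2 + (2 * Real.pi * ξ) ^ 2 := by positivity
      exact_mod_cast this.ne'
    have hfac : ((c : ℂ) + -(2 * Real.pi * ξ : ℝ) * Complex.I)
        * (c - -(2 * Real.pi * ξ : ℝ) * Complex.I) = (c : ℂ) ^ 2 + (2 * Real.pi * ξ) ^ 2 := by
      push_cast
      linear_combination (-(2 * Real.pi * ξ : ℂ) ^ 2) * Complex.I_sq
    have hne := hfac ▸ hsq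
    rw [div_add_div _ _ (left_ne_zero_of_mul hne) (right_ne_zero_of_mul hne), hfac]
    push_cast
    congr 1
    ring
  have hgint : Integrable g := by
    have := (hcplx 0 (by simpa using hc) (by simpa using hc)).1
    simpa using this
  have hFTint : Integrable (FourierTransform.fourier g) := by
    have h1 : Integrable (fun ξ : ℝ => 2 / c * (1 + (2 * Real.pi / c * ξ) ^ 2)⁻¹) :=
      (integrable_inv_one_add_sq.comp_mul_left' (R := 2 * Real.pi / c)
        (by positivity)).const_mul _
    have h2 := h1.ofReal (𝕜 := ℂ)
    refine h2.congr (ae_of_all _ fun ξ => ?_)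
    rw [hFT]
    simp only [Complex.coe_algebraMap]
    congr 1
    field_simp
  -- Fourier inversion recovers `exp (-c |h|)` from its transform. The substitution `w = 2πv`
  -- contributes `1 / (2π)`, which with the factor `2c` gives the constant `c / π`.
  have hinv := congrFun (hgc.fourierInv_fourier_eq hgint hFTint) h
  rw [Real.fourierInv_eq'] at hinv
  have hchange : ∫ v : ℝ, Complex.exp (((2 * Real.pi * inner ℝ v h : ℝ) : ℂ) * Complex.I) •
      FourierTransform.fourier g v
      = ∫ v : ℝ, (fun w : ℝ => (2 * c : ℂ) * spectralIntegrand lam 0 1 h w) (2 * Real.pi * v) := by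
    congr 1
    ext v
    rw [hFT, smul_eq_mul]
    simp only [spectralIntegrand, ratDensity, RCLike.inner_apply, conj_trivial, map_one, zero_add,
      Finset.prod_range_one]
    rw [show Complex.I * ((2 * Real.pi * v : ℝ) : ℂ) * h
      = ((2 * Real.pi * (h * v) : ℝ) : ℂ) * Complex.I by push_cast; ring]
    push_cast
    change _ = 2 * (c : ℂ) * (1 * _ * ((2 * Real.pi * v) ^ 2 + (c : ℂ) ^ 2)⁻¹)
    rw [add_comm ((c : ℂ) ^ 2)]
    ring
  rw [hchange, Measure.integral_comp_mul_left
    (fun w : ℝ => (2 * c : ℂ) * spectralIntegrand lam 0 1 h w), integral_const_mul] at hinv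
  have hre := congrArg Complex.re hinv
  simp only [hg] at hre
  rw [Complex.real_smul, ← mul_assoc,
    show (((|(2 * Real.pi)⁻¹| : ℝ) : ℂ) * (2 * c)) = ((c / Real.pi : ℝ) : ℂ) by
      rw [abs_of_pos (by positivity)]; push_cast; field_simp, Complex.re_ofReal_mul,
    show (-(c : ℂ) * |h|) = ((-c * |h| : ℝ) : ℂ) by push_cast; ring, Complex.exp_ofReal_re] at hre
  rw [spectralOp, ← hre]
  field_simp

end

/-! ### Linear independence of exponential polynomials -/

theorem hasDerivAt_eval_mul_exp (P : Polynomial ℂ) (d : ℂ) (w : ℝ) :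
    HasDerivAt (fun w : ℝ => P.eval (w : ℂ) * Complex.exp (d * w))
      ((P.derivative + Polynomial.C d * P).eval (w : ℂ) * Complex.exp (d * w)) w := by
  have h1 := (P.hasDerivAt (w : ℂ)).comp_ofReal
  have h2 : HasDerivAt (fun y : ℝ => Complex.exp (d * y)) (Complex.exp (d * w) * d) w := by
    have := ((hasDerivAt_id (w : ℂ)).const_mul d).cexp.comp_ofReal
    simpa using this
  refine (h1.mul h2).congr_deriv ?_
  simp only [Polynomial.eval_add, Polynomial.eval_mul, Polynomial.eval_C]
  ring

theorem eq_zero_of_derivative_add_C_mul (P : Polynomial ℂ) (d : ℂ) (hd : d ≠ 0)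
    (h : P.derivative + Polynomial.C d * P = 0) : P = 0 := by
  by_contra hP
  have h1 := Polynomial.degree_derivative_lt hP
  have h2 : P.derivative = -(Polynomial.C d * P) := eq_neg_of_add_eq_zero_left h
  rw [h2, Polynomial.degree_neg, Polynomial.degree_C_mul hd] at h1
  exact lt_irrefl _ h1

/-- Multiplying by `exp (-c i0 w)` and differentiating lowers the degree of `P i0`, while every
other coefficient becomes `P' + d P` with `d ≠ 0`, which vanishes only for `P = 0`. The inner
induction exhausts `P i0`; the outer one removes the frequency. -/
theorem exponential_polynomials_independent {ι : Type*} (s : Finset ι) (c : ι → ℂ) :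
    Set.InjOn c s → ∀ P : ι → Polynomial ℂ,
    (∀ w : ℝ, ∑ i ∈ s, (P i).eval (w : ℂ) * Complex.exp (c i * w) = 0) → ∀ i ∈ s, P i = 0 := by
  classical
  induction s using Finset.induction_on with
  | empty => intro _ P _ i hi; simp at hi
  | insert i0 s hi0 ih =>
    intro hc
    have hc' : Set.InjOn c s := hc.mono (by simp)
    have inner : ∀ n : ℕ, ∀ P : ι → Polynomial ℂ, Polynomial.derivative^[n] (P i0) = 0 →
        (∀ w : ℝ, ∑ i ∈ insert i0 s, (P i).eval (w : ℂ) * Complex.exp (c i * w) = 0) →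
        ∀ i ∈ insert i0 s, P i = 0 := by
      intro n
      induction n with
      | zero =>
        intro P hP h i hi
        have hP0 : P i0 = 0 := hP
        rcases Finset.mem_insert.1 hi with rfl | hi
        · exact hP0
        · refine ih hc' P (fun w => ?_) i hi
          have := h w
          rwa [Finset.sum_insert hi0, hP0, Polynomial.eval_zero, zero_mul, zero_add] at this
      | succ n ihn =>
        intro P hP h
        have h' : ∀ w : ℝ, ∑ i ∈ insert i0 s,
            (P i).eval (w : ℂ) * Complex.exp ((c i - c i0) * w) = 0 := by
          intro w
          have := congrArg (· * Complex.exp (-c i0 * w)) (h w)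
          simp only [zero_mul, Finset.sum_mul] at this
          rw [← this]
          refine Finset.sum_congr rfl fun i _ => ?_
          rw [mul_assoc, ← Complex.exp_add]
          congr 2; ring
        have hQ := ihn (fun i => (P i).derivative + Polynomial.C (c i - c i0) * P i)
          (by
            simp only [sub_self, map_zero, zero_mul, add_zero]
            rwa [Function.iterate_succ_apply] at hP)
          (fun w => by
            have h1 : HasDerivAt (fun w : ℝ => ∑ i ∈ insert i0 s,
                (P i).eval (w : ℂ) * Complex.exp ((c i - c i0) * w)) _ w :=
              HasDerivAt.fun_sum fun i _ => hasDerivAt_eval_mul_exp (P i) (c i - c i0) w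
            have h2 : HasDerivAt (fun w : ℝ => ∑ i ∈ insert i0 s,
                (P i).eval (w : ℂ) * Complex.exp ((c i - c i0) * w)) 0 w := by
              simp_rw [h']; exact hasDerivAt_const _ _
            have h3 := congrArg (· * Complex.exp (c i0 * w)) (h1.unique h2)
            simp only [zero_mul, Finset.sum_mul] at h3
            rw [← h3]
            refine Finset.sum_congr rfl fun i _ => ?_
            rw [mul_assoc, ← Complex.exp_add]
            congr 2; ring)
        have hPs : ∀ i ∈ s, P i = 0 := by
          intro i hi
          refine eq_zero_of_derivative_add_C_mul (P i) (c i - c i0) ?_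
            (hQ i (Finset.mem_insert_of_mem hi))
          refine sub_ne_zero.2 fun hcc => hi0 ?_
          have := hc (by simp [hi]) (by simp) hcc
          rwa [← this]
        intro i hi
        rcases Finset.mem_insert.1 hi with rfl | hi
        · refine Polynomial.eq_zero_of_infinite_isRoot _
            ((Set.infinite_range_of_injective Complex.ofReal_injective).mono ?_)
          rintro _ ⟨w, rfl⟩
          have := h w
          rw [Finset.sum_insert hi0, Finset.sum_eq_zero (fun j hj => by
            rw [hPs j hj, Polynomial.eval_zero, zero_mul]), add_zero] at this
          exact (mul_eq_zero.1 this).resolve_right (Complex.exp_ne_zero _)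
        · exact hPs i hi
    intro P h
    exact inner ((P i0).natDegree + 1) P
      (Polynomial.iterate_derivative_eq_zero (Nat.lt_succ_self _)) h

/-! ### The differential equation of the covariance function -/

/-- Solutions are multiples of `exp (c h)`, and only the zero solution is bounded. This selects the
decaying half of the factors of the differential operator. -/
theorem eq_zero_of_bounded_of_deriv_eq (z : ℝ → ℝ) (c C : ℝ) (hc : 0 < c)
    (hz : ∀ h, 0 < h → HasDerivAt z (c * z h) h) (hC : ∀ h, |z h| ≤ C) (h : ℝ) (hh : 0 < h) :
    z h = 0 := by
  have hw : ∀ x, 0 < x → HasDerivAt (fun x => z x * Real.exp (-c * x)) 0 x := by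
    intro x hx
    have h2 : HasDerivAt (fun y : ℝ => Real.exp (-c * y)) (Real.exp (-c * x) * (-c)) x := by
      simpa using ((hasDerivAt_id x).const_mul (-c)).exp
    exact ((hz x hx).mul h2).congr_deriv (by ring)
  have hconst : ∀ x, 0 < x → z x * Real.exp (-c * x) = z h * Real.exp (-c * h) := fun x hx =>
    isOpen_Ioi.is_const_of_deriv_eq_zero isPreconnected_Ioi
      (fun y hy => (hw y hy).differentiableAt.differentiableWithinAt)
      (fun y hy => (hw y hy).deriv) hx hh
  have hlim : Tendsto (fun x : ℝ => C * Real.exp (-c * x)) atTop (𝓝 (C * 0)) := by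
    refine tendsto_const_nhds.mul (Real.tendsto_exp_atBot.comp ?_)
    exact tendsto_id.const_mul_atTop_of_neg (by linarith)
  have hle : |z h * Real.exp (-c * h)| ≤ C * 0 := by
    refine ge_of_tendsto hlim ?_
    filter_upwards [eventually_gt_atTop 0] with x hx
    rw [← hconst x hx, abs_mul, abs_of_pos (Real.exp_pos _)]
    exact mul_le_mul_of_nonneg_right (hC x) (Real.exp_pos _).le
  rw [mul_zero, abs_nonpos_iff] at hle
  exact (mul_eq_zero.1 hle).resolve_right (Real.exp_pos _).ne'

/-- The polynomial `∏ l < k, (X + lam l)`. -/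
noncomputable def charPoly (lam : ℕ → ℝ) (k : ℕ) : Polynomial ℝ :=
  ∏ l ∈ Finset.range k, (Polynomial.X + Polynomial.C (lam l))

theorem charPoly_monic (lam : ℕ → ℝ) (k : ℕ) : (charPoly lam k).Monic :=
  Polynomial.monic_prod_of_monic _ _ fun l _ => Polynomial.monic_X_add_C (lam l)

theorem natDegree_charPoly (lam : ℕ → ℝ) (k : ℕ) : (charPoly lam k).natDegree = k := by
  rw [charPoly, Polynomial.natDegree_prod_of_monic _ _ fun l _ => Polynomial.monic_X_add_C (lam l)]
  simp

theorem charPoly_succ (lam : ℕ → ℝ) (k : ℕ) :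
    charPoly lam (k + 1) = charPoly lam k * (Polynomial.X + Polynomial.C (lam k)) :=
  Finset.prod_range_succ _ _

section

variable {lam : ℕ → ℝ} (hlam : ∀ l, 0 < lam l)
include hlam

/-- Write `D = d/dh`; the claim is that `∏ l ≤ M, (D + lam l)` annihilates the covariance function
for `h > 0`. The base case is the Ornstein–Uhlenbeck covariance. In the inductive step `x = (D + a)
L` applied to the new covariance satisfies `(a - D) x = g`, and `(D + b) g = 0` by induction. Hence
`z = (D + b) x` satisfies `z' = a z`, and being bounded it vanishes. -/
theorem hasDerivAt_spectralOp_charPoly (M : ℕ) : ∀ h, 0 < h →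
    HasDerivAt (spectralOp lam M (charPoly lam M))
      (-lam M * spectralOp lam M (charPoly lam M) h) h := by
  induction M with
  | zero =>
    intro h hh
    have h0 : charPoly lam 0 = 1 := by simp [charPoly]
    rw [h0]
    have h2 : HasDerivAt (fun y : ℝ => Real.pi / lam 0 * Real.exp (-lam 0 * y))
        (-lam 0 * (Real.pi / lam 0 * Real.exp (-lam 0 * h))) h := by
      have : HasDerivAt (fun y : ℝ => Real.exp (-lam 0 * y)) (Real.exp (-lam 0 * h) * (-lam 0)) h := by
        simpa using ((hasDerivAt_id h).const_mul (-lam 0)).exp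
      exact (this.const_mul _).congr_deriv (by ring)
    rw [spectralOp_zero_one hlam, abs_of_pos hh]
    refine h2.congr_of_eventuallyEq ?_
    filter_upwards [lt_mem_nhds hh] with y hy
    rw [spectralOp_zero_one hlam, abs_of_pos hy]
  | succ M ih =>
    intro h hh
    set L := charPoly lam M with hL
    have hLd : L.natDegree = M := natDegree_charPoly lam M
    set a := lam (M + 1)
    set b := lam M
    set p := L * (Polynomial.X + Polynomial.C a)
    have hpd : p.natDegree ≤ M + 1 :=
      Polynomial.natDegree_mul_le.trans (by rw [hLd, Polynomial.natDegree_X_add_C])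
    have hXp : (Polynomial.X * p).natDegree ≤ M + 2 :=
      Polynomial.natDegree_mul_le.trans (by rw [Polynomial.natDegree_X]; omega)
    have hbp : (Polynomial.C b * p).natDegree ≤ M + 1 :=
      (Polynomial.natDegree_C_mul_le _ _).trans hpd
    set x := spectralOp lam (M + 1) p with hx
    set x' := spectralOp lam (M + 1) (Polynomial.X * p)
    set g := spectralOp lam M L
    have hxd : ∀ y, HasDerivAt x (x' y) y := fun y =>
      hasDerivAt_spectralOp hlam (M + 1) p (by omega) y
    have hrel : ∀ y, x' y = a * x y - g y := by
      intro y
      have h1 : Polynomial.X * p = Polynomial.C a * p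
          + Polynomial.C (-1) * (L * (Polynomial.C a ^ 2 - Polynomial.X ^ 2)) := by
        simp only [p, map_neg, map_one]; ring
      have h2 : (L * (Polynomial.C a ^ 2 - Polynomial.X ^ 2)).natDegree ≤ M + 2 := by
        refine Polynomial.natDegree_mul_le.trans ?_
        rw [hLd]
        refine add_le_add le_rfl ((Polynomial.natDegree_sub_le _ _).trans ?_)
        rw [← map_pow]
        simp
      change spectralOp lam (M + 1) (Polynomial.X * p) y = _
      rw [h1, spectralOp_add hlam _ _ _
        ((Polynomial.natDegree_C_mul_le _ _).trans (by omega))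
        ((Polynomial.natDegree_C_mul_le _ _).trans (by omega)), spectralOp_C_mul,
        spectralOp_C_mul, spectralOp_mul_sq_sub hlam]
      ring
    have hz : ∀ y, 0 < y → x' y + b * x y = 0 := by
      obtain ⟨C1, hC1⟩ := exists_spectralOp_bound hlam (M + 1) (Polynomial.X * p) (by omega)
      obtain ⟨C2, hC2⟩ := exists_spectralOp_bound hlam (M + 1) (Polynomial.C b * p) (by omega)
      intro y hy
      refine eq_zero_of_bounded_of_deriv_eq (fun y => x' y + b * x y) a (C1 + C2) (hlam _) ?_ ?_ y hy
      · intro s hs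
        have h1 : HasDerivAt (fun y => a * x y - g y + b * x y)
            (a * x' s - -b * g s + b * x' s) s :=
          (((hxd s).const_mul a).sub (ih s hs)).add ((hxd s).const_mul b)
        have h2 : (fun y => x' y + b * x y) = fun y => a * x y - g y + b * x y := by
          ext y; rw [hrel]
        rw [h2]
        refine h1.congr_deriv ?_
        rw [hrel]; ring
      · intro s
        have h3 := hC2 s
        rw [spectralOp_C_mul] at h3
        exact (abs_add_le _ _).trans (add_le_add (hC1 s) h3)
    have hdeg : (charPoly lam (M + 1)).natDegree = M + 1 := natDegree_charPoly lam _
    have hd := hasDerivAt_spectralOp hlam (M + 1) (charPoly lam (M + 1)) (by omega) h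
    refine hd.congr_deriv ?_
    have h4 : Polynomial.X * charPoly lam (M + 1) + Polynomial.C a * charPoly lam (M + 1)
        = Polynomial.X * p + Polynomial.C b * p := by
      rw [charPoly_succ]; simp only [p]; ring
    have h5 := congrArg (fun r => spectralOp lam (M + 1) r h) h4
    rw [spectralOp_add hlam _ _ _
      (Polynomial.natDegree_mul_le.trans (by rw [Polynomial.natDegree_X]; omega))
      ((Polynomial.natDegree_C_mul_le _ _).trans (by omega)),
      spectralOp_add hlam _ _ _ (by omega) (by omega), spectralOp_C_mul, spectralOp_C_mul] at h5
    have h6 := hz h hh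
    linarith

/-- The characteristic polynomial is monic, so the equation can be solved for the highest
derivative. The case `M = 0` is separate because no derivative is then available as a convergent
integral. -/
theorem exists_hasDerivAt_spectralOp_X_pow (M : ℕ) : ∃ a : ℕ → ℝ, ∀ h, 0 < h →
    HasDerivAt (spectralOp lam M (Polynomial.X ^ M))
      (-∑ j ∈ Finset.range (M + 1), a j * spectralOp lam M (Polynomial.X ^ j) h) h := by
  set r := charPoly lam M - Polynomial.X ^ M with hr
  set R := Polynomial.C (lam M) * charPoly lam M + Polynomial.X * r with hR
  have hdeg := natDegree_charPoly lam M
  have hrd : M = 0 ∧ r = 0 ∨ r.natDegree + 1 ≤ M := by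
    rcases Nat.eq_zero_or_pos M with h | h
    · left; refine ⟨h, ?_⟩
      subst h
      simp [hr, charPoly]
    · right
      have h1 : r.degree < (charPoly lam M).degree := by
        refine Polynomial.degree_sub_lt_left ?_ (charPoly_monic lam M).ne_zero ?_
        · rw [Polynomial.degree_X_pow, Polynomial.degree_eq_natDegree (charPoly_monic lam M).ne_zero,
            hdeg]
        · rw [(charPoly_monic lam M).leadingCoeff, (Polynomial.monic_X_pow M).leadingCoeff]
      rw [Polynomial.degree_eq_natDegree (charPoly_monic lam M).ne_zero, hdeg] at h1
      by_cases hr0 : r = 0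
      · rw [hr0, Polynomial.natDegree_zero]; omega
      · rw [Polynomial.degree_eq_natDegree hr0] at h1
        have : r.natDegree < M := by exact_mod_cast h1
        omega
  have hXr : (Polynomial.X * r).natDegree ≤ M := by
    rcases hrd with ⟨-, h⟩ | h
    · simp [h]
    · exact Polynomial.natDegree_mul_le.trans (by rw [Polynomial.natDegree_X]; omega)
  have hRd : R.natDegree ≤ M :=
    (Polynomial.natDegree_add_le _ _).trans
      (max_le ((Polynomial.natDegree_C_mul_le _ _).trans hdeg.le) hXr)
  refine ⟨R.coeff, fun h hh => ?_⟩
  have hsum : ∑ j ∈ Finset.range (M + 1), R.coeff j * spectralOp lam M (Polynomial.X ^ j) h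
      = spectralOp lam M R h := by
    conv_rhs => rw [Polynomial.as_sum_range_C_mul_X_pow' R (Nat.lt_succ_of_le hRd)]
    rw [spectralOp_sum hlam]
    · exact Finset.sum_congr rfl fun j _ => (spectralOp_C_mul _ _ _ _).symm
    · intro j hj
      have := Finset.mem_range.1 hj
      exact (Polynomial.natDegree_C_mul_X_pow_le _ _).trans (by omega)
  have hrder : HasDerivAt (spectralOp lam M r) (spectralOp lam M (Polynomial.X * r) h) h := by
    rcases hrd with ⟨-, h0⟩ | h0
    · have h1 : spectralOp lam M 0 = fun _ => 0 := by
        ext y; simp [spectralOp, spectralIntegrand]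
      rw [h0, mul_zero, h1]
      exact hasDerivAt_const _ _
    · exact hasDerivAt_spectralOp hlam M r (by omega) h
  have hrm : r.natDegree ≤ M := by
    rcases hrd with ⟨-, h0⟩ | h0
    · simp [h0]
    · omega
  have hfun : spectralOp lam M (Polynomial.X ^ M)
      = fun y => spectralOp lam M (charPoly lam M) y - spectralOp lam M r y := by
    ext y
    have h1 : charPoly lam M = Polynomial.X ^ M + r := by rw [hr]; ring
    rw [eq_sub_iff_add_eq, ← spectralOp_add hlam _ _ _ (by rw [Polynomial.natDegree_X_pow]; omega)
      (by omega), ← h1]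
  rw [hsum, hfun]
  refine ((hasDerivAt_spectralOp_charPoly hlam M h hh).sub hrder).congr_deriv ?_
  rw [hR, spectralOp_add hlam _ _ _ ((Polynomial.natDegree_C_mul_le _ _).trans (by omega))
    (by omega), spectralOp_C_mul]
  ring

end

/-! ### Covariance matrices of a process and its derivatives -/

/-- The entry `(k, l)` is `(-1)ˡ y_{k+l}(s - t)`. -/
def derivCov (M : ℕ) (y : ℕ → ℝ → ℝ) (s t : ℝ) : Matrix (Fin (M + 1)) (Fin (M + 1)) ℝ :=
  Matrix.of fun k l => (-1) ^ (l : ℕ) * y (k + l) (s - t)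

theorem multiCov_eq_derivCov (M : ℕ) (y : ℕ → ℝ → ℝ)
    (hy : ∀ j, j < 2 * M → ∀ h, HasDerivAt (y j) (y (j + 1) h) h) (s t : ℝ) :
    multiCov M (y 0) s t = derivCov M y s t := by
  have h1 : ∀ l, l ≤ 2 * M → ∀ x : ℝ,
      iteratedDeriv l (fun z => y 0 (x - z)) = fun z => (-1) ^ l * y l (x - z) := by
    intro l
    induction l with
    | zero => intro _ x; simp
    | succ l ih =>
      intro hl x
      rw [iteratedDeriv_succ, ih (by omega) x]
      ext z
      have h2 : HasDerivAt (fun z => y l (x - z)) (y (l + 1) (x - z) * (-1)) z :=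
        (hy l (by omega) (x - z)).comp z ((hasDerivAt_id z).const_sub x)
      rw [(h2.const_mul ((-1) ^ l)).deriv, pow_succ]
      ring
  have h3 : ∀ l k, k + l ≤ 2 * M →
      iteratedDeriv k (fun x => (-1) ^ l * y l (x - t))
        = fun x => (-1) ^ l * y (k + l) (x - t) := by
    intro l k
    induction k with
    | zero => intro _; simp
    | succ k ih =>
      intro hk
      rw [iteratedDeriv_succ, ih (by omega)]
      ext x
      have h2 : HasDerivAt (fun x => y (k + l) (x - t)) (y (k + l + 1) (x - t)) x :=
        (hy (k + l) (by omega) (x - t)).comp_sub_const x t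
      rw [(h2.const_mul ((-1) ^ l)).deriv]
      congr 2; ring
  ext k l
  have hk := Nat.lt_succ_iff.1 k.2
  have hl := Nat.lt_succ_iff.1 l.2
  simp only [multiCov, derivCov, Matrix.of_apply]
  simp_rw [h1 l (by omega)]
  rw [h3 l k (by omega)]

/-! ### The Markov property -/

/-- The equation is assumed only for positive times, since the highest derivatives of a covariance
function may break at lag `0`. Continuity supplies the right derivative at `0`, and uniqueness for
Lipschitz equations applies. -/
theorem linear_ode_eq_zero {E : Type*} [NormedAddCommGroup E] [NormedSpace ℝ E]
    (A : E →L[ℝ] E) (d : ℝ → E) (hd : Continuous d) (hd' : ∀ τ, 0 < τ → HasDerivAt d (A (d τ)) τ)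
    (h0 : d 0 = 0) (τ : ℝ) (hτ : 0 ≤ τ) : d τ = 0 := by
  have hright : ∀ s, 0 ≤ s → HasDerivWithinAt d (A (d s)) (Set.Ici s) s := by
    intro s hs
    refine hasDerivWithinAt_Ici_of_tendsto_deriv (s := Set.Ioi s)
      (fun x hx => (hd' x (hs.trans_lt hx)).differentiableAt.differentiableWithinAt)
      hd.continuousWithinAt self_mem_nhdsWithin ?_
    have h1 : Tendsto (fun x => A (d x)) (𝓝[>] s) (𝓝 (A (d s))) :=
      ((A.continuous.comp hd).tendsto s).mono_left nhdsWithin_le_nhds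
    refine h1.congr' ?_
    filter_upwards [self_mem_nhdsWithin] with x hx
    exact ((hd' x (hs.trans_lt hx)).deriv).symm
  have := ODE_solution_unique (v := fun _ => A) (K := ‖A‖₊) (f := d) (g := fun _ => 0)
    (a := 0) (b := τ) (fun _ => A.lipschitz) hd.continuousOn (fun s hs => hright s hs.1)
    continuousOn_const
    (fun s _ => by rw [map_zero]; exact hasDerivWithinAt_const _ _ _) h0
  exact this ⟨hτ, le_rfl⟩

/-- The equation is differentiated `l` times. For `l = M` it yields a derivative of `y (2 * M)` away
from the origin, which the smoothness hypothesis alone does not provide. -/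
theorem hasDerivAt_higher_order (M : ℕ) (y : ℕ → ℝ → ℝ) (a : ℕ → ℝ)
    (hy : ∀ j, j < 2 * M → ∀ h, HasDerivAt (y j) (y (j + 1) h) h)
    (h0 : ∀ h, 0 < h → HasDerivAt (y M) (-∑ j ∈ Finset.range (M + 1), a j * y j h) h) (l : ℕ) :
    l ≤ M → ∀ h, 0 < h →
      HasDerivAt (y (M + l)) (-∑ j ∈ Finset.range (M + 1), a j * y (j + l) h) h := by
  induction l with
  | zero => exact fun _ => h0
  | succ l ih =>
    intro hl h hh
    have heq : ∀ x, 0 < x → y (M + l + 1) x = -∑ j ∈ Finset.range (M + 1), a j * y (j + l) x :=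
      fun x hx => (hy (M + l) (by omega) x).unique (ih (by omega) x hx)
    have hder : HasDerivAt (fun x => -∑ j ∈ Finset.range (M + 1), a j * y (j + l) x)
        (-∑ j ∈ Finset.range (M + 1), a j * y (j + l + 1) h) h := by
      refine (HasDerivAt.fun_sum fun j hj => ?_).fun_neg
      have := Finset.mem_range.1 hj
      exact (hy (j + l) (by omega) h).const_mul _
    refine HasDerivAt.congr_of_eventuallyEq hder ?_
    filter_upwards [lt_mem_nhds hh] with x hx using heq x hx

/-- The companion matrix of the differential equation, as a linear map. -/
noncomputable def companionMap (M : ℕ) (a : ℕ → ℝ) : (Fin (M + 1) → ℝ) →L[ℝ] (Fin (M + 1) → ℝ) :=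
  LinearMap.toContinuousLinearMap
    { toFun := fun v k => if h : (k : ℕ) < M then v ⟨k + 1, by omega⟩ else -∑ j : Fin (M + 1), a j * v j
      map_add' := by
        intro v w
        ext k
        by_cases h : (k : ℕ) < M
        · simp [h]
        · simp only [h, dite_false, Pi.add_apply, mul_add, Finset.sum_add_distrib]; ring
      map_smul' := by
        intro c v
        ext k
        by_cases h : (k : ℕ) < M
        · simp [h]
        · simp only [h, dite_false, Pi.smul_apply, smul_eq_mul, RingHom.id_apply, mul_neg,
            Finset.mul_sum]
          congr 1
          exact Finset.sum_congr rfl fun j _ => by ring }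

theorem hasDerivAt_stateVector (M : ℕ) (y : ℕ → ℝ → ℝ) (a : ℕ → ℝ)
    (hy : ∀ j, j < 2 * M → ∀ h, HasDerivAt (y j) (y (j + 1) h) h)
    (h0 : ∀ h, 0 < h → HasDerivAt (y M) (-∑ j ∈ Finset.range (M + 1), a j * y j h) h)
    (l : ℕ) (hl : l ≤ M) (b τ : ℝ) (hb : 0 < b + τ) :
    HasDerivAt (fun τ => fun k : Fin (M + 1) => y (k + l) (b + τ))
      (companionMap M a (fun k : Fin (M + 1) => y (k + l) (b + τ))) τ := by
  rw [hasDerivAt_pi]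
  intro k
  have hshift : ∀ {f : ℝ → ℝ} {f' : ℝ}, HasDerivAt f f' (b + τ) →
      HasDerivAt (fun τ => f (b + τ)) f' τ := fun h => h.comp_const_add b τ
  by_cases h : (k : ℕ) < M
  · refine (hshift (hy (k + l) (by omega) _)).congr_deriv ?_
    simp only [companionMap, LinearMap.coe_toContinuousLinearMap', LinearMap.coe_mk,
      AddHom.coe_mk, h, dite_true]
    rw [add_right_comm]
  · have hk : (k : ℕ) = M := by omega
    have := hshift (hasDerivAt_higher_order M y a hy h0 l hl (b + τ) hb)
    rw [hk]
    refine this.congr_deriv ?_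
    simp only [companionMap, LinearMap.coe_toContinuousLinearMap', LinearMap.coe_mk,
      AddHom.coe_mk, hk, lt_irrefl, dite_false]
    rw [Fin.sum_univ_eq_sum_range (fun j => a j * y (j + l) (b + τ))]

/-- As functions of `x ≥ s`, the columns of both sides solve the same companion system. They agree
at `x = s` by the choice of the transition factor, hence for all later `x`. -/
theorem derivCov_markov (M : ℕ) (y : ℕ → ℝ → ℝ) (a : ℕ → ℝ)
    (hy : ∀ j, j < 2 * M → ∀ h, HasDerivAt (y j) (y (j + 1) h) h)
    (hc : ∀ j, j ≤ 2 * M → Continuous (y j))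
    (h0 : ∀ h, 0 < h → HasDerivAt (y M) (-∑ j ∈ Finset.range (M + 1), a j * y j h) h)
    (s t x : ℝ) (hts : t ≤ s) (hsx : s ≤ x) (hdet : IsUnit (derivCov M y s s).det) :
    derivCov M y x t = derivCov M y x s * ((derivCov M y s s)⁻¹ * derivCov M y s t) := by
  set Ψ := (derivCov M y s s)⁻¹ * derivCov M y s t with hΨ
  ext k₀ l₀
  set Y : ℕ → ℝ → ℝ → Fin (M + 1) → ℝ := fun l b τ k => y (k + l) (b + τ) with hY
  set d : ℝ → Fin (M + 1) → ℝ := fun τ => (-1 : ℝ) ^ (l₀ : ℕ) • Y l₀ (s - t) τ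
    - ∑ l : Fin (M + 1), ((-1 : ℝ) ^ (l : ℕ) * Ψ l l₀) • Y l 0 τ with hd
  have hdval : ∀ τ k, d τ k = derivCov M y (s + τ) t k l₀ - (derivCov M y (s + τ) s * Ψ) k l₀ := by
    intro τ k
    simp only [hd, hY, Pi.sub_apply, Pi.smul_apply, smul_eq_mul, Finset.sum_apply, derivCov,
      Matrix.of_apply, Matrix.mul_apply]
    congr 1
    · congr 2; ring
    · refine Finset.sum_congr rfl fun l _ => ?_
      rw [show s + τ - s = 0 + τ by ring]; ring
  have hYc : ∀ l b, l ≤ M → Continuous (Y l b) := by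
    intro l b hl
    refine continuous_pi fun k => ?_
    exact (hc (k + l) (by omega)).comp (by fun_prop)
  have hdc : Continuous d := by
    refine Continuous.sub ?_ ?_
    · exact (hYc l₀ _ (by omega)).const_smul ((-1 : ℝ) ^ (l₀ : ℕ))
    · refine continuous_finsetSum _ fun l _ => ?_
      exact (hYc l _ (by omega)).const_smul ((-1 : ℝ) ^ (l : ℕ) * Ψ l l₀)
  have hd' : ∀ τ, 0 < τ → HasDerivAt d (companionMap M a (d τ)) τ := by
    intro τ hτ
    have h1 : HasDerivAt d _ τ :=
      ((hasDerivAt_stateVector M y a hy h0 l₀ (by omega) (s - t) τ (by linarith)).const_smul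
        ((-1 : ℝ) ^ (l₀ : ℕ))).sub
      (HasDerivAt.fun_sum fun (l : Fin (M + 1)) (_ : l ∈ Finset.univ) =>
        (hasDerivAt_stateVector M y a hy h0 l (by omega) 0 τ (by linarith)).const_smul
          ((-1 : ℝ) ^ (l : ℕ) * Ψ l l₀))
    refine h1.congr_deriv ?_
    simp only [hd, map_sub, map_sum, map_smul, hY]
  have hd0 : d 0 = 0 := by
    ext k
    rw [hdval, add_zero, hΨ, ← Matrix.mul_assoc, Matrix.mul_nonsing_inv _ hdet, Matrix.one_mul]
    simp
  have := congrFun (linear_ode_eq_zero (companionMap M a) d hdc hd' hd0 (x - s) (by linarith)) k₀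
  rw [hdval, add_sub_cancel] at this
  exact sub_eq_zero.1 this

/-! ### Positive definiteness -/

section

variable {lam : ℕ → ℝ} (hlam : ∀ l, 0 < lam l)

theorem spectralIntegrand_X_pow (M j : ℕ) (h w : ℝ) :
    spectralIntegrand lam M (Polynomial.X ^ j) h w
      = (Complex.I * w) ^ j * Complex.exp (Complex.I * w * h) * (ratDensity lam M w : ℂ) := by
  simp [spectralIntegrand]

theorem spectralOp_X_pow_neg (M j : ℕ) (h : ℝ) :
    spectralOp lam M (Polynomial.X ^ j) (-h) = (-1) ^ j * spectralOp lam M (Polynomial.X ^ j) h := by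
  have h1 : ∀ w, spectralIntegrand lam M (Polynomial.X ^ j) (-h) w
      = ((-1 : ℝ) ^ j : ℝ) * (starRingEnd ℂ) (spectralIntegrand lam M (Polynomial.X ^ j) h w) := by
    intro w
    rw [spectralIntegrand_X_pow, spectralIntegrand_X_pow]
    simp only [map_mul, map_pow, Complex.conj_I, Complex.conj_ofReal, ← Complex.exp_conj]
    push_cast
    rw [neg_mul, neg_pow (Complex.I * (w : ℂ)), ← mul_assoc, ← mul_assoc, ← mul_assoc, ← mul_pow,
      neg_one_mul, neg_neg, one_pow, one_mul]
    congr 3; ring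
  rw [spectralOp, spectralOp]
  simp_rw [h1]
  rw [integral_const_mul, Complex.re_ofReal_mul, integral_conj, Complex.conj_re]

/-- The function `∑ v_{a,k} (iw)ᵏ exp(iw t_a)`. -/
noncomputable def expSum {n q : ℕ} (t : Fin n → ℝ) (v : Fin n × Fin q → ℝ) (w : ℝ) : ℂ :=
  ∑ x : Fin n × Fin q, (v x : ℂ) * ((Complex.I * w) ^ (x.2 : ℕ) * Complex.exp (Complex.I * w * t x.1))

theorem continuous_expSum {n q : ℕ} (t : Fin n → ℝ) (v : Fin n × Fin q → ℝ) :
    Continuous (expSum t v) := by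
  unfold expSum
  fun_prop

theorem eq_zero_of_expSum_eq_zero {n q : ℕ} (t : Fin n → ℝ) (ht : Function.Injective t)
    (v : Fin n × Fin q → ℝ) (h : ∀ w, expSum t v w = 0) : v = 0 := by
  have key := exponential_polynomials_independent (Finset.univ : Finset (Fin n))
    (fun a => Complex.I * t a)
    (fun a _ b _ hab => ht (by simpa using hab))
    (fun a => ∑ k : Fin q, Polynomial.C ((v (a, k) : ℂ) * Complex.I ^ (k : ℕ)) *
      Polynomial.X ^ (k : ℕ))
    (fun w => by
      rw [← h w, expSum, Fintype.sum_prod_type]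
      refine Finset.sum_congr rfl fun a _ => ?_
      rw [Polynomial.eval_finsetSum, Finset.sum_mul]
      refine Finset.sum_congr rfl fun k _ => ?_
      simp only [Polynomial.eval_mul, Polynomial.eval_C, Polynomial.eval_pow, Polynomial.eval_X]
      rw [mul_pow, show Complex.I * (t a : ℂ) * w = Complex.I * w * t a by ring]
      ring)
  ext ⟨a, k⟩
  have h1 := congrArg (fun P => Polynomial.coeff P (k : ℕ)) (key a (Finset.mem_univ a))
  simp only [Polynomial.finsetSum_coeff, Polynomial.coeff_C_mul, Polynomial.coeff_X_pow,
    Polynomial.coeff_zero] at h1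
  rw [Finset.sum_eq_single k (fun b _ hb => by
      rw [if_neg (fun h => hb (Fin.ext h.symm)), mul_zero]) (by simp)] at h1
  simpa using h1

include hlam

/-- The sign `(-1) ^ l` is the conjugation of `(iw) ^ l`, so the double sum under the integral is
the squared modulus of one exponential sum. -/
theorem quadraticForm_eq_integral (M n : ℕ) (t : Fin n → ℝ) (v : Fin n × Fin (M + 1) → ℝ) :
    Integrable (fun w => ‖expSum t v w‖ ^ 2 * ratDensity lam M w) ∧
    ∑ x, ∑ x', v x * (((-1) ^ (x'.2 : ℕ) * spectralOp lam M
        (Polynomial.X ^ ((x.2 : ℕ) + (x'.2 : ℕ))) (t x.1 - t x'.1)) * v x')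
      = ∫ w, ‖expSum t v w‖ ^ 2 * ratDensity lam M w := by
  have hint : ∀ (x x' : Fin n × Fin (M + 1)), Integrable (fun w =>
      (v x * ((-1) ^ (x'.2 : ℕ) * v x')) * (spectralIntegrand lam M
        (Polynomial.X ^ ((x.2 : ℕ) + (x'.2 : ℕ))) (t x.1 - t x'.1) w).re) := fun x x' => by
    have h1 := integrable_spectralIntegrand hlam M (Polynomial.X ^ ((x.2 : ℕ) + (x'.2 : ℕ)))
      (by rw [Polynomial.natDegree_X_pow]; omega) (t x.1 - t x'.1)
    exact h1.re.const_mul _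
  have hpt : ∀ w, ‖expSum t v w‖ ^ 2 * ratDensity lam M w = ∑ x, ∑ x',
      (v x * ((-1) ^ (x'.2 : ℕ) * v x')) * (spectralIntegrand lam M
        (Polynomial.X ^ ((x.2 : ℕ) + (x'.2 : ℕ))) (t x.1 - t x'.1) w).re := by
    intro w
    have h1 : ((‖expSum t v w‖ ^ 2 * ratDensity lam M w : ℝ) : ℂ) = ∑ x, ∑ x',
      ((v x * ((-1) ^ (x'.2 : ℕ) * v x') : ℝ) : ℂ) * (spectralIntegrand lam M
        (Polynomial.X ^ ((x.2 : ℕ) + (x'.2 : ℕ))) (t x.1 - t x'.1) w) := by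
      push_cast
      rw [← Complex.mul_conj', expSum, map_sum, Finset.sum_mul_sum, Finset.sum_mul]
      refine Finset.sum_congr rfl fun x _ => ?_
      rw [Finset.sum_mul]
      refine Finset.sum_congr rfl fun x' _ => ?_
      rw [spectralIntegrand_X_pow]
      simp only [map_mul, map_pow, Complex.conj_I, Complex.conj_ofReal, ← Complex.exp_conj]
      push_cast
      rw [show Complex.I * (w : ℂ) * ((t x.1 : ℂ) - t x'.1)
        = Complex.I * w * t x.1 + (-Complex.I * w * t x'.1) by ring, Complex.exp_add, pow_add,
        neg_mul, neg_pow (Complex.I * (w : ℂ))]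
      ring
    have h2 := congrArg Complex.re h1
    rw [Complex.ofReal_re, Complex.re_sum] at h2
    rw [h2]
    refine Finset.sum_congr rfl fun x _ => ?_
    rw [Complex.re_sum]
    exact Finset.sum_congr rfl fun x' _ => Complex.re_ofReal_mul _ _
  simp_rw [hpt]
  refine ⟨integrable_finsetSum _ fun x _ => integrable_finsetSum _ fun x' _ => hint x x', ?_⟩
  rw [integral_finsetSum _ fun x _ => integrable_finsetSum _ fun x' _ => hint x x']
  refine Finset.sum_congr rfl fun x _ => ?_
  rw [integral_finsetSum _ fun x' _ => hint x x']
  refine Finset.sum_congr rfl fun x' _ => ?_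
  rw [integral_const_mul]
  have h1 := integrable_spectralIntegrand hlam M (Polynomial.X ^ ((x.2 : ℕ) + (x'.2 : ℕ)))
      (by rw [Polynomial.natDegree_X_pow]; omega) (t x.1 - t x'.1)
  have h3 := integral_re h1
  simp only [RCLike.re_to_complex] at h3
  rw [h3, spectralOp]
  ring

theorem quadraticForm_pos (M n : ℕ) (t : Fin n → ℝ) (ht : Function.Injective t)
    (v : Fin n × Fin (M + 1) → ℝ) (hv : v ≠ 0) :
    0 < ∑ x, ∑ x', v x * (((-1) ^ (x'.2 : ℕ) * spectralOp lam M
        (Polynomial.X ^ ((x.2 : ℕ) + (x'.2 : ℕ))) (t x.1 - t x'.1)) * v x') := by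
  obtain ⟨hint, heq⟩ := quadraticForm_eq_integral hlam M n t v
  rw [heq]
  have hcont : Continuous (fun w => ‖expSum t v w‖ ^ 2 * ratDensity lam M w) :=
    ((continuous_expSum t v).norm.pow 2).mul (continuous_ratDensity hlam M)
  have hnn : ∀ w, 0 ≤ ‖expSum t v w‖ ^ 2 * ratDensity lam M w := fun w =>
    mul_nonneg (by positivity) (ratDensity_pos hlam M w).le
  obtain ⟨w, hw⟩ : ∃ w, expSum t v w ≠ 0 := by
    by_contra! h
    exact hv (eq_zero_of_expSum_eq_zero t ht v h)
  refine integral_pos_of_integrable_nonneg_nonzero (x := w) hcont hint hnn ?_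
  exact mul_ne_zero (pow_ne_zero _ (norm_ne_zero_iff.2 hw)) (ratDensity_pos hlam M w).ne'

/-- The covariance matrix of a process with rational spectral density and of its derivatives. -/
theorem posDef_blockCov_derivCov (M n : ℕ) (C : ℝ) (hC : 0 < C) (t : Fin n → ℝ)
    (ht : Function.Injective t) :
    (blockCov (derivCov M fun j h => C * spectralOp lam M (Polynomial.X ^ j) h) t).PosDef := by
  refine Matrix.PosDef.of_dotProduct_mulVec_pos ?_ fun v hv => ?_
  · ext x x'
    simp only [Matrix.conjTranspose_apply, blockCov, derivCov, Matrix.of_apply, star_trivial]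
    rw [show t x'.1 - t x.1 = -(t x.1 - t x'.1) by ring, spectralOp_X_pow_neg,
      add_comm (x'.2 : ℕ), pow_add]
    have h1 : ((-1 : ℝ) ^ (x.2 : ℕ)) * (-1) ^ (x.2 : ℕ) = 1 := by
      rw [← mul_pow]; norm_num
    linear_combination (C * (-1) ^ (x'.2 : ℕ) * spectralOp lam M
      (Polynomial.X ^ ((x.2 : ℕ) + (x'.2 : ℕ))) (t x.1 - t x'.1)) * h1
  · have h1 := mul_pos hC (quadraticForm_pos hlam M n t ht v hv)
    convert h1 using 1
    simp only [dotProduct, Matrix.mulVec, blockCov, derivCov, Matrix.of_apply, star_trivial,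
      Pi.star_apply]
    rw [Finset.mul_sum]
    refine Finset.sum_congr rfl fun x _ => ?_
    rw [Finset.mul_sum, Finset.mul_sum]
    refine Finset.sum_congr rfl fun x' _ => ?_
    ring

end

/-! ### Precision matrices of Markov covariances -/

theorem blockCov_row_mul {n d q : ℕ} (r : ℝ → ℝ → Matrix (Fin q) (Fin q) ℝ) (t : Fin n → ℝ)
    (w : Fin d → Fin n) (A : Fin d × Fin q → ℝ) (l : Fin n) (j : Fin q) :
    ∑ x : Fin n × Fin q, (∑ y, if w y = x.1 then A (y, x.2) else 0) * blockCov r t x (l, j)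
      = ∑ z : Fin d × Fin q, A z * r (t (w z.1)) (t l) z.2 j := by
  rw [Fintype.sum_prod_type, Fintype.sum_prod_type]
  simp only [Finset.sum_mul]
  rw [Finset.sum_comm]
  rw [Finset.sum_comm (s := (Finset.univ : Finset (Fin d)))]
  refine Finset.sum_congr rfl fun p _ => ?_
  rw [Finset.sum_comm]
  refine Finset.sum_congr rfl fun y _ => ?_
  rw [Finset.sum_eq_single (w y)]
  · rw [if_pos rfl]; rfl
  · intro b _ hb
    rw [if_neg (Ne.symm hb), zero_mul]
  · simp

/-- If the blocks outside a window are determined by a block of the window other than `a`, then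
the row `a` of the precision matrix of the window is a row of the whole precision matrix. -/
theorem blk_inv_of_window {n d q : ℕ} (r : ℝ → ℝ → Matrix (Fin q) (Fin q) ℝ) (t : Fin n → ℝ)
    (w : Fin d → Fin n) (hw : Function.Injective w) (hR : IsUnit (blockCov r t).det)
    (hS : IsUnit (blockCov r (t ∘ w)).det) (a : Fin d)
    (h : ∀ l, l ∉ Set.range w → ∃ b, b ≠ a ∧ ∃ Ψ : Matrix (Fin q) (Fin q) ℝ,
      ∀ x, r (t (w x)) (t l) = r (t (w x)) (t (w b)) * Ψ) :
    (∀ y, blk (blockCov r t)⁻¹ (w a) (w y) = blk (blockCov r (t ∘ w))⁻¹ a y) ∧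
      ∀ l, l ∉ Set.range w → blk (blockCov r t)⁻¹ (w a) l = 0 := by
  set R := blockCov r t with hRdef
  set S := blockCov r (t ∘ w) with hSdef
  have hSS : S⁻¹ * S = 1 := Matrix.nonsing_inv_mul _ hS
  have hSinv : ∀ i (y : Fin d) (j : Fin q), ∑ z : Fin d × Fin q,
      S⁻¹ (a, i) z * r (t (w z.1)) (t (w y)) z.2 j = if (a, i) = (y, j) then 1 else 0 := by
    intro i y j
    have := congrFun (congrFun hSS (a, i)) (y, j)
    rwa [Matrix.mul_apply, Matrix.one_apply] at this
  -- The row `a` of the inverse of the window, extended by zero to all locations. It remains to see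
  -- that its product with the full covariance is a row of the identity.
  set X : Matrix (Fin q) (Fin n × Fin q) ℝ :=
    Matrix.of fun i x => ∑ y, if w y = x.1 then S⁻¹ (a, i) (y, x.2) else 0 with hX
  have hXR : X * R = Matrix.of fun i x => (1 : Matrix (Fin n × Fin q) (Fin n × Fin q) ℝ) (w a, i) x := by
    ext i ⟨l, j⟩
    rw [Matrix.mul_apply]
    simp only [hX, Matrix.of_apply]
    rw [blockCov_row_mul r t w (fun z => S⁻¹ (a, i) z) l j, Matrix.one_apply]
    by_cases hl : l ∈ Set.range w
    · obtain ⟨y, rfl⟩ := hl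
      rw [hSinv]
      simp only [Prod.mk.injEq, hw.eq_iff]
    -- Outside the window the product is the `(a, b)` block of `S⁻¹ * S` times `Ψ`, which vanishes
    -- since `b ≠ a`.
    · obtain ⟨b, hb, Ψ, hΨ⟩ := h l hl
      simp_rw [hΨ, Matrix.mul_apply, Finset.mul_sum]
      rw [Finset.sum_comm, if_neg (fun h => hl ⟨a, (Prod.mk.inj h).1⟩)]
      refine Finset.sum_eq_zero fun k _ => ?_
      have h1 := hSinv i b k
      rw [if_neg (fun h => hb (Prod.mk.inj h).1.symm)] at h1
      simp_rw [← mul_assoc]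
      rw [← Finset.sum_mul, h1, zero_mul]
  have hXeq : X = Matrix.of fun i x => R⁻¹ (w a, i) x := by
    have h1 : X = X * R * R⁻¹ := by rw [Matrix.mul_assoc, Matrix.mul_nonsing_inv _ hR, Matrix.mul_one]
    rw [h1, hXR]
    ext i x
    rw [Matrix.mul_apply]
    simp only [Matrix.of_apply, Matrix.one_apply, ite_mul, one_mul, zero_mul,
      Finset.sum_ite_eq, Finset.mem_univ, if_true]
  refine ⟨fun y => ?_, fun l hl => ?_⟩
  · ext i j
    have h1 := congrFun (congrFun hXeq i) (w y, j)
    simp only [hX, Matrix.of_apply] at h1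
    simp only [blk, Matrix.of_apply]
    rw [← h1, Finset.sum_eq_single y]
    · rw [if_pos rfl]
    · intro z _ hz
      rw [if_neg (fun h => hz (hw h))]
    · simp
  · ext i j
    have h1 := congrFun (congrFun hXeq i) (l, j)
    simp only [hX, Matrix.of_apply] at h1
    simp only [blk, Matrix.of_apply, Matrix.zero_apply]
    rw [← h1]
    exact Finset.sum_eq_zero fun y _ => if_neg fun h => hl ⟨y, h⟩

/-- A symmetric, positive definite matrix-valued covariance function with the Markov property. -/
structure IsMarkovCov {q : ℕ} (r : ℝ → ℝ → Matrix (Fin q) (Fin q) ℝ) : Prop where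
  posDef : ∀ (n : ℕ) (t : Fin n → ℝ), Function.Injective t → (blockCov r t).PosDef
  markov : ∀ t s x, t ≤ s → s ≤ x → r x t = r x s * ((r s s)⁻¹ * r s t)

namespace IsMarkovCov

variable {q : ℕ} {r : ℝ → ℝ → Matrix (Fin q) (Fin q) ℝ} (hr : IsMarkovCov r)
include hr

theorem isUnit_det {n : ℕ} {t : Fin n → ℝ} (ht : Function.Injective t) :
    IsUnit (blockCov r t).det :=
  (Matrix.isUnit_iff_isUnit_det _).1 (hr.posDef n t ht).isUnit

theorem transpose (s t : ℝ) : (r s t).transpose = r t s := by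
  rcases eq_or_ne s t with rfl | hne
  · have h := (hr.posDef 1 (fun _ => s) (fun _ _ _ => Subsingleton.elim _ _)).isHermitian
    ext i j
    exact congrFun (congrFun h (0, i)) (0, j)
  · have hinj : Function.Injective ![t, s] := by
      intro i j hij
      fin_cases i <;> fin_cases j <;> simp_all
    have h := (hr.posDef 2 ![t, s] hinj).isHermitian
    ext i j
    exact congrFun (congrFun h (0, i)) (1, j)

theorem markov_left (x s l : ℝ) (hxs : x ≤ s) (hsl : s ≤ l) :
    r x l = r x s * ((r s s)⁻¹ * r s l) := by
  have h := congrArg Matrix.transpose (hr.markov x s l hxs hsl)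
  rw [Matrix.transpose_mul, Matrix.transpose_mul, hr.transpose, hr.transpose, hr.transpose,
    Matrix.transpose_nonsing_inv, hr.transpose] at h
  rw [h, Matrix.mul_assoc]

theorem blk_inv_transpose {n : ℕ} {t : Fin n → ℝ} (ht : Function.Injective t) (j l : Fin n) :
    blk (blockCov r t)⁻¹ j l = (blk (blockCov r t)⁻¹ l j).transpose := by
  have h := (hr.posDef n t ht).inv.isHermitian
  ext x y
  exact (congrFun (congrFun h (j, x)) (l, y)).symm

/-- Each location outside the window must lie beyond an extreme window location `b` other than `a`.
The Markov property at `b`, forward or backward, then supplies the factor `Ψ`. -/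
theorem blk_inv_window {n d : ℕ} {t : Fin n → ℝ} (ht : StrictMono t) (w : Fin d → Fin n)
    (hw : Function.Injective w) (a : Fin d)
    (h : ∀ l, l ∉ Set.range w → (∃ b, b ≠ a ∧ l ≤ w b ∧ ∀ x, w b ≤ w x) ∨
      (∃ b, b ≠ a ∧ w b ≤ l ∧ ∀ x, w x ≤ w b)) :
    (∀ y, blk (blockCov r t)⁻¹ (w a) (w y) = blk (blockCov r (t ∘ w))⁻¹ a y) ∧
      ∀ l, l ∉ Set.range w → blk (blockCov r t)⁻¹ (w a) l = 0 := by
  refine blk_inv_of_window r t w hw (hr.isUnit_det ht.injective)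
    (hr.isUnit_det (ht.injective.comp hw)) a fun l hl => ?_
  rcases h l hl with ⟨b, hb, h1, h2⟩ | ⟨b, hb, h1, h2⟩
  · exact ⟨b, hb, _, fun x => hr.markov _ _ _ (ht.monotone h1) (ht.monotone (h2 x))⟩
  · exact ⟨b, hb, _, fun x => hr.markov_left _ _ _ (ht.monotone (h2 x)) (ht.monotone h1)⟩

/-- The row `j` is computed from the window of `j` and its neighbours, so its blocks outside that
window vanish; the first location needs only its right neighbour. The lower half follows by
symmetry. -/
theorem isBlockTridiagonal_inv {n : ℕ} {t : Fin n → ℝ} (ht : StrictMono t) :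
    IsBlockTridiagonal (blockCov r t)⁻¹ := by
  have main : ∀ j l : Fin n, (j : ℕ) + 1 < l → blk (blockCov r t)⁻¹ j l = 0 := by
    intro j l hjl
    have hl := l.2
    rcases Nat.eq_zero_or_pos (j : ℕ) with hj | hj
    · have h1 : (j : ℕ) + 1 < n := by omega
      refine (hr.blk_inv_window ht ![j, ⟨j + 1, h1⟩] ?_ 0 ?_).2 l ?_
      · intro x y hxy
        fin_cases x <;> fin_cases y <;> simp_all [Fin.ext_iff]
      · intro k hk
        right
        refine ⟨1, by decide, ?_, ?_⟩
        · simp only [Matrix.range_cons, Matrix.range_empty, Set.union_empty, Set.mem_union,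
            Set.mem_singleton_iff, not_or, Fin.ext_iff] at hk
          simp only [Matrix.cons_val_one, Matrix.cons_val_fin_one, Fin.le_def]
          omega
        · intro x
          fin_cases x <;> apply Fin.le_def.2 <;> dsimp <;> omega
      · simp only [Matrix.range_cons, Matrix.range_empty, Set.union_empty, Set.mem_union,
          Set.mem_singleton_iff, not_or, Fin.ext_iff]
        omega
    · have h1 : (j : ℕ) + 1 < n := by omega
      have h0 : (j : ℕ) - 1 < n := by omega
      refine (hr.blk_inv_window ht ![⟨j - 1, h0⟩, j, ⟨j + 1, h1⟩] ?_ 1 ?_).2 l ?_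
      · refine StrictMono.injective (Fin.strictMono_iff_lt_succ.2 fun x => ?_)
        fin_cases x <;> apply Fin.lt_def.2 <;> dsimp <;> omega
      · intro k hk
        simp only [Matrix.range_cons, Matrix.range_empty, Set.union_empty, Set.mem_union,
            Set.mem_singleton_iff, not_or, Fin.ext_iff] at hk
        rcases lt_or_ge (k : ℕ) j with hkj | hkj
        · left
          refine ⟨0, by decide, ?_, ?_⟩
          · simp only [Matrix.cons_val_zero, Fin.le_def]
            omega
          · intro x
            fin_cases x <;> apply Fin.le_def.2 <;> dsimp <;> omega
        · right
          refine ⟨2, by decide, ?_, ?_⟩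
          · simp only [Matrix.cons_val, Fin.le_def]
            omega
          · intro x
            fin_cases x <;> apply Fin.le_def.2 <;> dsimp <;> omega
      · simp only [Matrix.range_cons, Matrix.range_empty, Set.union_empty, Set.mem_union,
          Set.mem_singleton_iff, not_or, Fin.ext_iff]
        omega
  rintro j l (h | h)
  · exact main j l h
  · rw [hr.blk_inv_transpose ht.injective, main l j h, Matrix.transpose_zero]

theorem first_blocks {n : ℕ} {t : Fin n → ℝ} (ht : StrictMono t) (j₁ j₂ : Fin n)
    (h₁ : (j₁ : ℕ) = 0) (h₂ : (j₂ : ℕ) = 1) :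
    let Q := (blockCov r t)⁻¹
    let S := blockCov r ![t j₁, t j₂]
    IsUnit S.det ∧ blk Q j₁ j₁ = blk S⁻¹ 0 0 ∧ blk Q j₁ j₂ = blk S⁻¹ 0 1 ∧
      blk Q j₂ j₁ = blk S⁻¹ 1 0 ∧ (n = 2 → blk Q j₂ j₂ = blk S⁻¹ 1 1) := by
  intro Q S
  have hinj : Function.Injective ![j₁, j₂] := by
    intro x y hxy
    fin_cases x <;> fin_cases y <;> simp_all [Fin.ext_iff]
  have hcomp : ![t j₁, t j₂] = t ∘ ![j₁, j₂] := by
    ext x; fin_cases x <;> rfl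
  have hinj' : Function.Injective ![t j₁, t j₂] := hcomp ▸ ht.injective.comp hinj
  have hrow := (hr.blk_inv_window ht ![j₁, j₂] hinj 0 (fun k hk => by
    right
    refine ⟨1, by decide, ?_, ?_⟩
    · simp only [Matrix.range_cons, Matrix.range_empty, Set.union_empty, Set.mem_union,
        Set.mem_singleton_iff, not_or, Fin.ext_iff] at hk
      simp only [Matrix.cons_val_one, Matrix.cons_val_fin_one, Fin.le_def]
      omega
    · intro x
      fin_cases x <;> apply Fin.le_def.2 <;> dsimp <;> omega)).1
  rw [← hcomp] at hrow
  have e01 : blk Q j₁ j₂ = blk S⁻¹ 0 1 := hrow 1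
  refine ⟨hr.isUnit_det hinj', hrow 0, e01, ?_, fun hn => ?_⟩
  · rw [hr.blk_inv_transpose ht.injective, hr.blk_inv_transpose hinj' 1 0]
    exact congrArg _ e01
  -- For `n = 2` the window contains every location, so the condition on outside locations is empty
  -- and the second row agrees as well.
  · have hrow' := (hr.blk_inv_window ht ![j₁, j₂] hinj 1 (fun k hk => by
      exfalso
      simp only [Matrix.range_cons, Matrix.range_empty, Set.union_empty, Set.mem_union,
        Set.mem_singleton_iff, not_or, Fin.ext_iff] at hk
      have := k.2
      omega)).1 1
    rw [← hcomp] at hrow'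
    exact hrow'

/-- The middle row of the window is a row of the full precision matrix, and the zero corners are
tridiagonality of the window's own inverse. The last row is also exact when `j₂` is the final
location, since all outside locations then lie to the left. -/
theorem subsequent_blocks {n : ℕ} {t : Fin n → ℝ} (ht : StrictMono t) (j₀ j₁ j₂ : Fin n)
    (h₁ : (j₁ : ℕ) = j₀ + 1) (h₂ : (j₂ : ℕ) = j₁ + 1) :
    let Q := (blockCov r t)⁻¹
    let S := blockCov r ![t j₀, t j₁, t j₂]
    IsUnit S.det ∧ blk S⁻¹ 0 2 = 0 ∧ blk S⁻¹ 2 0 = 0 ∧ blk Q j₁ j₁ = blk S⁻¹ 1 1 ∧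
      blk Q j₁ j₂ = blk S⁻¹ 1 2 ∧ blk Q j₂ j₁ = blk S⁻¹ 2 1 ∧
      ((j₂ : ℕ) + 1 = n → blk Q j₂ j₂ = blk S⁻¹ 2 2) := by
  intro Q S
  have hmono : StrictMono ![j₀, j₁, j₂] := by
    refine Fin.strictMono_iff_lt_succ.2 fun x => ?_
    fin_cases x <;> apply Fin.lt_def.2 <;> dsimp <;> omega
  have hcomp : ![t j₀, t j₁, t j₂] = t ∘ ![j₀, j₁, j₂] := by
    ext x; fin_cases x <;> rfl
  have hmono' : StrictMono ![t j₀, t j₁, t j₂] := hcomp ▸ ht.comp hmono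
  have hlow : ∀ k : Fin n, (k : ℕ) ≤ j₀ → k ≤ ![j₀, j₁, j₂] 0 ∧ ∀ x, ![j₀, j₁, j₂] 0 ≤ ![j₀, j₁, j₂] x :=
    fun k hk => ⟨hk, fun x => hmono.monotone (Fin.zero_le x)⟩
  have hhigh : ∀ k : Fin n, (j₂ : ℕ) ≤ k → ![j₀, j₁, j₂] 2 ≤ k ∧ ∀ x, ![j₀, j₁, j₂] x ≤ ![j₀, j₁, j₂] 2 :=
    fun k hk => ⟨hk, fun x => hmono.monotone (Fin.le_last x)⟩
  have hrange : ∀ k : Fin n, k ∉ Set.range ![j₀, j₁, j₂] → (k : ℕ) ≤ j₀ ∨ (j₂ : ℕ) ≤ k := by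
    intro k hk
    simp only [Matrix.range_cons, Matrix.range_empty, Set.union_empty, Set.mem_union,
        Set.mem_singleton_iff, not_or, Fin.ext_iff] at hk
    omega
  have htri := hr.isBlockTridiagonal_inv hmono'
  have hrow := (hr.blk_inv_window ht ![j₀, j₁, j₂] hmono.injective 1 (fun k hk => by
    rcases hrange k hk with h | h
    · exact Or.inl ⟨0, by decide, hlow k h⟩
    · exact Or.inr ⟨2, by decide, hhigh k h⟩)).1
  rw [← hcomp] at hrow
  have e12 : blk Q j₁ j₂ = blk S⁻¹ 1 2 := hrow 2
  refine ⟨hr.isUnit_det hmono'.injective, htri 0 2 (Or.inl (by decide)),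
    htri 2 0 (Or.inr (by decide)), hrow 1, e12, ?_, fun hn => ?_⟩
  · rw [hr.blk_inv_transpose ht.injective, hr.blk_inv_transpose hmono'.injective 2 1]
    exact congrArg _ e12
  · have hrow' := (hr.blk_inv_window ht ![j₀, j₁, j₂] hmono.injective 2 (fun k hk => by
      rcases hrange k hk with h | h
      · exact Or.inl ⟨0, by decide, hlow k h⟩
      · exfalso
        have hk2 := k.2
        have : k = j₂ := Fin.ext (by omega)
        exact hk ⟨2, this.symm⟩)).1 2
    rw [← hcomp] at hrow'
    exact hrow'

end IsMarkovCov

/-! ### Curves in Hilbert spaces with a stationary covariance -/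

theorem uniqueDiffOn_of_ordConnected {I : Set ℝ} (hI : I.OrdConnected) (hI' : I.Nontrivial) :
    UniqueDiffOn ℝ I := by
  obtain ⟨a, ha, b, hb, hab⟩ := hI'.exists_lt
  refine uniqueDiffOn_convex hI.convex ?_
  have h1 : Set.Ioo a b ⊆ interior I :=
    interior_maximal (Set.Ioo_subset_Icc_self.trans (hI.out ha hb)) isOpen_Ioo
  exact (Set.nonempty_Ioo.2 hab).mono h1

theorem neBot_of_uniqueDiff {I : Set ℝ} (hI : UniqueDiffOn ℝ I) {t : ℝ} (ht : t ∈ I) :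
    (𝓝[I \ {t}] t).NeBot :=
  accPt_principal_iff_nhdsWithin.1 (uniqueDiffWithinAt_iff_accPt.1 (hI t ht))

/-- The mean value inequality is applied twice: to `K'` minus its linear part over a step `y`, and
then to the resulting difference over a step `x`. -/
theorem second_difference_bound (K K' K'' : ℝ → ℝ) (hK : ∀ h, HasDerivAt K (K' h) h)
    (hK' : ∀ h, HasDerivAt K' (K'' h) h) (δ ε : ℝ)
    (hδ : ∀ η, |η| < 2 * δ → |K'' η - K'' 0| ≤ ε) (x y : ℝ) (hx : |x| < δ) (hy : |y| < δ) :
    |K (x - y) - K x - K (-y) + K 0 + x * y * K'' 0| ≤ ε * |y| * |x| := by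
  have hconv : ∀ r : ℝ, Convex ℝ (Metric.ball (0 : ℝ) r) := fun r => convex_ball _ _
  have hψ : ∀ ξ, |ξ| < δ → |(K' (ξ - y) - (ξ - y) * K'' 0) - (K' ξ - ξ * K'' 0)| ≤ ε * |y| := by
    intro ξ hξ
    have h1 := (hconv (2 * δ)).norm_image_sub_le_of_norm_hasDerivWithin_le
      (f := fun η => K' η - η * K'' 0) (f' := fun η => K'' η - K'' 0) (C := ε) (x := ξ) (y := ξ - y)
      (fun η _ => ((hK' η).sub (by simpa using (hasDerivAt_id η).mul_const (K'' 0))).hasDerivWithinAt)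
      (fun η hη => by
        rw [Real.norm_eq_abs]
        exact hδ η (by simpa using hη))
      (by rw [mem_ball_zero_iff, Real.norm_eq_abs]; linarith [abs_nonneg ξ])
      (by
        rw [mem_ball_zero_iff, Real.norm_eq_abs]
        exact (abs_sub _ _).trans_lt (by linarith))
    simpa using h1
  have h2 := (hconv δ).norm_image_sub_le_of_norm_hasDerivWithin_le
    (f := fun ξ => K (ξ - y) - K ξ + ξ * y * K'' 0)
    (f' := fun ξ => (K' (ξ - y) - (ξ - y) * K'' 0) - (K' ξ - ξ * K'' 0)) (C := ε * |y|)
    (x := 0) (y := x)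
    (fun ξ _ => by
      have h3 : HasDerivAt (fun ξ => K (ξ - y)) (K' (ξ - y)) ξ := (hK (ξ - y)).comp_sub_const ξ y
      have h4 : HasDerivAt (fun ξ : ℝ => ξ * y * K'' 0) (y * K'' 0) ξ := by
        simpa using ((hasDerivAt_id ξ).mul_const y).mul_const (K'' 0)
      exact (((h3.sub (hK ξ)).add h4).congr_deriv (by ring)).hasDerivWithinAt)
    (fun ξ hξ => by
      rw [Real.norm_eq_abs]
      exact hψ ξ (by simpa using hξ))
    (by
      rw [mem_ball_zero_iff, norm_zero]
      exact lt_of_le_of_lt (abs_nonneg x) hx)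
    (by rwa [mem_ball_zero_iff, Real.norm_eq_abs])
  simp only [Real.norm_eq_abs, sub_zero, zero_sub, zero_mul, add_zero] at h2
  convert h2 using 2
  ring

section Hilbert

variable {H : Type*} [NormedAddCommGroup H] [InnerProductSpace ℝ H]

/-- The inner product of two difference quotients is a divided second difference of `K`, which tends
to `-K'' 0`. The squared distance of two quotients therefore tends to `0`, and completeness gives
the limit. -/
theorem exists_hasDerivWithinAt_of_inner [CompleteSpace H] {I : Set ℝ} (hI : UniqueDiffOn ℝ I)
    (W : ℝ → H) (K K' K'' : ℝ → ℝ) (hK : ∀ h, HasDerivAt K (K' h) h)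
    (hK' : ∀ h, HasDerivAt K' (K'' h) h) (hK'' : Continuous K'')
    (hW : ∀ s ∈ I, ∀ t ∈ I, inner ℝ (W s) (W t) = K (s - t)) (t : ℝ) (ht : t ∈ I) :
    ∃ v, HasDerivWithinAt W v I t := by
  have hne := neBot_of_uniqueDiff hI ht
  simp_rw [hasDerivWithinAt_iff_tendsto_slope]
  rw [← cauchy_map_iff_exists_tendsto, Metric.cauchy_iff]
  refine ⟨hne.map _, fun ε hε => ?_⟩
  obtain ⟨δ, hδ, hδ'⟩ := Metric.continuousAt_iff.1 (hK''.continuousAt (x := 0)) (ε ^ 2 / 8)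
    (by positivity)
  have hbound : ∀ η, |η| < 2 * (δ / 2) → |K'' η - K'' 0| ≤ ε ^ 2 / 8 := by
    intro η hη
    have := hδ' (x := η) (by rw [Real.dist_eq, sub_zero]; linarith)
    rw [Real.dist_eq] at this
    exact this.le
  have hinner : ∀ s ∈ I, ∀ r ∈ I, s ≠ t → r ≠ t → |s - t| < δ / 2 → |r - t| < δ / 2 →
      |inner ℝ (slope W t s) (slope W t r) + K'' 0| ≤ ε ^ 2 / 8 := by
    intro s hs r hr hst hrt hsd hrd
    have hs0 : s - t ≠ 0 := sub_ne_zero.2 hst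
    have hr0 : r - t ≠ 0 := sub_ne_zero.2 hrt
    have hb := second_difference_bound K K' K'' hK hK' (δ / 2) _ hbound (s - t) (r - t) hsd hrd
    have heq : inner ℝ (slope W t s) (slope W t r) + K'' 0
        = (K (s - t - (r - t)) - K (s - t) - K (-(r - t)) + K 0 + (s - t) * (r - t) * K'' 0)
          / ((r - t) * (s - t)) := by
      rw [slope_def_module, slope_def_module, real_inner_smul_left, real_inner_smul_right,
        inner_sub_left, inner_sub_right, inner_sub_right, hW s hs r hr, hW s hs t ht, hW t ht r hr,
        hW t ht t ht, show s - t - (r - t) = s - r by ring, show -(r - t) = t - r by ring, sub_self]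
      field_simp
      ring
    rw [heq, abs_div, div_le_iff₀ (abs_pos.2 (mul_ne_zero hr0 hs0)), abs_mul]
    linarith
  refine ⟨slope W t '' ((I \ {t}) ∩ Metric.ball t (δ / 2)), image_mem_map
    (inter_mem_nhdsWithin _ (Metric.ball_mem_nhds _ (by positivity))), ?_⟩
  rintro _ ⟨s, ⟨⟨hs, hst⟩, hsd⟩, rfl⟩ _ ⟨r, ⟨⟨hr, hrt⟩, hrd⟩, rfl⟩
  rw [Metric.mem_ball, Real.dist_eq] at hsd hrd
  have h1 := abs_le.1 (hinner s hs s hs hst hst hsd hsd)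
  have h2 := abs_le.1 (hinner s hs r hr hst hrt hsd hrd)
  have h3 := abs_le.1 (hinner r hr r hr hrt hrt hrd hrd)
  rw [dist_eq_norm]
  have h4 := norm_sub_sq_real (slope W t s) (slope W t r)
  rw [real_inner_self_eq_norm_sq] at h1 h3
  refine lt_of_pow_lt_pow_left₀ 2 hε.le ?_
  nlinarith [h1.1, h1.2, h2.1, h2.2, h3.1, h3.2, sq_pos_of_pos hε]

/-- The covariances of the derivatives of a curve with a stationary covariance. -/
theorem inner_derivatives {I : Set ℝ} (hI : UniqueDiffOn ℝ I) (M : ℕ) (y : ℕ → ℝ → ℝ)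
    (hy : ∀ j, j < 2 * M → ∀ h, HasDerivAt (y j) (y (j + 1) h) h) (N : ℕ) (hN : N ≤ M)
    (U : ℕ → ℝ → H) (hU0 : ∀ s ∈ I, ∀ t ∈ I, inner ℝ (U 0 s) (U 0 t) = y 0 (s - t))
    (hU : ∀ k < N, ∀ t ∈ I, HasDerivWithinAt (U k) (U (k + 1) t) I t) (k l : ℕ) (hk : k ≤ N)
    (hl : l ≤ N) (s t : ℝ) (hs : s ∈ I) (ht : t ∈ I) :
    inner ℝ (U k s) (U l t) = (-1) ^ l * y (k + l) (s - t) := by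
  have h1 : ∀ k, k ≤ N → ∀ s ∈ I, ∀ t ∈ I, inner ℝ (U k s) (U 0 t) = y k (s - t) := by
    intro k
    induction k with
    | zero => exact fun _ => hU0
    | succ k ih =>
      intro hk s hs t ht
      have ha : HasDerivWithinAt (fun s => inner ℝ (U k s) (U 0 t)) (inner ℝ (U (k + 1) s) (U 0 t))
          I s := by
        simpa using (hU k (by omega) s hs).inner ℝ (hasDerivWithinAt_const s I (U 0 t))
      have hb : HasDerivWithinAt (fun s => inner ℝ (U k s) (U 0 t)) (y (k + 1) (s - t)) I s :=
        ((hy k (by omega) (s - t)).comp_sub_const s t).hasDerivWithinAt.congr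
          (fun x hx => ih (by omega) x hx t ht) (ih (by omega) s hs t ht)
      exact (hI s hs).eq_deriv I ha hb
  induction l generalizing t with
  | zero => rw [h1 k hk s hs t ht]; simp
  | succ l ih =>
    have ha : HasDerivWithinAt (fun t => inner ℝ (U k s) (U l t)) (inner ℝ (U k s) (U (l + 1) t))
        I t := by
      simpa using (hasDerivWithinAt_const t I (U k s)).inner ℝ (hU l (by omega) t ht)
    have hc : HasDerivAt (fun t => y (k + l) (s - t)) (y (k + l + 1) (s - t) * (-1)) t :=
      (hy (k + l) (by omega) (s - t)).comp t ((hasDerivAt_id t).const_sub s)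
    have hb : HasDerivWithinAt (fun t => inner ℝ (U k s) (U l t))
        ((-1) ^ l * (y (k + l + 1) (s - t) * (-1))) I t :=
      (hc.const_mul _).hasDerivWithinAt.congr
        (fun x hx => ih (by omega) x hx) (ih (by omega) t ht)
    rw [(hI t ht).eq_deriv I ha hb, pow_succ, ← add_assoc]
    ring

/-- The derivative of order `N` is again stationary, with covariance `(-1) ^ N * y (2 * N)`, so the
existence criterion applies to it as long as two further derivatives of the covariance are
available. -/
theorem exists_derivatives [CompleteSpace H] {I : Set ℝ} (hI : UniqueDiffOn ℝ I) (M : ℕ)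
    (y : ℕ → ℝ → ℝ) (hy : ∀ j, j < 2 * M → ∀ h, HasDerivAt (y j) (y (j + 1) h) h)
    (hc : ∀ j, 0 < j → j ≤ 2 * M → Continuous (y j)) (W : ℝ → H)
    (hW : ∀ s ∈ I, ∀ t ∈ I, inner ℝ (W s) (W t) = y 0 (s - t)) (N : ℕ) (hN : N ≤ M) :
    ∃ U : ℕ → ℝ → H, U 0 = W ∧ ∀ k < N, ∀ t ∈ I, HasDerivWithinAt (U k) (U (k + 1) t) I t := by
  classical
  induction N with
  | zero => exact ⟨fun _ => W, rfl, fun k hk => absurd hk (by omega)⟩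
  | succ N ih =>
    obtain ⟨U, hU0, hU⟩ := ih (by omega)
    have hinner := inner_derivatives hI M y hy N (by omega) U (by rwa [hU0]) hU
    have hex : ∀ t, ∃ v, t ∈ I → HasDerivWithinAt (U N) v I t := by
      intro t
      by_cases ht : t ∈ I
      · obtain ⟨v, hv⟩ := exists_hasDerivWithinAt_of_inner hI (U N)
          (fun h => (-1) ^ N * y (N + N) h) (fun h => (-1) ^ N * y (N + N + 1) h)
          (fun h => (-1) ^ N * y (N + N + 2) h)
          (fun h => (hy (N + N) (by omega) h).const_mul _)
          (fun h => (hy (N + N + 1) (by omega) h).const_mul _)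
          (continuous_const.mul (hc _ (by omega) (by omega)))
          (fun s hs t ht => hinner N N le_rfl le_rfl s t hs ht) t ht
        exact ⟨v, fun _ => hv⟩
      · exact ⟨0, fun h => absurd h ht⟩
    choose V hV using hex
    refine ⟨Function.update U (N + 1) V, by rw [Function.update_of_ne (by omega), hU0], ?_⟩
    intro k hk t ht
    rw [Function.update_of_ne (by omega)]
    rcases Nat.lt_succ_iff_lt_or_eq.1 hk with h | h
    · rw [Function.update_of_ne (by omega)]
      exact hU k h t ht
    · subst h
      rw [Function.update_self]
      exact hV t ht

theorem derivative_mem_of_isClosed {I : Set ℝ} (hI : UniqueDiffOn ℝ I) (N : ℕ) (U : ℕ → ℝ → H)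
    (hU : ∀ k < N, ∀ t ∈ I, HasDerivWithinAt (U k) (U (k + 1) t) I t) (S : Submodule ℝ H)
    (hS : IsClosed (S : Set H)) (h0 : ∀ t ∈ I, U 0 t ∈ S) (k : ℕ) (hk : k ≤ N) :
    ∀ t ∈ I, U k t ∈ S := by
  induction k with
  | zero => exact h0
  | succ k ih =>
    intro t ht
    have hne := neBot_of_uniqueDiff hI ht
    have h1 := hasDerivWithinAt_iff_tendsto_slope.1 (hU k (by omega) t ht)
    refine hS.mem_of_tendsto h1 ?_
    filter_upwards [self_mem_nhdsWithin] with s hs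
    rw [slope_def_module]
    exact S.smul_mem _ (S.sub_mem (ih (by omega) s hs.1) (ih (by omega) t ht))

end Hilbert

/-! ### Gaussian subspaces of `L²` -/

section

variable {Ω : Type*} [MeasurableSpace Ω] {P : Measure Ω} [IsProbabilityMeasure P]

theorem integral_abs_le_norm (Z : Lp ℝ 2 P) : ∫ ω, |Z ω| ∂P ≤ ‖Z‖ := by
  have h1 : ∫ ω, |Z ω| ∂P = (eLpNorm Z 1 P).toReal := by
    rw [eLpNorm_one_eq_lintegral_enorm, ← integral_norm_eq_lintegral_enorm
      (Lp.aestronglyMeasurable Z)]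
    rfl
  rw [h1, Lp.norm_def]
  exact ENNReal.toReal_mono (Lp.eLpNorm_ne_top Z)
    (eLpNorm_le_eLpNorm_of_exponent_le (by norm_num) (Lp.aestronglyMeasurable Z))

theorem norm_exp_I_mul_sub_le (a b : ℝ) :
    ‖Complex.exp (a * Complex.I) - Complex.exp (b * Complex.I)‖ ≤ |a - b| := by
  have h1 : Complex.exp (a * Complex.I) - Complex.exp (b * Complex.I)
      = Complex.exp (b * Complex.I) * (Complex.exp (Complex.I * ((a - b : ℝ) : ℂ)) - 1) := by
    rw [mul_sub, mul_one, ← Complex.exp_add]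
    congr 2; push_cast; ring
  rw [h1, norm_mul, Complex.norm_exp_ofReal_mul_I, one_mul, ← Real.norm_eq_abs]
  exact Real.norm_exp_I_mul_ofReal_sub_one_le

theorem integrable_exp_I_mul (θ : ℝ) (X : Lp ℝ 2 P) :
    Integrable (fun ω => Complex.exp (((θ * X ω : ℝ) : ℂ) * Complex.I)) P := by
  have hm : AEStronglyMeasurable (fun ω => Complex.exp (((θ * X ω : ℝ) : ℂ) * Complex.I)) P := by
    have h1 : Continuous fun x : ℝ => Complex.exp (((θ * x : ℝ) : ℂ) * Complex.I) := by fun_prop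
    exact h1.comp_aestronglyMeasurable (Lp.aestronglyMeasurable X)
  exact Integrable.of_bound hm 1 (ae_of_all _ fun ω => by rw [Complex.norm_exp_ofReal_mul_I])

/-- Lipschitz in the `L²` norm, through `L¹`. It makes being centered Gaussian a closed condition in
`L²`. -/
theorem continuous_charFun_Lp (θ : ℝ) :
    Continuous fun X : Lp ℝ 2 P => ∫ ω, Complex.exp (((θ * X ω : ℝ) : ℂ) * Complex.I) ∂P := by
  have hlip : LipschitzWith (Real.nnabs θ)
      fun X : Lp ℝ 2 P => ∫ ω, Complex.exp (((θ * X ω : ℝ) : ℂ) * Complex.I) ∂P := by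
    refine LipschitzWith.of_dist_le_mul fun X Y => ?_
    rw [dist_eq_norm, dist_eq_norm, ← integral_sub (integrable_exp_I_mul θ X)
      (integrable_exp_I_mul θ Y), Real.coe_nnabs]
    have hXY : Integrable (fun ω => |(X - Y : Lp ℝ 2 P) ω|) P :=
      ((Lp.memLp (X - Y)).integrable (by norm_num)).abs
    calc _ ≤ ∫ ω, |θ| * |(X - Y : Lp ℝ 2 P) ω| ∂P := by
          refine norm_integral_le_of_norm_le (hXY.const_mul _) ?_
          filter_upwards [Lp.coeFn_sub X Y] with ω hω
          refine (norm_exp_I_mul_sub_le _ _).trans ?_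
          rw [hω, Pi.sub_apply, ← mul_sub, abs_mul]
      _ = |θ| * ∫ ω, |(X - Y : Lp ℝ 2 P) ω| ∂P := integral_const_mul _ _
      _ ≤ _ := mul_le_mul_of_nonneg_left (integral_abs_le_norm _) (abs_nonneg _)
  exact hlip.continuous

theorem map_eq_gaussianReal_of_charFun (X : Lp ℝ 2 P)
    (h : ∀ θ : ℝ, ∫ ω, Complex.exp (((θ * X ω : ℝ) : ℂ) * Complex.I) ∂P
      = Complex.exp (-((‖X‖ ^ 2 * θ ^ 2 / 2 : ℝ) : ℂ))) :
    P.map X = gaussianReal 0 (‖X‖₊ ^ 2) := by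
  have hX : AEMeasurable X P := (Lp.aestronglyMeasurable X).aemeasurable
  refine Measure.ext_of_charFun ?_
  ext θ
  rw [charFun_apply_real, charFun_gaussianReal, integral_map hX (by fun_prop)]
  have := h θ
  push_cast at this ⊢
  rw [this]
  congr 1
  simp

/-- Elements of the closed span of a centered Gaussian process are centered Gaussian. -/
theorem map_eq_gaussianReal_of_mem_closure {T : Type*} (X : T → Ω → ℝ)
    (hX : IsGaussianProcess X P) (h0 : ∀ t, ∫ ω, X t ω ∂P = 0) (U : T → Lp ℝ 2 P)
    (hU : ∀ t, U t =ᵐ[P] X t) (Z : Lp ℝ 2 P)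
    (hZ : Z ∈ (Submodule.span ℝ (Set.range U)).topologicalClosure) :
    P.map Z = gaussianReal 0 (‖Z‖₊ ^ 2) := by
  refine map_eq_gaussianReal_of_charFun Z fun θ => ?_
  -- Both sides of the characteristic function identity are continuous on `L²`, so it suffices to
  -- verify it for finite linear combinations of the process.
  have hclosed : IsClosed {Z : Lp ℝ 2 P |
      ∫ ω, Complex.exp (((θ * Z ω : ℝ) : ℂ) * Complex.I) ∂P
        = Complex.exp (-((‖Z‖ ^ 2 * θ ^ 2 / 2 : ℝ) : ℂ))} :=
    isClosed_eq (continuous_charFun_Lp θ) (by fun_prop)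
  refine closure_minimal (s := (Submodule.span ℝ (Set.range U) : Set (Lp ℝ 2 P))) ?_ hclosed hZ
  intro Y hY
  obtain ⟨c, rfl⟩ := Finsupp.mem_span_range_iff_exists_finsupp.1 hY
  set Y := c.sum fun i a => a • U i
  have hYae : Y =ᵐ[P] fun ω => ∑ i ∈ c.support, c i • X i ω := by
    have h1 : Y =ᵐ[P] ∑ i ∈ c.support, ⇑(c i • U i) := Lp.coeFn_finsetSum _ _
    have h2 : ∀ i, ⇑(c i • U i) =ᵐ[P] fun ω => c i • X i ω := fun i => by
      filter_upwards [Lp.coeFn_smul (c i) (U i), hU i] with ω h3 h4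
      rw [h3, Pi.smul_apply, h4]
    refine h1.trans ?_
    have h5 : ∀ᵐ ω ∂P, ∀ i ∈ c.support, (⇑(c i • U i) : Ω → ℝ) ω = c i • X i ω :=
      (Finset.eventually_all c.support).2 fun i _ => h2 i
    filter_upwards [h5] with ω hω
    rw [Finset.sum_apply]
    exact Finset.sum_congr rfl hω
  have hG : HasGaussianLaw (fun ω => ∑ i ∈ c.support, c i • X i ω) P :=
    (hX.smul (fun i => c i)).hasGaussianLaw_fun_sum
  have hGY : HasGaussianLaw Y P := hG.congr hYae.symm
  have hmean : ∫ ω, Y ω ∂P = 0 := by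
    rw [integral_congr_ae hYae, integral_finsetSum]
    · refine Finset.sum_eq_zero fun i _ => ?_
      rw [integral_smul, h0, smul_zero]
    · exact fun i _ => (hX.hasGaussianLaw_eval i).integrable.smul (c i)
  have hmem : MemLp Y 2 P := Lp.memLp Y
  have hvar : Var[Y; P] = ‖Y‖ ^ 2 := by
    rw [variance_of_integral_eq_zero hmem.aemeasurable hmean, ← real_inner_self_eq_norm_sq,
      L2.inner_def]
    refine integral_congr_ae (ae_of_all _ fun ω => ?_)
    simp [sq]
  have h6 := hGY.map_eq_gaussianReal
  rw [hmean, hvar] at h6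
  have h7 := congrArg (fun μ => charFun μ θ) h6
  beta_reduce at h7
  rw [charFun_gaussianReal, charFun_apply_real, integral_map hmem.aemeasurable (by fun_prop)] at h7
  simp only [Set.mem_ofPred_eq]
  push_cast at h7 ⊢
  rw [h7]
  congr 1
  rw [Real.coe_toNNReal _ (by positivity)]
  push_cast
  ring

theorem cov_eq_inner (X Y : Ω → ℝ) (hX : MemLp X 2 P) (hY : MemLp Y 2 P) (U V : Lp ℝ 2 P)
    (hU : U =ᵐ[P] X) (hV : V =ᵐ[P] Y) (h0 : ∫ ω, X ω ∂P = 0) :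
    cov[X, Y; P] = inner ℝ U V := by
  rw [covariance_eq_sub hX hY, h0, zero_mul, sub_zero, L2.inner_def]
  refine integral_congr_ae ?_
  filter_upwards [hU, hV] with ω h1 h2
  simp [h1, h2, mul_comm]

-- The bridge from random variables to `L²` classes: mean-square differentiation is ordinary
-- differentiation of the associated curve.
omit [IsProbabilityMeasure P] in
theorem meanSquareDeriv_iff {I : Set ℝ} (X X' : ℝ → Ω → ℝ) (V V' : ℝ → Lp ℝ 2 P)
    (hV : ∀ t ∈ I, V t =ᵐ[P] X t) (hV' : ∀ t ∈ I, V' t =ᵐ[P] X' t) :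
    IsMeanSquareDerivOn P I X X' ↔ ∀ t ∈ I, HasDerivWithinAt V (V' t) I t := by
  refine forall₂_congr fun t ht => ?_
  have hmem : MemLp (X' t) 2 P := (memLp_congr_ae (hV' t ht)).1 (Lp.memLp (V' t))
  rw [hasDerivWithinAt_iff_tendsto_slope, tendsto_iff_edist_tendsto_0, and_iff_right hmem]
  refine tendsto_congr' ?_
  filter_upwards [self_mem_nhdsWithin] with s hs
  rw [Lp.edist_def]
  refine eLpNorm_congr_ae ?_
  rw [slope_def_module]
  filter_upwards [hV s hs.1, hV t ht, hV' t ht, Lp.coeFn_smul (s - t)⁻¹ (V s - V t),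
    Lp.coeFn_sub (V s) (V t)] with ω h1 h2 h3 h4 h5
  rw [Pi.sub_apply, h4, Pi.smul_apply, h5, Pi.sub_apply, h1, h2, h3, smul_eq_mul, div_eq_inv_mul]

end

/-! ### Mean-square derivatives of a stationary Gaussian process -/

section

variable {Ω : Type*} [MeasurableSpace Ω] {P : Measure Ω} [IsProbabilityMeasure P]

theorem exists_meanSquareDerivSeq {I : Set ℝ} (hI : UniqueDiffOn ℝ I) {u : ℝ → Ω → ℝ} {M : ℕ}
    {y : ℕ → ℝ → ℝ} (hu : IsCenteredGaussianProcessOn P I u (y 0))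
    (hy : ∀ j, j < 2 * M → ∀ h, HasDerivAt (y j) (y (j + 1) h) h)
    (hc : ∀ j, 0 < j → j ≤ 2 * M → Continuous (y j)) :
    ∃ D, IsMeanSquareDerivSeqOn P I u M D := by
  classical
  have hmem : ∀ t ∈ I, MemLp (u t) 2 P := fun t ht =>
    (hu.gaussian.hasGaussianLaw_eval ⟨t, ht⟩).memLp_two
  set W : ℝ → Lp ℝ 2 P := fun t => if h : MemLp (u t) 2 P then h.toLp (u t) else 0 with hWdef
  have hWu : ∀ t ∈ I, W t =ᵐ[P] u t := by
    intro t ht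
    simp only [hWdef, hmem t ht, dite_true]
    exact (hmem t ht).coeFn_toLp
  have hW : ∀ s ∈ I, ∀ t ∈ I, inner ℝ (W s) (W t) = y 0 (s - t) := fun s hs t ht => by
    rw [← cov_eq_inner (u s) (u t) (hmem s hs) (hmem t ht) _ _ (hWu s hs) (hWu t ht)
      (hu.mean_zero s hs), hu.cov_eq s hs t ht]
  obtain ⟨U, hU0, hU⟩ := exists_derivatives hI M y hy hc W hW M le_rfl
  set D : ℕ → ℝ → Ω → ℝ := fun k t => if k = 0 then u t else U k t with hD
  have hDU : ∀ k, ∀ t ∈ I, U k t =ᵐ[P] D k t := by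
    intro k t ht
    rcases eq_or_ne k 0 with rfl | hk
    · simp only [hD, if_true, hU0]; exact hWu t ht
    · simp only [hD, if_neg hk]; rfl
  exact ⟨D, fun t _ => by simp [hD],
    fun k hk => (meanSquareDeriv_iff _ _ _ _ (hDU k) (hDU (k + 1))).2 (hU k hk)⟩

/-- The derivatives are limits of difference quotients, so they remain in the closed span of the
process, all of whose elements are centered Gaussian. Their covariances come from differentiating
the inner product. The family `D` is arbitrary: different versions agree almost surely at each
point. -/
theorem IsMeanSquareDerivSeqOn.gaussian {I : Set ℝ} (hI : UniqueDiffOn ℝ I) {u : ℝ → Ω → ℝ} {M : ℕ}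
    {y : ℕ → ℝ → ℝ} (hu : IsCenteredGaussianProcessOn P I u (y 0))
    (hy : ∀ j, j < 2 * M → ∀ h, HasDerivAt (y j) (y (j + 1) h) h)
    {n : ℕ} {t : Fin n → ℝ} (htI : ∀ j, t j ∈ I) (hpos : (blockCov (derivCov M y) t).PosDef)
    {D : ℕ → ℝ → Ω → ℝ} (hD : IsMeanSquareDerivSeqOn P I u M D) :
    IsCenteredGaussianWithPrecision P (stackedVector M D t) (blockCov (derivCov M y) t)⁻¹ ∧
      covarianceMatrix P (stackedVector M D t) = blockCov (derivCov M y) t := by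
  classical
  have hmem0 : ∀ t ∈ I, MemLp (u t) 2 P := fun t ht =>
    (hu.gaussian.hasGaussianLaw_eval ⟨t, ht⟩).memLp_two
  have hmem : ∀ k, k ≤ M → ∀ t ∈ I, MemLp (D k t) 2 P := by
    intro k hk t ht
    rcases Nat.eq_zero_or_pos k with rfl | h
    · rw [hD.zero t ht]; exact hmem0 t ht
    · obtain ⟨k, rfl⟩ : ∃ k', k = k' + 1 := ⟨k - 1, by omega⟩
      exact (hD.succ k (by omega) t ht).1
  set U : ℕ → ℝ → Lp ℝ 2 P := fun k t => if h : MemLp (D k t) 2 P then h.toLp (D k t) else 0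
    with hUdef
  have hUD : ∀ k, k ≤ M → ∀ t ∈ I, U k t =ᵐ[P] D k t := by
    intro k hk t ht
    simp only [hUdef, hmem k hk t ht, dite_true]
    exact (hmem k hk t ht).coeFn_toLp
  have hUu : ∀ t ∈ I, U 0 t =ᵐ[P] u t := fun t ht => by
    rw [← hD.zero t ht]; exact hUD 0 (Nat.zero_le _) t ht
  have hU : ∀ k < M, ∀ t ∈ I, HasDerivWithinAt (U k) (U (k + 1) t) I t := fun k hk =>
    (meanSquareDeriv_iff _ _ _ _ (hUD k (by omega)) (hUD (k + 1) (by omega))).1 (hD.succ k hk)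
  have hU0 : ∀ s ∈ I, ∀ t ∈ I, inner ℝ (U 0 s) (U 0 t) = y 0 (s - t) := fun s hs t ht => by
    rw [← cov_eq_inner (u s) (u t) (hmem0 s hs) (hmem0 t ht) _ _ (hUu s hs) (hUu t ht)
      (hu.mean_zero s hs), hu.cov_eq s hs t ht]
  have hinner := inner_derivatives hI M y hy M le_rfl U hU0 hU
  -- the closed linear span of the process
  set S := (Submodule.span ℝ (Set.range fun t : I => U 0 t)).topologicalClosure with hS
  have hUS : ∀ k, k ≤ M → ∀ t ∈ I, U k t ∈ S :=
    derivative_mem_of_isClosed hI M U hU S (Submodule.isClosed_topologicalClosure _)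
      (fun t ht => Submodule.le_topologicalClosure _ (Submodule.subset_span ⟨⟨t, ht⟩, rfl⟩))
  have hSG : ∀ Z ∈ S, P.map Z = gaussianReal 0 (‖Z‖₊ ^ 2) := fun Z hZ =>
    map_eq_gaussianReal_of_mem_closure (fun t : I => u t) hu.gaussian
      (fun t => hu.mean_zero t t.2) (fun t : I => U 0 t) (fun t => hUu t t.2) Z hZ
  set X := stackedVector M D t with hX
  set V : Fin n × Fin (M + 1) → Lp ℝ 2 P := fun x => U x.2 (t x.1) with hV
  have hle : ∀ x : Fin n × Fin (M + 1), (x.2 : ℕ) ≤ M := fun x => Nat.lt_succ_iff.1 x.2.2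
  have hVX : ∀ x, V x =ᵐ[P] X x := fun x => hUD _ (hle x) _ (htI _)
  have hXmem : ∀ x, MemLp (X x) 2 P := fun x => hmem _ (hle x) _ (htI _)
  have hVS : ∀ x, V x ∈ S := fun x => hUS _ (hle x) _ (htI _)
  have hmean : ∀ x, ∫ ω, X x ω ∂P = 0 := by
    intro x
    rw [← integral_congr_ae (hVX x)]
    have h1 : ∫ z, z ∂(P.map (V x)) = ∫ ω, V x ω ∂P :=
      integral_map (Lp.memLp (V x)).aemeasurable (by fun_prop)
    rw [← h1, hSG _ (hVS x), integral_id_gaussianReal]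
  have hcov : covarianceMatrix P X = blockCov (derivCov M y) t := by
    ext x x'
    simp only [covarianceMatrix, blockCov, derivCov, Matrix.of_apply]
    rw [cov_eq_inner _ _ (hXmem x) (hXmem x') _ _ (hVX x) (hVX x') (hmean x)]
    exact hinner _ _ (hle x) (hle x') _ _ (htI _) (htI _)
  refine ⟨⟨⟨?_⟩, hmean, hcov ▸ hpos, by rw [hcov]⟩, hcov⟩
  have hXae : AEMeasurable (fun ω x => X x ω) P :=
    aemeasurable_pi_lambda _ fun x => (hXmem x).aemeasurable
  -- Joint normality is tested on linear functionals; each one gives a finite combination `Z` of the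
  -- vectors `V x`, which again lies in the closed span.
  refine isGaussian_of_map_eq_gaussianReal fun L => ?_
  set Z : Lp ℝ 2 P := ∑ x, L (Pi.single x 1) • V x with hZ
  have hZae : Z =ᵐ[P] fun ω => L (fun x => X x ω) := by
    have h1 : Z =ᵐ[P] ∑ x, ⇑(L (Pi.single x 1) • V x) := Lp.coeFn_finsetSum _ _
    have h2 : ∀ᵐ ω ∂P, ∀ x, (L (Pi.single x 1) • V x : Lp ℝ 2 P) ω = L (Pi.single x 1) * X x ω := by
      refine ae_all_iff.2 fun x => ?_
      filter_upwards [Lp.coeFn_smul (L (Pi.single x 1)) (V x), hVX x] with ω h3 h4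
      rw [h3, Pi.smul_apply, h4, smul_eq_mul]
    filter_upwards [h1, h2] with ω h3 h4
    rw [h3, Finset.sum_apply]
    simp_rw [h4]
    have h5 : (fun x => X x ω) = ∑ x, X x ω • (Pi.single x 1 : Fin n × Fin (M + 1) → ℝ) :=
      pi_eq_sum_univ' _
    rw [h5, map_sum]
    refine Finset.sum_congr rfl fun x _ => ?_
    rw [map_smul, smul_eq_mul, mul_comm]
  refine ⟨0, ‖Z‖₊ ^ 2, ?_⟩
  rw [AEMeasurable.map_map_of_aemeasurable (by fun_prop) hXae,
    ← hSG Z (Submodule.sum_mem _ fun x _ => Submodule.smul_mem _ _ (hVS x))]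
  exact (Measure.map_congr hZae).symm

end

/-! ### Covariances with the Markov property -/

theorem isMarkovCov_spectral {lam : ℕ → ℝ} (hlam : ∀ l, 0 < lam l) (M : ℕ) (C : ℝ) (hC : 0 < C) :
    IsMarkovCov (derivCov M fun j h => C * spectralOp lam M (Polynomial.X ^ j) h) := by
  have hpos := fun n t ht => posDef_blockCov_derivCov hlam M n C hC t ht
  refine ⟨hpos, fun t s x hts hsx => ?_⟩
  obtain ⟨a, ha⟩ := exists_hasDerivAt_spectralOp_X_pow hlam M
  refine derivCov_markov M _ a (fun j hj h => ?_) (fun j hj => ?_) (fun h hh => ?_) s t x hts hsx ?_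
  · rw [pow_succ']
    exact (hasDerivAt_spectralOp hlam M _ (by rw [Polynomial.natDegree_X_pow]; omega) h).const_mul C
  · exact continuous_const.mul
      (continuous_spectralOp hlam M _ (by rw [Polynomial.natDegree_X_pow]; omega))
  · refine ((ha h hh).const_mul C).congr_deriv ?_
    rw [mul_neg, Finset.mul_sum]
    congr 1
    exact Finset.sum_congr rfl fun j _ => by ring
  -- The covariance at a single time is the one-location block matrix, hence positive definite and
  -- invertible.
  · have h1 := ((hpos 1 (fun _ => s) (fun _ _ _ => Subsingleton.elim _ _)).submatrix
      (e := fun k => ((0 : Fin 1), k)) (fun k l h => (Prod.mk.inj h).2)).isUnit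
    exact (Matrix.isUnit_iff_isUnit_det _).1 h1

/-- The component `0` for `α < 1`: values at distinct times are uncorrelated, so the covariance is a
multiple of the identity, and the factorization is an identity at `x = s` and `0 = 0` for `x > s`.
-/
theorem isMarkovCov_whiteNoise (y : ℕ → ℝ → ℝ) (c : ℝ) (hc : 0 < c)
    (hy : ∀ h, y 0 h = if h = 0 then c else 0) : IsMarkovCov (derivCov 0 y) := by
  have hr : ∀ s t, derivCov 0 y s t = if s = t then c • (1 : Matrix (Fin (0 + 1)) (Fin (0 + 1)) ℝ) else 0 := by
    intro s t
    ext k l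
    have hk : (k : ℕ) = 0 := by omega
    have hl : (l : ℕ) = 0 := by omega
    have hkl : k = l := Fin.ext (by omega)
    simp only [derivCov, Matrix.of_apply, hk, hl, pow_zero, one_mul, add_zero, hy, sub_eq_zero]
    split_ifs
    · simp [hkl]
    · rfl
  constructor
  · intro n t ht
    have h1 : blockCov (derivCov 0 y) t = c • (1 : Matrix (Fin n × Fin (0 + 1)) (Fin n × Fin (0 + 1)) ℝ) := by
      ext x x'
      simp only [blockCov, Matrix.of_apply, hr, ht.eq_iff]
      by_cases h : x.1 = x'.1
      · have hx : x = x' := Prod.ext h (Fin.ext (by omega))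
        simp [hx]
      · have hx : x ≠ x' := fun hxx => h (by rw [hxx])
        simp [h, hx]
    rw [h1]
    exact Matrix.PosDef.one.smul hc
  · intro t s x hts hsx
    have hinv : (c • (1 : Matrix (Fin (0 + 1)) (Fin (0 + 1)) ℝ)) * (c • (1 : Matrix _ _ ℝ))⁻¹ = 1 := by
      refine Matrix.mul_nonsing_inv _ ?_
      simp [hc.ne']
    rcases eq_or_ne x s with rfl | hxs
    · rw [← Matrix.mul_assoc, hr x x, if_pos rfl, hinv, Matrix.one_mul]
    · have hxt : x ≠ t := fun h => hxs (le_antisymm (h ▸ hts) hsx)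
      rw [hr x t, if_neg hxt, hr x s, if_neg hxs, Matrix.zero_mul]

/-! ### The precision matrix -/

/-- Continuity is required only for `0 < j`, so the discontinuous white noise covariance is admitted
with `N = 0`, where no derivative is taken. -/
theorem precision_of_markov {Ω : Type*} [MeasurableSpace Ω] (P : Measure Ω) [IsProbabilityMeasure P]
    {I : Set ℝ} (hI : I.OrdConnected) (hI' : I.Nontrivial) (u : ℝ → Ω → ℝ) (ρ : ℝ → ℝ)
    (hu : IsCenteredGaussianProcessOn P I u ρ) (N : ℕ) (y : ℕ → ℝ → ℝ) (hρ : ρ = y 0)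
    (hy : ∀ j, j < 2 * N → ∀ h, HasDerivAt (y j) (y (j + 1) h) h)
    (hc : ∀ j, 0 < j → j ≤ 2 * N → Continuous (y j)) (hr : IsMarkovCov (derivCov N y))
    (n : ℕ) (t : Fin n → ℝ) (ht : StrictMono t) (htI : ∀ j, t j ∈ I) :
    (∃ D : ℕ → ℝ → Ω → ℝ, IsMeanSquareDerivSeqOn P I u N D) ∧
    ∃ Q : Matrix (Fin n × Fin (N + 1)) (Fin n × Fin (N + 1)) ℝ,
      let r := multiCov N ρ
      (∀ D : ℕ → ℝ → Ω → ℝ, IsMeanSquareDerivSeqOn P I u N D →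
          IsCenteredGaussianWithPrecision P (stackedVector N D t) Q ∧
            covarianceMatrix P (stackedVector N D t) = blockCov r t) ∧
      IsBlockTridiagonal Q ∧
      (∀ j₁ j₂ : Fin n, (j₁ : ℕ) = 0 → (j₂ : ℕ) = 1 →
        let S := blockCov r ![t j₁, t j₂]
        IsUnit S.det ∧ blk Q j₁ j₁ = blk S⁻¹ 0 0 ∧ blk Q j₁ j₂ = blk S⁻¹ 0 1 ∧
        blk Q j₂ j₁ = blk S⁻¹ 1 0 ∧ (n = 2 → blk Q j₂ j₂ = blk S⁻¹ 1 1)) ∧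
      (∀ j₀ j₁ j₂ : Fin n, (j₁ : ℕ) = j₀ + 1 → (j₂ : ℕ) = j₁ + 1 →
        let S := blockCov r ![t j₀, t j₁, t j₂]
        IsUnit S.det ∧ blk S⁻¹ 0 2 = 0 ∧ blk S⁻¹ 2 0 = 0 ∧ blk Q j₁ j₁ = blk S⁻¹ 1 1 ∧
        blk Q j₁ j₂ = blk S⁻¹ 1 2 ∧ blk Q j₂ j₁ = blk S⁻¹ 2 1 ∧
        ((j₂ : ℕ) + 1 = n → blk Q j₂ j₂ = blk S⁻¹ 2 2)) := by
  subst hρ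
  have hU := uniqueDiffOn_of_ordConnected hI hI'
  have hmulti : multiCov N (y 0) = derivCov N y := by
    ext1 s; ext1 t
    exact multiCov_eq_derivCov N y hy s t
  refine ⟨exists_meanSquareDerivSeq hU hu hy hc, (blockCov (derivCov N y) t)⁻¹, ?_⟩
  simp only [hmulti]
  exact ⟨fun D hD => hD.gaussian hU hu hy htI (hr.posDef n t ht.injective),
    hr.isBlockTridiagonal_inv ht, fun j₁ j₂ h₁ h₂ => hr.first_blocks ht j₁ j₂ h₁ h₂,
    fun j₀ j₁ j₂ h₁ h₂ => hr.subsequent_blocks ht j₀ j₁ j₂ h₁ h₂⟩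

/-! ### Reduction of the components to rational spectral densities -/

theorem spectralCov_const_mul_ratDensity (lam : ℕ → ℝ) (M : ℕ) (C : ℝ) (h : ℝ) :
    spectralCov (fun w => C * ratDensity lam M w) h
      = C / Real.sqrt (2 * Real.pi) * spectralOp lam M 1 h := by
  have h1 : ∀ w : ℝ, Complex.exp (Complex.I * w * h) * ((C * ratDensity lam M w : ℝ) : ℂ)
      = (C : ℂ) * spectralIntegrand lam M 1 h w := by
    intro w
    simp only [spectralIntegrand, map_one]
    push_cast
    ring
  rw [spectralCov]
  simp_rw [h1]
  rw [integral_const_mul, Complex.re_ofReal_mul, Complex.re_ofReal_mul, spectralOp]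
  ring

theorem IsCenteredGaussianProcessOn.variance_nonneg {Ω : Type*} [MeasurableSpace Ω]
    {P : Measure Ω} [IsProbabilityMeasure P] {I : Set ℝ} (hI : I.Nonempty) {u : ℝ → Ω → ℝ}
    {ρ : ℝ → ℝ} (hu : IsCenteredGaussianProcessOn P I u ρ) : 0 ≤ ρ 0 := by
  obtain ⟨t, ht⟩ := hI
  have h1 := hu.cov_eq t ht t ht
  rw [sub_self] at h1
  rw [← h1, covariance_self (hu.gaussian.aemeasurable ⟨t, ht⟩)]
  exact ProbabilityTheory.variance_nonneg _ _

/-- A covariance function with a rational spectral density has all the data of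
`precision_of_markov`. -/
theorem exists_markov_of_spectralCov {lam : ℕ → ℝ} (hlam : ∀ l, 0 < lam l) (M : ℕ) (C : ℝ)
    (hC : C ≠ 0) (f : ℝ → ℝ) (hf : ∀ w, f w = C * ratDensity lam M w)
    (h0 : 0 ≤ spectralCov f 0) :
    ∃ y : ℕ → ℝ → ℝ, spectralCov f = y 0 ∧
      (∀ j, j < 2 * M → ∀ h, HasDerivAt (y j) (y (j + 1) h) h) ∧
      (∀ j, 0 < j → j ≤ 2 * M → Continuous (y j)) ∧ IsMarkovCov (derivCov M y) := by
  obtain rfl : f = fun w => C * ratDensity lam M w := funext hf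
  have hpos : 0 < spectralOp lam M 1 0 := by
    have h1 := (posDef_blockCov_derivCov hlam M 1 1 one_pos (fun _ => 0)
      (fun _ _ _ => Subsingleton.elim _ _)).diag_pos (i := (0, 0))
    simpa [blockCov, derivCov] using h1
  rw [spectralCov_const_mul_ratDensity] at h0
  have hsqrt : 0 < Real.sqrt (2 * Real.pi) := by positivity
  -- The variance is the constant times a positive integral, so its nonnegativity together with `C ≠
  -- 0` fixes the sign of `C`.
  have hC' : 0 < C / Real.sqrt (2 * Real.pi) :=
    lt_of_le_of_ne (nonneg_of_mul_nonneg_left h0 hpos) (div_ne_zero hC hsqrt.ne').symm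
  refine ⟨fun j h => C / Real.sqrt (2 * Real.pi) * spectralOp lam M (Polynomial.X ^ j) h, ?_, ?_, ?_,
    isMarkovCov_spectral hlam M _ hC'⟩
  · ext h
    beta_reduce
    rw [spectralCov_const_mul_ratDensity, pow_zero]
  · intro j hj h
    beta_reduce
    rw [pow_succ']
    exact (hasDerivAt_spectralOp hlam M _ (by rw [Polynomial.natDegree_X_pow]; omega) h).const_mul _
  · intro j _ hj
    exact continuous_const.mul
      (continuous_spectralOp hlam M _ (by rw [Polynomial.natDegree_X_pow]; omega))

/-- Clearing powers of `κ²` turns `1 + w² / κ²` into `w² + κ²` and `1 + w² / κ² - p j` into `w² + κ²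
(1 - p j)`; the last node `κ √(1 - p j)` is real and positive because `p j < 1`. The number of
factors is `maxOrder α i + 1`, which for the component `0` uses `⌊α⌋₊ ≥ 1`. -/
theorem exists_specDensity_eq {m : ℕ} (α κ σ k : ℝ) (hα : 1 / 2 < α) (hκ : 0 < κ) (hσ : 0 < σ)
    (c p : Fin m → ℝ) (hk : k ≠ 0) (hc : ∀ j, c j ≠ 0) (hp : ∀ j, p j < 1) (i : Fin (m + 1))
    (hi : ¬(i = 0 ∧ α < 1)) :
    ∃ (lam : ℕ → ℝ) (C : ℝ), (∀ l, 0 < lam l) ∧ C ≠ 0 ∧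
      ∀ w, specDensity α κ σ k c p i w = C * ratDensity lam (maxOrder α i) w := by
  have hA : specConst α κ * σ ^ 2 * κ ^ (-2 * α) ≠ 0 := by
    have h1 : 0 < Real.Gamma (α - 1 / 2 + 1 / 2) := Real.Gamma_pos_of_pos (by linarith)
    have h2 : 0 < Real.Gamma (α - 1 / 2) := Real.Gamma_pos_of_pos (by linarith)
    rw [specConst]
    positivity
  have hκw : ∀ w : ℝ, w ^ 2 + κ ^ 2 ≠ 0 := fun w => by positivity
  have h1w : ∀ w : ℝ, 1 + w ^ 2 / κ ^ 2 = (w ^ 2 + κ ^ 2) / κ ^ 2 := fun w => by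
    field_simp; ring
  rcases Fin.eq_zero_or_eq_succ i with rfl | ⟨j, rfl⟩
  · have hα1 : 1 ≤ α := by
      by_contra! h
      exact hi ⟨rfl, h⟩
    have hfl : 1 ≤ ⌊α⌋₊ := (Nat.one_le_floor_iff α).2 hα1
    refine ⟨fun _ => κ, specConst α κ * σ ^ 2 * κ ^ (-2 * α) * (k * (κ ^ 2) ^ ⌊α⌋₊), fun _ => hκ,
      mul_ne_zero hA (mul_ne_zero hk (by positivity)), fun w => ?_⟩
    simp only [specDensity, maxOrder, Fin.cases_zero, ratDensity, Finset.prod_const,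
      Finset.card_range]
    rw [Nat.sub_add_cancel hfl, h1w, div_pow, mul_assoc]
    have := pow_ne_zero ⌊α⌋₊ (hκw w)
    field_simp
  · have hpj : 0 < 1 - p j := by linarith [hp j]
    refine ⟨fun l => if l < ⌊α⌋₊ then κ else κ * Real.sqrt (1 - p j),
      specConst α κ * σ ^ 2 * κ ^ (-2 * α) * (c j * (κ ^ 2) ^ (⌊α⌋₊ + 1)), fun l => ?_,
      mul_ne_zero hA (mul_ne_zero (hc j) (by positivity)), fun w => ?_⟩
    · have := Real.sqrt_pos.2 hpj
      dsimp only
      split_ifs <;> positivity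
    · simp only [specDensity, maxOrder, Fin.cases_succ, ratDensity]
      rw [Finset.prod_range_succ, Finset.prod_congr rfl (g := fun _ => w ^ 2 + κ ^ 2)
        (fun l hl => by rw [if_pos (Finset.mem_range.1 hl)]), if_neg (lt_irrefl _),
        Finset.prod_const, Finset.card_range, mul_pow, Real.sq_sqrt hpj.le, h1w, div_pow]
      have h2 : (w ^ 2 + κ ^ 2) / κ ^ 2 - p j = (w ^ 2 + κ ^ 2 * (1 - p j)) / κ ^ 2 := by
        field_simp; ring
      have h3 : w ^ 2 + κ ^ 2 * (1 - p j) ≠ 0 := by positivity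
      have := pow_ne_zero ⌊α⌋₊ (hκw w)
      rw [h2]
      field_simp
      ring

/-- The covariance function of each component, with the data of `precision_of_markov`. -/
theorem exists_markov_of_componentCov {m : ℕ} (α κ σ k : ℝ) (hα : 1 / 2 < α) (hκ : 0 < κ)
    (hσ : 0 < σ) (c p : Fin m → ℝ) (hk : k ≠ 0) (hc : ∀ j, c j ≠ 0) (hp : ∀ j, p j < 1)
    (i : Fin (m + 1)) (h0 : 0 ≤ componentCov α κ σ k c p i 0) :
    ∃ y : ℕ → ℝ → ℝ, componentCov α κ σ k c p i = y 0 ∧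
      (∀ j, j < 2 * maxOrder α i → ∀ h, HasDerivAt (y j) (y (j + 1) h) h) ∧
      (∀ j, 0 < j → j ≤ 2 * maxOrder α i → Continuous (y j)) ∧
      IsMarkovCov (derivCov (maxOrder α i) y) := by
  by_cases hi : i = 0 ∧ α < 1
  · have hN : maxOrder α i = 0 := by
      rw [hi.1, maxOrder, Fin.cases_zero, Nat.floor_eq_zero.2 hi.2]
    set v := k * σ ^ 2 * (Real.Gamma α / Real.Gamma (α - 1 / 2) * Real.sqrt (4 * Real.pi) / κ)
      with hv
    have hcov : ∀ h, componentCov α κ σ k c p i h = if h = 0 then v else 0 := fun h => by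
      rw [componentCov, if_pos hi]
    have hv0 : v ≠ 0 := by
      have h1 : 0 < Real.Gamma α := Real.Gamma_pos_of_pos (by linarith)
      have h2 : 0 < Real.Gamma (α - 1 / 2) := Real.Gamma_pos_of_pos (by linarith)
      have h3 : 0 < Real.Gamma α / Real.Gamma (α - 1 / 2) * Real.sqrt (4 * Real.pi) / κ := by
        positivity
      exact mul_ne_zero (mul_ne_zero hk (by positivity)) h3.ne'
    rw [hcov, if_pos rfl] at h0
    refine ⟨fun _ => componentCov α κ σ k c p i, rfl, ?_, ?_, ?_⟩
    · intro j hj; omega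
    · intro j hj hj'; omega
    · rw [hN]
      exact isMarkovCov_whiteNoise _ v (lt_of_le_of_ne h0 hv0.symm) hcov
  · have hcov : componentCov α κ σ k c p i = spectralCov (specDensity α κ σ k c p i) := by
      ext h
      rw [componentCov, if_neg hi]
    rw [hcov] at h0 ⊢
    obtain ⟨lam, C, hlam, hC, hf⟩ := exists_specDensity_eq α κ σ k hα hκ hσ c p hk hc hp i hi
    exact exists_markov_of_spectralCov hlam _ C hC _ hf h0

end RationalMatern

theorem proposition3
    {Ω : Type*} [MeasurableSpace Ω] (P : Measure Ω) [IsProbabilityMeasure P]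
    -- the parameters of the Matérn process
    (α κ σ : ℝ) (hα : 1 / 2 < α) (hαn : ∀ N : ℕ, α ≠ N) (hκ : 0 < κ) (hσ : 0 < σ)
    -- the best rational approximation of order `m`, in partial fractions
    (m : ℕ) (a b : Fin (m + 1) → ℝ) (hab : RationalMatern.IsBestRationalApprox (Int.fract α) a b)
    (k : ℝ) (c p : Fin m → ℝ) (hkcp : RationalMatern.IsPartialFraction a b k c p)
    -- the interval, and the component process `u_i` on it
    (I : Set ℝ) (hI : I.OrdConnected) (hI' : I.Nontrivial)
    (i : Fin (m + 1)) (u : ℝ → Ω → ℝ)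
    (hu : RationalMatern.IsCenteredGaussianProcessOn P I u
      (RationalMatern.componentCov α κ σ k c p i))
    -- the locations
    (n : ℕ) (t : Fin n → ℝ) (ht : StrictMono t) (htI : ∀ j, t j ∈ I) :
    -- the derivatives exist
    (∃ D : ℕ → ℝ → Ω → ℝ,
      RationalMatern.IsMeanSquareDerivSeqOn P I u (RationalMatern.maxOrder α i) D) ∧
    ∃ Q : Matrix (Fin n × Fin (RationalMatern.maxOrder α i + 1))
        (Fin n × Fin (RationalMatern.maxOrder α i + 1)) ℝ,
      let r := RationalMatern.multiCov (RationalMatern.maxOrder α i)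
        (RationalMatern.componentCov α κ σ k c p i)
      -- the vector is centered Gaussian with precision matrix `Q` and covariance blocks `r`
      (∀ D : ℕ → ℝ → Ω → ℝ,
        RationalMatern.IsMeanSquareDerivSeqOn P I u (RationalMatern.maxOrder α i) D →
          RationalMatern.IsCenteredGaussianWithPrecision P
              (RationalMatern.stackedVector (RationalMatern.maxOrder α i) D t) Q ∧
            RationalMatern.covarianceMatrix P
                (RationalMatern.stackedVector (RationalMatern.maxOrder α i) D t) =
              RationalMatern.blockCov r t) ∧
      RationalMatern.IsBlockTridiagonal Q ∧
      -- the first set of blocks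
      (∀ j₁ j₂ : Fin n, (j₁ : ℕ) = 0 → (j₂ : ℕ) = 1 →
        let S := RationalMatern.blockCov r ![t j₁, t j₂]
        IsUnit S.det ∧
        RationalMatern.blk Q j₁ j₁ = RationalMatern.blk S⁻¹ 0 0 ∧
        RationalMatern.blk Q j₁ j₂ = RationalMatern.blk S⁻¹ 0 1 ∧
        RationalMatern.blk Q j₂ j₁ = RationalMatern.blk S⁻¹ 1 0 ∧
        (n = 2 → RationalMatern.blk Q j₂ j₂ = RationalMatern.blk S⁻¹ 1 1)) ∧
      -- the subsequent blocks
      (∀ j₀ j₁ j₂ : Fin n, (j₁ : ℕ) = j₀ + 1 → (j₂ : ℕ) = j₁ + 1 →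
        let S := RationalMatern.blockCov r ![t j₀, t j₁, t j₂]
        IsUnit S.det ∧
        RationalMatern.blk S⁻¹ 0 2 = 0 ∧
        RationalMatern.blk S⁻¹ 2 0 = 0 ∧
        RationalMatern.blk Q j₁ j₁ = RationalMatern.blk S⁻¹ 1 1 ∧
        RationalMatern.blk Q j₁ j₂ = RationalMatern.blk S⁻¹ 1 2 ∧
        RationalMatern.blk Q j₂ j₁ = RationalMatern.blk S⁻¹ 2 1 ∧
        ((j₂ : ℕ) + 1 = n → RationalMatern.blk Q j₂ j₂ = RationalMatern.blk S⁻¹ 2 2)) := by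
  have hθ : 0 < Int.fract α := by
    rw [Int.fract_pos]
    intro h
    refine hαn ⌊α⌋₊ ?_
    rw [natCast_floor_eq_intCast_floor (by linarith), ← h]
  have hθ1 := Int.fract_lt_one α
  -- The approximation argument shows only that `k` and `c i` are nonzero. Their sign is settled by
  -- the existence of `u`, through its nonnegative variance.
  have hu0 := hu.variance_nonneg hI'.nonempty
  obtain ⟨y, hρ, hy, hc, hr⟩ := RationalMatern.exists_markov_of_componentCov α κ σ k hα hκ hσ c p
    (hkcp.const_ne_zero hθ hθ1 hab) (hkcp.residue_ne_zero hθ hθ1 hab)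
    (hkcp.pole_lt_one hθ hθ1 hab) i hu0
  exact RationalMatern.precision_of_markov P hI hI' u _ hu _ y hρ hy hc hr n t ht htI
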